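/- \textbf{Setting.} Let $T>0$, $\Omega=(0,1)$, $Q=\Omega\times(0,T)$. Let $a\in C([0,1])\cap C^1((0,1])$ satisfy $a>0$ on $(0,1]$, $a(0)=0$, $a(xy)=a(x)a(y)$ for $x,y\in[0,1]$, and $x a'(x)\le K a(x)$ on $(0,1]$ for some $K\in(0,1)$. Let $\ell\in C^1([0,T])$ be positive; if $\ell$ takes values larger than $1$, $a$ is also defined there and $a(\ell(t)x)=a(\ell(t))a(x)$ for $t\in[0,T]$, $x\in[0,1]$. Put $$b(t)=\frac{a(\ell(t))}{\ell(t)^2},\qquad B(x,t)=\frac{\ell'(t)\,x}{\ell(t)\sqrt{a(x)}}.$$ Let $F_1,F_2\in C^2(\mathbb R^2)$ have bounded first and second derivatives and $F_i(0,0)=0$. Let $\mathcal O,\mathcal O_1,\mathcal O_2,\mathcal O_{1,d},\mathcal O_{2,d}\subset\Omega$ be measurable (for instance open; $\mathcal O_{1,d}=\mathcal O_{2,d}$ is allowed), $\alpha_i>0$, $\mu_i>0$, and $y^i_{k,d}\in L^2(\mathcal O_{i,d}\times(0,T))$ for $i,k\in\{1,2\}$. Let $\rho_*\in C^\infty((0,T))$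 be positive with $\rho_*(t)\to+\infty$ as $t\to0^+$ and as $t\to T^-$. Let $H^1_a(\Omega)$ be the space of absolutely continuous $u$ on $[0,1]$ with $u(0)=u(1)=0$ and $\sqrt a\,u_x\in L^2(\Omega)$, and let $\mathbb H$ be the space of pairs of functions in $C([0,T];L^2(\Omega))\cap L^2(0,T;H^1_a(\Omega))$. Let $y_1^0,y_2^0\in H^1_a(\Omega)$ and $h\in L^2(\mathcal O\times(0,T))$. For $v^i\in L^2(\mathcal O_i\times(0,T))$ let $y=(y_1,y_2)\in\mathbb H$ be the weak solution (tested with $H^1_a(\Omega)$) of $$\begin{cases} y_{1t}-b(t)(a(x)y_{1x})_x-B\sqrt a\,y_{1x}+F_1(y_1,y_2)=h\mathbb 1_{\mathcal O}+v^1\mathbb 1_{\mathcal O_1}+v^2\mathbb 1_{\mathcal O_2} & \text{in }Q,\\ y_{2t}-b(t)(a(x)y_{2x})_x-B\sqrt a\,y_{2x}+F_2(y_1,y_2)=0 & \text{in }Q,\\ y_k(0,t)=y_k(1,t)=0 \ \text{on }(0,T),\qquad y_k(\cdot,0)=y_k^0 \ \text{in }\Omega,\qquad k=1,2,\end{cases}\tag{1}$$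 and, for $i=1,2$, $$J_i(h,v^1,v^2)=\frac{\alpha_i}2\iint_{\mathcal O_{i,d}\times(0,T)}\big(|y_1-y^i_{1,d}|^2+|y_2-y^i_{2,d}|^2\big)\,dx\,dt+\frac{\mu_i}2\iint_{\mathcal O_i\times(0,T)}\rho_*^2|v^i|^2\,dx\,dt .$$ The pair $(v^1,v^2)$ is a \emph{Nash quasi-equilibrium} for $(J_1,J_2)$ if $\rho_*v^i\in L^2(\mathcal O_i\times(0,T))$ for $i=1,2$ (the control costs are finite) and $$\frac{d}{d\lambda}J_1(h,v^1+\lambda w,v^2)\Big|_{\lambda=0}=0,\qquad \frac{d}{d\lambda}J_2(h,v^1,v^2+\lambda w)\Big|_{\lambda=0}=0$$ for every $w\in L^2(\mathcal O_1\times(0,T))$, respectively $w\in L^2(\mathcal O_2\times(0,T))$, with $\rho_*w$ in the same space. \textbf{Proposition.} Let $\mu_1,\mu_2>0$ be arbitrary (in particular, sufficiently large) and let $(v^1,v^2)\in L^2(\mathcal O_1\times(0,T))\times L^2(\mathcal O_2\times(0,T))$. Then $(v^1,v^2)$ is a Nash quasi-equilibrium for $(J_1,J_2)$ if and only if there exist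 $y=(y_1,y_2)\in\mathbb H$ and $p^i=(p^i_1,p^i_2)\in\mathbb H$, $i=1,2$, such that $$v^i=-\frac1{\mu_i}\rho_*^{-2}p^i_1\mathbb 1_{\mathcal O_i}\quad\text{a.e. in }\mathcal O_i\times(0,T),\qquad i=1,2,$$ and $(y,p^1,p^2)$ is a weak solution of the optimality system consisting of (1) with $v^i$ replaced by $-\frac1{\mu_i}\rho_*^{-2}p^i_1$ and, for $i=1,2$, $$\begin{cases} -p^i_{1t}-b(t)(a(x)p^i_{1x})_x+(B\sqrt a\,p^i_1)_x+D_1F_1(y_1,y_2)p^i_1+D_1F_2(y_1,y_2)p^i_2=\alpha_i(y_1-y^i_{1,d})\mathbb 1_{\mathcal O_{i,d}} & \text{in }Q,\\ -p^i_{2t}-b(t)(a(x)p^i_{2x})_x+(B\sqrt a\,p^i_2)_x+D_2F_1(y_1,y_2)p^i_1+D_2F_2(y_1,y_2)p^i_2=\alpha_i(y_2-y^i_{2,d})\mathbb 1_{\mathcal O_{i,d}} & \text{in }Q,\\ p^i_k(0,t)=p^i_k(1,t)=0\ \text{on }(0,T),\qquad p^i_k(\cdot,T)=0\ \text{in }\Omega,\qquad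 k=1,2.\end{cases}$$ -/

import Mathlib

open MeasureTheory Set Filter Topology
open scoped ContDiff

noncomputable section

namespace StackelbergNash

/-- The partial derivative `D_{j+1} G` of a function of two real variables (`j = 0, 1`). -/
def pd (j : Fin 2) (G : ℝ × ℝ → ℝ) (z : ℝ × ℝ) : ℝ :=
  fderiv ℝ G z (if j = 0 then (1, 0) else (0, 1))

/-- The space interval `Ω = (0,1)`. -/
abbrev Om : Set ℝ := Ioo 0 1

/-- The data of the control problem on the cylinder `Q = (0,1) × (0,T)`.  Space-time functions take
the argument `(x, t)`; indices `1, 2` of the mathematics are `0, 1 : Fin 2`. -/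
structure Data where
  /-- final time -/
  T : ℝ
  /-- degenerate diffusion coefficient -/
  a : ℝ → ℝ
  /-- length of the moving interval -/
  ell : ℝ → ℝ
  /-- coupling nonlinearities `F₁, F₂` -/
  F : Fin 2 → ℝ × ℝ → ℝ
  /-- control region of the leader -/
  O : Set ℝ
  /-- control regions of the followers -/
  Of : Fin 2 → Set ℝ
  /-- observation regions of the followers -/
  Od : Fin 2 → Set ℝ
  /-- weights of the observation terms -/
  α : Fin 2 → ℝ
  /-- weights of the control terms -/
  μ : Fin 2 → ℝ
  /-- the weight function `ρ_*` of time -/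
  ρ : ℝ → ℝ
  /-- targets: `yd i k` is the target of follower `i` for the `k`-th component -/
  yd : Fin 2 → Fin 2 → ℝ × ℝ → ℝ
  /-- initial state -/
  y0 : Fin 2 → ℝ → ℝ

/-- `u` is (a.e. equal to) an element of `H¹_a(0,1)` and `g` is its derivative: `u` is absolutely
continuous on `[0,1]` with derivative `g`, `u(0) = u(1) = 0` and `√a g ∈ L²(0,1)`. -/
structure MemHa (a : ℝ → ℝ) (u g : ℝ → ℝ) : Prop where
  integrable : IntegrableOn g Om
  weighted : MemLp (fun x => √(a x) * g x) 2 (volume.restrict Om)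
  eq_integral : ∀ᵐ x ∂volume.restrict Om, u x = ∫ r in Ioo 0 x, g r
  integral_eq_zero : ∫ r in Om, g r = 0

/-- `u` belongs to `C([0,T]; L²(0,1)) ∩ L²(0,T; H¹_a(0,1))` and `g` is its space derivative. -/
structure MemH (a : ℝ → ℝ) (T : ℝ) (u g : ℝ × ℝ → ℝ) : Prop where
  memLp : MemLp u 2 (volume.restrict (Om ×ˢ Ioo 0 T))
  weighted : MemLp (fun z => √(a z.1) * g z) 2 (volume.restrict (Om ×ˢ Ioo 0 T))
  slice : ∀ᵐ t ∂volume.restrict (Ioo 0 T), MemHa a (fun x => u (x, t)) (fun x => g (x, t))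
  memLp_slice : ∀ t ∈ Icc 0 T, MemLp (fun x => u (x, t)) 2 (volume.restrict Om)
  continuous : ∀ t ∈ Icc 0 T,
    Tendsto (fun s => eLpNorm (fun x => u (x, s) - u (x, t)) 2 (volume.restrict Om))
      (𝓝[Icc 0 T] t) (𝓝 0)

namespace Data

variable (D : Data)

/-- `b(t) = a(ℓ(t)) / ℓ(t)²`. -/
def b (t : ℝ) : ℝ := D.a (D.ell t) / D.ell t ^ 2

/-- `B(x,t) = ℓ'(t) x / (ℓ(t) √a(x))`. -/
def B (x t : ℝ) : ℝ :=
  derivWithin D.ell (Icc 0 D.T) t * x / (D.ell t * √(D.a x))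

/-- The standing assumptions. -/
structure Assumptions : Prop where
  T_pos : 0 < D.T
  a_cont : ContinuousOn D.a (Icc 0 1)
  a_C1 : ContDiffOn ℝ 1 D.a (Ioc 0 1)
  a_pos : ∀ x ∈ Ioc (0 : ℝ) 1, 0 < D.a x
  a_zero : D.a 0 = 0
  a_weak : ∃ K ∈ Ioo (0 : ℝ) 1, ∀ x ∈ Ioc (0 : ℝ) 1,
    x * derivWithin D.a (Ioc 0 1) x ≤ K * D.a x
  a_mul : ∀ x ∈ Icc (0 : ℝ) 1, ∀ y ∈ Icc (0 : ℝ) 1, D.a (x * y) = D.a x * D.a y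
  ell_C1 : ContDiffOn ℝ 1 D.ell (Icc 0 D.T)
  ell_pos : ∀ t ∈ Icc 0 D.T, 0 < D.ell t
  /-- Follows from `a_mul` when `ℓ ≤ 1`; for `ℓ(t) > 1` it is what multiplicativity of `a` means on
  the moving interval `(0, ℓ(t))`, where the diffusion coefficient is defined. -/
  a_ell : ∀ t ∈ Icc 0 D.T, ∀ x ∈ Icc (0 : ℝ) 1, D.a (D.ell t * x) = D.a (D.ell t) * D.a x
  F_zero : ∀ i, D.F i (0, 0) = 0
  F_C2 : ∀ i, ContDiff ℝ 2 (D.F i)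
  F_bound : ∃ M > 0, ∀ i z,
    ∑ j, |pd j (D.F i) z| + ∑ j, ∑ k, |pd k (pd j (D.F i)) z| ≤ M
  O_meas : MeasurableSet D.O
  O_sub : D.O ⊆ Om
  Of_meas : ∀ i, MeasurableSet (D.Of i)
  Of_sub : ∀ i, D.Of i ⊆ Om
  Od_meas : ∀ i, MeasurableSet (D.Od i)
  Od_sub : ∀ i, D.Od i ⊆ Om
  α_pos : ∀ i, 0 < D.α i
  μ_pos : ∀ i, 0 < D.μ i
  ρ_smooth : ContDiffOn ℝ ∞ D.ρ (Ioo 0 D.T)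
  ρ_pos : ∀ t ∈ Ioo 0 D.T, 0 < D.ρ t
  ρ_zero : Tendsto D.ρ (𝓝[>] 0) atTop
  ρ_T : Tendsto D.ρ (𝓝[<] D.T) atTop
  yd_memLp : ∀ i k, MemLp (D.yd i k) 2 (volume.restrict (D.Od i ×ˢ Ioo 0 D.T))
  y0_mem : ∀ k, ∃ g, MemHa D.a (D.y0 k) g

/-- `u ∈ C([0,T];L²) ∩ L²(0,T;H¹_a)` is the weak solution of
`u_t - b (a u_x)_x - B √a u_x = f` in `Q`, `u(0,t) = u(1,t) = 0`, `u(·,0) = u₀`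
(tested with `φ ∈ H¹_a(0,1)` and integrated over `(0,t)`). -/
def IsForwardSol (u₀ : ℝ → ℝ) (f u : ℝ × ℝ → ℝ) : Prop :=
  ∃ ux : ℝ × ℝ → ℝ, MemH D.a D.T u ux ∧
    ∀ φ φx : ℝ → ℝ, MemHa D.a φ φx → ∀ t ∈ Icc 0 D.T,
      (∫ x in Om, u (x, t) * φ x) - (∫ x in Om, u₀ x * φ x)
        + ∫ z in Om ×ˢ Ioo 0 t,
            (D.b z.2 * D.a z.1 * ux z * φx z.1 - D.B z.1 z.2 * √(D.a z.1) * ux z * φ z.1)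
        = ∫ z in Om ×ˢ Ioo 0 t, f z * φ z.1

/-- `p ∈ C([0,T];L²) ∩ L²(0,T;H¹_a)` is the weak solution of
`-p_t - b (a p_x)_x + (B √a p)_x = f` in `Q`, `p(0,t) = p(1,t) = 0`, `p(·,T) = 0`
(tested with `φ ∈ H¹_a(0,1)` and integrated over `(t,T)`). -/
def IsBackwardSol (f p : ℝ × ℝ → ℝ) : Prop :=
  ∃ px : ℝ × ℝ → ℝ, MemH D.a D.T p px ∧
    ∀ φ φx : ℝ → ℝ, MemHa D.a φ φx → ∀ t ∈ Icc 0 D.T,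
      (∫ x in Om, p (x, t) * φ x)
        + ∫ z in Om ×ˢ Ioo t D.T,
            (D.b z.2 * D.a z.1 * px z * φx z.1 - D.B z.1 z.2 * √(D.a z.1) * p z * φx z.1)
        = ∫ z in Om ×ˢ Ioo t D.T, f z * φ z.1

/-- `y = (y₁, y₂)` solves the state system with leader control `h` and follower controls
`v = (v¹, v²)`. -/
def IsState (h : ℝ × ℝ → ℝ) (v : Fin 2 → ℝ × ℝ → ℝ) (y : Fin 2 → ℝ × ℝ → ℝ) : Prop :=
  D.IsForwardSol (D.y0 0)
    (fun z => (D.O.indicator 1 z.1 : ℝ) * h z + ∑ i, ((D.Of i).indicator 1 z.1 : ℝ) * v i z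
      - D.F 0 (y 0 z, y 1 z)) (y 0) ∧
  D.IsForwardSol (D.y0 1) (fun z => - D.F 1 (y 0 z, y 1 z)) (y 1)

/-- `q = (q₁, q₂)` solves the adjoint system of follower `i` along the state `y`. -/
def IsAdjoint (y : Fin 2 → ℝ × ℝ → ℝ) (i : Fin 2) (q : Fin 2 → ℝ × ℝ → ℝ) : Prop :=
  ∀ k, D.IsBackwardSol
    (fun z => D.α i * (y k z - D.yd i k z) * ((D.Od i).indicator 1 z.1 : ℝ)
      - ∑ j, pd k (D.F j) (y 0 z, y 1 z) * q j z) (q k)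

/-- The state associated with the controls `h, v` (unique up to null sets). -/
def state (h : ℝ × ℝ → ℝ) (v : Fin 2 → ℝ × ℝ → ℝ) : Fin 2 → ℝ × ℝ → ℝ :=
  Classical.epsilon (D.IsState h v)

/-- The cost functional `J_i(h, v¹, v²)`. -/
def J (i : Fin 2) (h : ℝ × ℝ → ℝ) (v : Fin 2 → ℝ × ℝ → ℝ) : ℝ :=
  D.α i / 2 * (∫ z in D.Od i ×ˢ Ioo 0 D.T, ∑ k, (D.state h v k z - D.yd i k z) ^ 2)
    + D.μ i / 2 * ∫ z in D.Of i ×ˢ Ioo 0 D.T, D.ρ z.2 ^ 2 * v i z ^ 2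

/-- `w ∈ L²(O_i × (0,T))` with finite control cost, i.e. `ρ_* w ∈ L²(O_i × (0,T))`.  As `ρ_*` blows
up at `0` and `T`, these are the controls at which `J_i` is finite. -/
def Admissible (i : Fin 2) (w : ℝ × ℝ → ℝ) : Prop :=
  MemLp w 2 (volume.restrict (D.Of i ×ˢ Ioo 0 D.T)) ∧
  MemLp (fun z => D.ρ z.2 * w z) 2 (volume.restrict (D.Of i ×ˢ Ioo 0 D.T))

/-- Nash quasi-equilibrium for `(J₁, J₂)`, given `h`: for each `i` the directional derivative of
`J_i` with respect to its own control vanishes in every direction. -/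
def IsNashQuasiEquilibrium (h : ℝ × ℝ → ℝ) (v : Fin 2 → ℝ × ℝ → ℝ) : Prop :=
  ∀ i, D.Admissible i (v i) ∧
    ∀ w, D.Admissible i w →
      HasDerivAt (fun s : ℝ => D.J i h (Function.update v i (v i + s • w))) 0 0

end Data

end StackelbergNash

end

/-! The heart of the matter is a first order expansion of `J_i` in its own control. If `y` is a
state for `v`, `p` an adjoint state along `y`, and `y'` the state for the control `v^i + s w`, then
the exact difference `δ = y' - y` solves a linear problem with source `s w 1_{O_i}` minus `F(y') -
F(y)`. Pairing it with `p` cancels the terms `DF(y) δ` and leaves `α_i ∫ (y - y_d) δ = s ∫ p_1 w - ∫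
R · p`, where `R` is the Taylor remainder of `F` (`integral_observation`). No linearised state is
needed: it suffices that `R` and the square of `δ` are `O(s²)`. Hence the derivative of `J_i` in the
direction `w` is `∫ (p_1 + μ_i ρ² v^i) w` over `O_i × (0,T)` (`hasDerivAt_J`). It vanishes for all
admissible `w` exactly when `p_1 + μ_i ρ² v^i = 0` a.e.; the direction that shows this is damped by
`1 + ρ²` so as to have finite cost, and conversely the formula for `v^i` yields a finite cost
because `ρ` is bounded below.

The remainder is quadratic in `δ`, so a pointwise bound on `δ` is wanted. It is available because
the degeneracy is weak: `x a' ≤ K a` and `a(1) = 1` give `a ≥ x^K` with `K < 1`, so `1/a` is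
integrable, `H¹_a` embeds into `L^∞`, and the energy estimate for `sup_t ∫ a δ_x²` becomes `|δ|² ≤ C
s²` a.e. (`exists_state_stability`).

Well-posedness rests on the same integrability. The embedding of `H¹_a` into `L²` has a square
integrable kernel, hence is compact, and its singular vectors are eigenfunctions of `-(a u')'`. As
`b` depends on time only, the principal part decouples into scalar equations `c' + λ b c = f` with
estimates uniform in `λ`; Parseval's identity turns these into existence, energy bounds and duality
for the degenerate heat equation. The drift coefficient is `B √a = (ℓ'/ℓ) x` and `x ≤ √a`, so the
drift and the nonlinearities are Lipschitz sources controlled by the energy, and a contraction in an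
exponentially weighted norm solves the full systems (`exists_semilinear`). The adjoint system
reduces to the same form by integrating its drift by parts and reversing time. -/

namespace StackelbergNash

open scoped InnerProductSpace

/-! ### Spectral theory of compact operators in Hilbert spaces -/

/-- An orthonormal family in a separable space is countable. -/
theorem countable_of_orthonormal {H : Type} [NormedAddCommGroup H] [InnerProductSpace ℝ H]
    [TopologicalSpace.SeparableSpace H] {ι : Type} {e : ι → H}
    (he : Orthonormal ℝ e) : Countable ι := by
  refine Pairwise.countable_of_isOpen_disjoint (s := fun i => Metric.ball (e i) (1 / 2))
    (fun i j hij => ?_) (fun i => Metric.isOpen_ball)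
    (fun i => ⟨e i, Metric.mem_ball_self (by norm_num)⟩)
  -- Distinct members are at distance `√2`, which exceeds `1/2 + 1/2`.
  refine Metric.ball_disjoint_ball ?_
  have h : ‖e i - e j‖ ^ 2 = 2 := by
    rw [norm_sub_sq_real, he.1 i, he.1 j, he.2 hij]; norm_num
  rw [dist_eq_norm]
  nlinarith [norm_nonneg (e i - e j)]

section Hilbert

variable {W H : Type} [NormedAddCommGroup W] [InnerProductSpace ℝ W] [CompleteSpace W]
  [NormedAddCommGroup H] [InnerProductSpace ℝ H] [CompleteSpace H]

/-- A compact symmetric operator has a Hilbert basis of eigenvectors. -/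
theorem exists_hilbertBasis_eigenvectors (A : H →L[ℝ] H) (hA : IsCompactOperator A)
    (hs : (A : H →ₗ[ℝ] H).IsSymmetric) :
    ∃ (ι : Type) (E : HilbertBasis ι ℝ H) (ν : ι → ℝ), ∀ i, A (E i) = ν i • E i := by
  -- All real `μ` occur, including `0`, so the kernel of `A` also receives a basis and `A` need not
  -- be injective.
  let F : ℝ → Submodule ℝ H := fun μ => Module.End.eigenspace (A : Module.End ℝ H) μ
  have hc : ∀ μ, CompleteSpace (F μ) := fun μ => by
    refine IsClosed.completeSpace_coe (hs := ?_)
    have : (F μ : Set H) = {x | A x = μ • x} := by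
      ext x; exact Module.End.mem_eigenspace_iff
    rw [this]
    exact isClosed_eq A.continuous (continuous_const_smul μ)
  have hch : ∀ μ, ∃ (s : Set (F μ)) (b : HilbertBasis s ℝ (F μ)), ⇑b = ((↑) : s → F μ) :=
    fun μ => exists_hilbertBasis ℝ (F μ)
  choose s b hb using hch
  have hF : OrthogonalFamily ℝ (fun μ => F μ) (fun μ => (F μ).subtypeₗᵢ) :=
    hs.orthogonalFamily_eigenspaces
  have ho : Orthonormal ℝ fun i : Σ μ, s μ => (b i.1 i.2 : H) :=
    hF.orthonormal_sigma_orthonormal (v_family := fun μ => b μ) fun μ => (b μ).orthonormal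
  have hbot : (Submodule.span ℝ (range fun i : Σ μ, s μ => (b i.1 i.2 : H)))ᗮ = ⊥ := by
    rw [eq_bot_iff, ← ContinuousLinearMap.orthogonalComplement_iSup_eigenspaces_eq_bot hA hs]
    rw [← Submodule.orthogonal_closure]
    refine Submodule.orthogonal_le ?_
    rw [iSup_le_iff]
    intro μ x hx
    have h1 := (b μ).hasSum_repr ⟨x, hx⟩
    have h2 := h1.mapL (F μ).subtypeL
    refine Submodule.isClosed_topologicalClosure _ |>.mem_of_tendsto h2 ?_
    refine Eventually.of_forall fun t => ?_
    refine Submodule.sum_mem _ fun i _ => ?_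
    simp only [map_smul]
    exact Submodule.smul_mem _ _
      (Submodule.le_topologicalClosure _ (Submodule.subset_span ⟨⟨μ, i⟩, rfl⟩))
  refine ⟨Σ μ, s μ, HilbertBasis.mkOfOrthogonalEqBot ho hbot, fun i => i.1, fun i => ?_⟩
  rw [HilbertBasis.coe_mkOfOrthogonalEqBot]
  exact Module.End.mem_eigenspace_iff.1 (b i.1 i.2).2

/-- Singular value decomposition of an injective compact operator with dense range. -/
theorem exists_singular_basis [TopologicalSpace.SeparableSpace H] (K : W →L[ℝ] H)
    (hK : IsCompactOperator K) (hinj : Function.Injective K)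
    (hdense : ∀ v : H, (∀ w, ⟪v, K w⟫_ℝ = 0) → v = 0) :
    ∃ (ι : Type) (_ : Countable ι) (E : HilbertBasis ι ℝ H) (Ψ : HilbertBasis ι ℝ W) (σ : ι → ℝ),
      (∀ i, 0 < σ i) ∧ (∀ i, K (Ψ i) = σ i • E i) ∧
      ∀ i w, ⟪E i, K w⟫_ℝ = σ i * ⟪Ψ i, w⟫_ℝ := by
  -- Eigenvectors of `K K*` are the left singular vectors, and the normalised `K* E_i` the right
  -- ones. Density of the range of `K` makes `K*` injective, so `σ_i > 0`; injectivity of `K` makes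
  -- the right singular vectors complete.
  let A : H →L[ℝ] H := K ∘L K.adjoint
  have hA : IsCompactOperator A := hK.comp_clm _
  have hs : (A : H →ₗ[ℝ] H).IsSymmetric := fun x y => by
    change ⟪K (K.adjoint x), y⟫_ℝ = ⟪x, K (K.adjoint y)⟫_ℝ
    rw [← ContinuousLinearMap.adjoint_inner_right, ContinuousLinearMap.adjoint_inner_left]
  obtain ⟨ι, E, ν, hE⟩ := exists_hilbertBasis_eigenvectors A hA hs
  have hν : ∀ i, ν i = ‖K.adjoint (E i)‖ ^ 2 := fun i => by
    have h1 : ⟪E i, A (E i)⟫_ℝ = ν i := by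
      rw [hE, real_inner_smul_right, real_inner_self_eq_norm_sq, E.orthonormal.1 i]; simp
    rw [← h1, ← real_inner_self_eq_norm_sq]
    exact (ContinuousLinearMap.adjoint_inner_left K _ _).symm
  have hne : ∀ i, K.adjoint (E i) ≠ 0 := fun i h0 => by
    have : E i = 0 := hdense _ fun w => by
      rw [← ContinuousLinearMap.adjoint_inner_left, h0, inner_zero_left]
    have h1 := E.orthonormal.1 i
    rw [this] at h1; simp at h1
  let σ : ι → ℝ := fun i => ‖K.adjoint (E i)‖
  have hσ : ∀ i, 0 < σ i := fun i => norm_pos_iff.2 (hne i)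
  let ψ : ι → W := fun i => (σ i)⁻¹ • K.adjoint (E i)
  have hEK : ∀ i w, ⟪E i, K w⟫_ℝ = σ i * ⟪ψ i, w⟫_ℝ := fun i w => by
    rw [real_inner_smul_left, ← ContinuousLinearMap.adjoint_inner_left, ← mul_assoc,
      mul_inv_cancel₀ (hσ i).ne', one_mul]
  have hKψ : ∀ i, K (ψ i) = σ i • E i := fun i => by
    simp only [ψ, map_smul]
    have : K (K.adjoint (E i)) = ν i • E i := hE i
    rw [this, hν, smul_smul]
    congr 1
    have := (hσ i).ne'
    simp only [σ] at this ⊢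
    field_simp
  have ho : Orthonormal ℝ ψ := by
    classical
    rw [orthonormal_iff_ite]
    intro i j
    have h1 := hEK i (ψ j)
    rw [hKψ, real_inner_smul_right, orthonormal_iff_ite.1 E.orthonormal i j] at h1
    split_ifs at h1 ⊢ with h
    · subst h
      have := (hσ i).ne'
      field_simp at h1
      linarith
    · have := (hσ i).ne'
      simpa [this] using h1
  have hbot : (Submodule.span ℝ (range ψ))ᗮ = ⊥ := by
    rw [eq_bot_iff]
    intro w hw
    rw [Submodule.mem_bot]
    apply hinj
    rw [map_zero]
    apply E.repr.injective
    ext i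
    rw [E.repr_apply_apply, hEK, (Submodule.mem_orthogonal _ _).1 hw (ψ i)
      (Submodule.subset_span ⟨i, rfl⟩)]
    simp
  refine ⟨ι, countable_of_orthonormal E.orthonormal, E,
    HilbertBasis.mkOfOrthogonalEqBot ho hbot, σ, hσ, ?_, ?_⟩
  · intro i; rw [HilbertBasis.coe_mkOfOrthogonalEqBot]; exact hKψ i
  · intro i w; rw [HilbertBasis.coe_mkOfOrthogonalEqBot]; exact hEK i w

end Hilbert

/-- A curve given by continuous coordinates that are dominated in `ℓ²` is continuous. -/
theorem exists_continuous_curve {W : Type} [NormedAddCommGroup W] [InnerProductSpace ℝ W]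
    {ι : Type} (E : HilbertBasis ι ℝ W) {c : ι → ℝ → ℝ}
    {m : ι → ℝ} (hc : ∀ i, Continuous (c i)) (hm : Summable m) (hcm : ∀ i t, c i t ^ 2 ≤ m i) :
    ∃ w : ℝ → W, Continuous w ∧ ∀ i t, ⟪E i, w t⟫_ℝ = c i t := by
  have hmem : ∀ t, Memℓp (fun i => c i t) 2 := fun t => by
    refine memℓp_gen ?_
    refine Summable.of_nonneg_of_le (fun i => by positivity) (fun i => ?_) hm
    simpa using hcm i t
  refine ⟨fun t => E.repr.symm ⟨_, hmem t⟩, ?_, fun i t => ?_⟩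
  · refine E.repr.symm.continuous.comp ?_
    rw [continuous_iff_continuousAt]
    intro s
    rw [ContinuousAt, tendsto_iff_norm_sub_tendsto_zero]
    -- The sum is `‖w t - w s‖²`; each term tends to zero and is at most `4 m i`.
    have key : Tendsto (fun t => ∑' i, (c i t - c i s) ^ 2) (𝓝 s) (𝓝 (∑' i : ι, (0 : ℝ))) := by
      refine tendsto_tsum_of_dominated_convergence (bound := fun i => 4 * m i)
        (hm.mul_left 4) (fun i => ?_) (Eventually.of_forall fun t i => ?_)
      · have h : Continuous fun t => (c i t - c i s) ^ 2 := by fun_prop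
        simpa using h.tendsto s
      · rw [Real.norm_eq_abs, abs_of_nonneg (sq_nonneg _)]
        nlinarith [hcm i t, hcm i s, sq_nonneg (c i t + c i s)]
    rw [tsum_zero] at key
    have h2 := (Real.continuous_sqrt.tendsto 0).comp key
    rw [Real.sqrt_zero] at h2
    refine h2.congr fun t => ?_
    rw [Function.comp, Real.sqrt_eq_iff_mul_self_eq (tsum_nonneg fun i => sq_nonneg _)
      (norm_nonneg _), ← sq, ← real_inner_self_eq_norm_sq, lp.inner_eq_tsum]
    refine tsum_congr fun i => ?_
    rw [sq]
    rfl
  · rw [← E.repr_apply_apply, LinearIsometryEquiv.apply_symm_apply]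

/-! ### Hilbert–Schmidt operators -/

section Kernel

variable {α : Type} [MeasurableSpace α] {ν : Measure α} {H : Type} [NormedAddCommGroup H]
  [InnerProductSpace ℝ H]

/-- The operator `w ↦ (x ↦ ⟪k x, w⟫)` with a square integrable kernel `k`. -/
noncomputable def kernelOp (k : Lp H 2 ν) : H →L[ℝ] Lp ℝ 2 ν :=
  LinearMap.mkContinuous
    { toFun := fun w => (innerSL ℝ w).compLp k
      map_add' := fun w w' => by rw [map_add, ContinuousLinearMap.add_compLp]
      map_smul' := fun c w => by
        rw [map_smul, ContinuousLinearMap.smul_compLp]; rfl }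
    ‖k‖ fun w => by
      refine (ContinuousLinearMap.norm_compLp_le _ _).trans ?_
      rw [innerSL_apply_norm, mul_comm]

theorem coeFn_kernelOp (k : Lp H 2 ν) (w : H) : kernelOp k w =ᵐ[ν] fun x => ⟪k x, w⟫_ℝ := by
  filter_upwards [ContinuousLinearMap.coeFn_compLp (innerSL ℝ w) k] with x hx
  rw [real_inner_comm]
  exact hx

theorem kernelOp_add (k k' : Lp H 2 ν) : kernelOp (k + k') = kernelOp k + kernelOp k' := by
  ext1 w
  exact map_add ((innerSL ℝ w).compLpₗ 2 ν) k k'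

theorem kernelOp_sub (k k' : Lp H 2 ν) : kernelOp (k - k') = kernelOp k - kernelOp k' := by
  ext1 w
  exact map_sub ((innerSL ℝ w).compLpₗ 2 ν) k k'

theorem norm_kernelOp_le (k : Lp H 2 ν) : ‖kernelOp k‖ ≤ ‖k‖ :=
  LinearMap.mkContinuous_norm_le _ (norm_nonneg _) _

/-- Operators with square integrable kernel are compact. -/
theorem isCompactOperator_kernelOp (k : Lp H 2 ν) : IsCompactOperator (kernelOp k) := by
  -- Indicator functions times a fixed vector give operators of rank at most one. The general case
  -- is a norm limit, since the operator norm is bounded by the `L²` norm of the kernel and compact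
  -- operators form a closed set.
  refine Lp.induction (by norm_num) (fun k : Lp H 2 ν => IsCompactOperator (kernelOp k))
    ?_ ?_ ?_ k
  · intro c s hs hμ
    have : kernelOp (Lp.simpleFunc.indicatorConst 2 hs hμ.ne c : Lp H 2 ν)
        = (ContinuousLinearMap.toSpanSingleton ℝ (indicatorConstLp 2 hs hμ.ne (1 : ℝ))) ∘L
          (innerSL ℝ c) := by
      ext1 w
      refine Lp.ext ?_
      refine (coeFn_kernelOp _ _).trans ?_
      rw [ContinuousLinearMap.comp_apply, ContinuousLinearMap.toSpanSingleton_apply]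
      rw [Lp.simpleFunc.coe_indicatorConst]
      filter_upwards [Lp.coeFn_smul (innerSL ℝ c w) (indicatorConstLp 2 hs hμ.ne (1 : ℝ)),
        indicatorConstLp_coeFn (p := 2) (hs := hs) (hμs := hμ.ne) (c := c),
        indicatorConstLp_coeFn (p := 2) (hs := hs) (hμs := hμ.ne) (c := (1 : ℝ))] with x h1 h2 h3
      rw [h1, h2, Pi.smul_apply, h3]
      by_cases hx : x ∈ s <;> simp [hx]
    rw [this]
    have h1 : IsCompactOperator
        (ContinuousLinearMap.toSpanSingleton ℝ (indicatorConstLp 2 hs hμ.ne (1 : ℝ))) :=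
      isCompactOperator_of_locallyCompactSpace_rng
        (ContinuousLinearMap.toSpanSingleton ℝ (indicatorConstLp 2 hs hμ.ne (1 : ℝ)))
    exact h1.comp_clm (innerSL ℝ c)
  · intro f g hf hg _ h1 h2
    rw [kernelOp_add]
    exact h1.add h2
  · have hcont : Continuous (kernelOp (ν := ν) (H := H)) := by
      refine LipschitzWith.continuous (K := 1) (LipschitzWith.of_dist_le_mul fun k k' => ?_)
      rw [dist_eq_norm, dist_eq_norm, ← kernelOp_sub, NNReal.coe_one, one_mul]
      exact norm_kernelOp_le _
    exact isClosed_setOfPred_isCompactOperator.preimage hcont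

end Kernel

theorem integral_inner_toLp {α : Type} [MeasurableSpace α] {μ : Measure α} {f g : α → ℝ}
    (hf : MemLp f 2 μ) (hg : MemLp g 2 μ) : ⟪hf.toLp f, hg.toLp g⟫_ℝ = ∫ x, f x * g x ∂μ := by
  rw [L2.inner_def]
  refine integral_congr_ae ?_
  filter_upwards [hf.coeFn_toLp, hg.coeFn_toLp] with x h1 h2
  rw [h1, h2, real_inner_eq_re_inner]
  simp [mul_comm]

/-! ### The space `H¹_a` described by weighted derivatives -/

/-- What is used of the degenerate diffusion coefficient. -/
structure Weight (a : ℝ → ℝ) : Prop where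
  cont : ContinuousOn a (Icc 0 1)
  pos : ∀ x ∈ Om, 0 < a x
  inv_int : IntegrableOn (fun x => (a x)⁻¹) Om
  sq_le : ∀ x ∈ Om, x ^ 2 ≤ a x

/-- The Hilbert space `L²(0,1)`. -/
abbrev L2Om : Type := Lp ℝ 2 (volume.restrict Om)

section WeightLemmas

variable {a : ℝ → ℝ}

theorem Weight.aemeasurable (ha : Weight a) : AEMeasurable a (volume.restrict Om) :=
  (ha.cont.mono Ioo_subset_Icc_self).aemeasurable measurableSet_Ioo

theorem Weight.aestronglyMeasurable_sqrt (ha : Weight a) :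
    AEStronglyMeasurable (fun x => √(a x)) (volume.restrict Om) :=
  ha.aemeasurable.sqrt.aestronglyMeasurable

theorem Weight.memLp_inv_sqrt (ha : Weight a) :
    MemLp (fun x => (√(a x))⁻¹) 2 (volume.restrict Om) := by
  refine (memLp_two_iff_integrable_sq ha.aemeasurable.sqrt.inv.aestronglyMeasurable).2 ?_
  refine (ha.inv_int : Integrable _ _).congr ?_
  refine (ae_restrict_iff' measurableSet_Ioo).2 (Eventually.of_forall fun x hx => ?_)
  simp only [Pi.inv_apply, inv_pow, Real.sq_sqrt (ha.pos x hx).le]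

theorem Weight.memLp_kernel (ha : Weight a) (x : ℝ) :
    MemLp ((Iio x).indicator fun r => (√(a r))⁻¹) 2 (volume.restrict Om) :=
  ha.memLp_inv_sqrt.indicator measurableSet_Iio

/-- The function `1_{(0,x)} / √a`, whose inner product with `√a u'` is `u(x)`. -/
noncomputable def Weight.kvec (ha : Weight a) (x : ℝ) : L2Om := (ha.memLp_kernel x).toLp _

theorem Weight.inner_kvec (ha : Weight a) (x : ℝ) (w : L2Om) :
    ⟪ha.kvec x, w⟫_ℝ = ∫ r in Om ∩ Iio x, (√(a r))⁻¹ * w r := by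
  have h := integral_inner_toLp (ha.memLp_kernel x) (Lp.memLp w)
  rw [Lp.toLp_coeFn] at h
  rw [Weight.kvec, h, inter_comm, ← Measure.restrict_restrict measurableSet_Iio,
    ← integral_indicator measurableSet_Iio]
  refine integral_congr_ae (Eventually.of_forall fun r => ?_)
  by_cases hr : r ∈ Iio x <;> simp [hr]

theorem Weight.integrable_inv_sqrt_mul (ha : Weight a) {w : ℝ → ℝ}
    (hw : MemLp w 2 (volume.restrict Om)) :
    Integrable (fun r => (√(a r))⁻¹ * w r) (volume.restrict Om) :=
  MemLp.integrable_mul ha.memLp_inv_sqrt hw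

/-- The squared distance of `kvec x` and `kvec y` is the integral of `1/a` between `x` and `y`, so
dominated convergence with majorant `1/a` suffices. This makes all elements of `H¹_a` continuous. -/
theorem Weight.continuous_kvec (ha : Weight a) : Continuous ha.kvec := by
  rw [continuous_iff_continuousAt]
  intro y
  rw [ContinuousAt, tendsto_iff_norm_sub_tendsto_zero]
  have hsub : ∀ x, MemLp (fun r => (Iio x).indicator (fun r => (√(a r))⁻¹) r
      - (Iio y).indicator (fun r => (√(a r))⁻¹) r) 2 (volume.restrict Om) := fun x =>
    (ha.memLp_kernel x).sub (ha.memLp_kernel y)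
  have key : Tendsto (fun x => ∫ r in Om, ((Iio x).indicator (fun r => (√(a r))⁻¹) r
      - (Iio y).indicator (fun r => (√(a r))⁻¹) r) ^ 2) (𝓝 y) (𝓝 (∫ r in Om, (0 : ℝ))) := by
    refine tendsto_integral_filter_of_dominated_convergence (fun r => (a r)⁻¹)
      (Eventually.of_forall fun x => ((hsub x).integrable_sq).aestronglyMeasurable)
      (Eventually.of_forall fun x => ?_) ha.inv_int ?_
    · refine (ae_restrict_iff' measurableSet_Ioo).2 (Eventually.of_forall fun r hr => ?_)
      have h1 : ((√(a r))⁻¹) ^ 2 = (a r)⁻¹ := by rw [inv_pow, Real.sq_sqrt (ha.pos r hr).le]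
      have h2 : 0 ≤ (a r)⁻¹ := (inv_pos.2 (ha.pos r hr)).le
      rw [Real.norm_eq_abs, abs_of_nonneg (sq_nonneg _)]
      by_cases h3 : r ∈ Iio x <;> by_cases h4 : r ∈ Iio y <;> simp [h3, h4, h1, h2]
    · have hne : ∀ᵐ r ∂(volume.restrict Om), r ≠ y :=
        ae_restrict_of_ae (by simp [ae_iff, measure_singleton])
      filter_upwards [hne] with r hr
      refine tendsto_const_nhds.congr' ?_
      rcases lt_or_gt_of_ne hr with h | h
      · filter_upwards [lt_mem_nhds h] with x hx
        simp [h, hx]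
      · filter_upwards [gt_mem_nhds h] with x hx
        simp [h.le, hx.le]
  rw [integral_zero] at key
  have h2 := (Real.continuous_sqrt.tendsto 0).comp key
  rw [Real.sqrt_zero] at h2
  refine h2.congr fun x => ?_
  have h3 : ha.kvec x - ha.kvec y = (hsub x).toLp _ :=
    (MemLp.toLp_sub (ha.memLp_kernel x) (ha.memLp_kernel y)).symm
  rw [Function.comp, Real.sqrt_eq_iff_mul_self_eq (integral_nonneg fun i => sq_nonneg _)
      (norm_nonneg _), ← sq, ← real_inner_self_eq_norm_sq, h3, integral_inner_toLp]
  refine integral_congr_ae (Eventually.of_forall fun r => ?_)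
  simp [sq]

theorem Weight.norm_kvec_sq_le (ha : Weight a) (x : ℝ) :
    ‖ha.kvec x‖ ^ 2 ≤ ∫ r in Om, (a r)⁻¹ := by
  rw [← real_inner_self_eq_norm_sq, Weight.kvec, integral_inner_toLp]
  refine integral_mono_ae ?_ ha.inv_int ?_
  · exact MemLp.integrable_mul (ha.memLp_kernel x) (ha.memLp_kernel x)
  · refine (ae_restrict_iff' measurableSet_Ioo).2 (Eventually.of_forall fun r hr => ?_)
    have h1 : (√(a r))⁻¹ * (√(a r))⁻¹ = (a r)⁻¹ := by
      rw [← mul_inv, Real.mul_self_sqrt (ha.pos r hr).le]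
    have h2 : 0 ≤ (a r)⁻¹ := (inv_pos.2 (ha.pos r hr)).le
    by_cases h3 : r ∈ Iio x
    · simp [h3, h1]
    · simpa [h3] using h2

/-- The kernel `x ↦ 1_{(0,x)} / √a` as an element of `L²(0,1; L²(0,1))`. -/
theorem Weight.memLp_kvec (ha : Weight a) : MemLp ha.kvec 2 (volume.restrict Om) := by
  refine MemLp.of_bound ha.continuous_kvec.aestronglyMeasurable (√(∫ r in Om, (a r)⁻¹))
    (Eventually.of_forall fun x => ?_)
  exact Real.le_sqrt_of_sq_le (ha.norm_kvec_sq_le x)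

/-- The space of weighted derivatives `√a u'` of elements `u` of `H¹_a`. -/
noncomputable def Weight.derivSpace (ha : Weight a) : Submodule ℝ L2Om := (ℝ ∙ ha.kvec 1)ᗮ

theorem Weight.mem_derivSpace (ha : Weight a) {w : L2Om} :
    w ∈ ha.derivSpace ↔ ⟪ha.kvec 1, w⟫_ℝ = 0 :=
  Submodule.mem_orthogonal_singleton_iff_inner_right

noncomputable instance (ha : Weight a) : CompleteSpace ha.derivSpace :=
  inferInstanceAs (CompleteSpace ↥((ℝ ∙ ha.kvec 1)ᗮ))

/-- The embedding of `H¹_a` into `L²(0,1)`, in terms of weighted derivatives. -/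
noncomputable def Weight.embed (ha : Weight a) : ha.derivSpace →L[ℝ] L2Om :=
  (kernelOp (ha.memLp_kvec.toLp _)) ∘L ha.derivSpace.subtypeL

theorem Weight.coeFn_embed (ha : Weight a) (w : ha.derivSpace) :
    ha.embed w =ᵐ[volume.restrict Om] fun x => ⟪ha.kvec x, (w : L2Om)⟫_ℝ := by
  filter_upwards [coeFn_kernelOp (ha.memLp_kvec.toLp _) (w : L2Om),
    ha.memLp_kvec.coeFn_toLp] with x h1 h2
  rw [← h2, ← h1]
  rfl

/-- The primitive of `w / √a` is differentiable a.e. with derivative `w / √a`. -/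
theorem Weight.ae_hasDerivAt (ha : Weight a) (w : L2Om) :
    ∀ᵐ x ∂volume.restrict Om,
      HasDerivAt (fun x => ⟪ha.kvec x, w⟫_ℝ) ((√(a x))⁻¹ * w x) x := by
  have h_int : Integrable (Om.indicator fun r => (√(a r))⁻¹ * w r) volume :=
    (integrable_indicator_iff measurableSet_Ioo).2 (ha.integrable_inv_sqrt_mul (Lp.memLp w))
  have h := LocallyIntegrable.ae_hasDerivAt_integral h_int.locallyIntegrable
  refine (ae_restrict_iff' measurableSet_Ioo).2 ?_
  filter_upwards [h] with x hx hxO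
  have h0 := hx 0
  rw [indicator_of_mem hxO] at h0
  refine h0.congr_of_eventuallyEq ?_
  filter_upwards [lt_mem_nhds hxO.1] with y hy
  rw [ha.inner_kvec, intervalIntegral.integral_of_le hy.le, integral_Ioc_eq_integral_Ioo,
    setIntegral_indicator measurableSet_Ioo]
  congr 2
  ext r
  simp only [mem_inter_iff, mem_Ioo, mem_Iio]
  tauto

/-- A primitive that vanishes a.e. vanishes on all of `(0,1)` by continuity, hence so does its a.e.
derivative `w / √a`. -/
theorem Weight.embed_injective (ha : Weight a) : Function.Injective ha.embed := by
  rw [injective_iff_map_eq_zero]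
  intro w hw
  have h0 : ∀ᵐ x ∂volume.restrict Om, ⟪ha.kvec x, (w : L2Om)⟫_ℝ = 0 := by
    filter_upwards [ha.coeFn_embed w, Lp.coeFn_zero ℝ 2 (volume.restrict Om)] with x h1 h2
    rw [← h1, hw, h2]; rfl
  have hc : Continuous fun x => ⟪ha.kvec x, (w : L2Om)⟫_ℝ :=
    ha.continuous_kvec.inner continuous_const
  have h1 : EqOn (fun x => ⟪ha.kvec x, (w : L2Om)⟫_ℝ) (fun _ => 0) Om :=
    Measure.eqOn_open_of_ae_eq h0 isOpen_Ioo hc.continuousOn continuousOn_const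
  have h2 : (w : L2Om) = 0 := by
    refine Lp.ext ?_
    filter_upwards [ha.ae_hasDerivAt (w : L2Om), Lp.coeFn_zero ℝ 2 (volume.restrict Om),
      ae_restrict_mem measurableSet_Ioo] with x hx hz hxO
    rw [hz]
    have h3 : HasDerivAt (fun x => ⟪ha.kvec x, (w : L2Om)⟫_ℝ) 0 x := by
      refine (hasDerivAt_const x (0 : ℝ)).congr_of_eventuallyEq ?_
      filter_upwards [isOpen_Ioo.mem_nhds hxO] with y hy using h1 hy
    have h4 := hx.unique h3
    have h5 : (√(a x))⁻¹ ≠ 0 := inv_ne_zero (Real.sqrt_pos.2 (ha.pos x hxO)).ne'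
    simpa [h5] using h4
  exact Subtype.ext h2

/-! ### Dictionary between pairs `(u, u')` in `H¹_a` and vectors of `derivSpace` -/

/-- The weighted derivative of an element of `H¹_a`. -/
noncomputable def MemHa.wvec {u g : ℝ → ℝ} (h : MemHa a u g) : L2Om := h.weighted.toLp _

theorem MemHa.inner_kvec_wvec (ha : Weight a) {u g : ℝ → ℝ} (h : MemHa a u g) (x : ℝ) :
    ⟪ha.kvec x, h.wvec⟫_ℝ = ∫ r in Om ∩ Iio x, g r := by
  rw [ha.inner_kvec]
  refine integral_congr_ae ?_
  have h1 : ∀ᵐ r ∂volume.restrict Om, (√(a r))⁻¹ * h.wvec r = g r := by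
    filter_upwards [h.weighted.coeFn_toLp, ae_restrict_mem measurableSet_Ioo] with r h1 h2
    have h3 : √(a r) ≠ 0 := (Real.sqrt_pos.2 (ha.pos r h2)).ne'
    rw [MemHa.wvec, h1, ← mul_assoc, inv_mul_cancel₀ h3, one_mul]
  exact ae_mono (Measure.restrict_mono inter_subset_left le_rfl) h1

theorem MemHa.wvec_mem (ha : Weight a) {u g : ℝ → ℝ} (h : MemHa a u g) :
    h.wvec ∈ ha.derivSpace := by
  rw [ha.mem_derivSpace, h.inner_kvec_wvec ha, ← h.integral_eq_zero]
  congr 2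
  exact inter_eq_left.2 fun r hr => hr.2

theorem MemHa.ae_eq_inner (ha : Weight a) {u g : ℝ → ℝ} (h : MemHa a u g) :
    ∀ᵐ x ∂volume.restrict Om, u x = ⟪ha.kvec x, h.wvec⟫_ℝ := by
  filter_upwards [h.eq_integral, ae_restrict_mem measurableSet_Ioo] with x hx hxO
  rw [hx, h.inner_kvec_wvec ha]
  congr 2
  ext r
  simp only [mem_inter_iff, mem_Ioo, mem_Iio]
  exact ⟨fun h => ⟨⟨h.1, h.2.trans hxO.2⟩, h.2⟩, fun h => ⟨h.1.1, h.2⟩⟩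

theorem MemHa.memLp (ha : Weight a) {u g : ℝ → ℝ} (h : MemHa a u g) :
    MemLp u 2 (volume.restrict Om) := by
  refine (Lp.memLp (ha.embed ⟨h.wvec, h.wvec_mem ha⟩)).ae_eq ?_
  filter_upwards [ha.coeFn_embed ⟨h.wvec, h.wvec_mem ha⟩, h.ae_eq_inner ha] with x h1 h2
  rw [h1, h2]

theorem MemHa.embed_wvec (ha : Weight a) {u g : ℝ → ℝ} (h : MemHa a u g) :
    ha.embed ⟨h.wvec, h.wvec_mem ha⟩ = (h.memLp ha).toLp u := by
  refine Lp.ext ?_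
  filter_upwards [ha.coeFn_embed ⟨h.wvec, h.wvec_mem ha⟩, h.ae_eq_inner ha,
    (h.memLp ha).coeFn_toLp] with x h1 h2 h3
  rw [h1, h3, h2]

theorem MemHa.inner_wvec (ha : Weight a) {u g v k : ℝ → ℝ} (h : MemHa a u g) (h' : MemHa a v k) :
    ⟪h.wvec, h'.wvec⟫_ℝ = ∫ x in Om, a x * g x * k x := by
  rw [MemHa.wvec, MemHa.wvec, integral_inner_toLp]
  refine integral_congr_ae ?_
  filter_upwards [ae_restrict_mem measurableSet_Ioo] with x hx
  have := Real.mul_self_sqrt (ha.pos x hx).le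
  linear_combination (g x * k x) * this

theorem MemHa.congr {u g v k : ℝ → ℝ} (h : MemHa a u g)
    (hu : u =ᵐ[volume.restrict Om] v) (hg : g =ᵐ[volume.restrict Om] k) : MemHa a v k where
  integrable := (h.integrable : Integrable _ _).congr hg
  weighted := h.weighted.ae_eq (by filter_upwards [hg] with x hx; rw [hx])
  eq_integral := by
    filter_upwards [hu, h.eq_integral, ae_restrict_mem measurableSet_Ioo] with x h1 h2 hxO
    rw [← h1, h2]
    refine integral_congr_ae (ae_mono (Measure.restrict_mono ?_ le_rfl) hg)
    exact Ioo_subset_Ioo le_rfl hxO.2.le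
  integral_eq_zero := by rw [← h.integral_eq_zero]; exact integral_congr_ae hg.symm

theorem Weight.memHa_of_derivSpace (ha : Weight a) (w : ha.derivSpace) :
    MemHa a (fun x => ⟪ha.kvec x, (w : L2Om)⟫_ℝ) (fun x => (√(a x))⁻¹ * (w : L2Om) x) where
  integrable := ha.integrable_inv_sqrt_mul (Lp.memLp _)
  weighted := by
    refine (Lp.memLp (w : L2Om)).ae_eq ?_
    filter_upwards [ae_restrict_mem measurableSet_Ioo] with x hx
    have h3 : √(a x) ≠ 0 := (Real.sqrt_pos.2 (ha.pos x hx)).ne'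
    rw [← mul_assoc, mul_inv_cancel₀ h3, one_mul]
  eq_integral := by
    filter_upwards [ae_restrict_mem measurableSet_Ioo] with x hxO
    rw [ha.inner_kvec]
    congr 2
    ext r
    simp only [mem_inter_iff, mem_Ioo, mem_Iio]
    exact ⟨fun h => ⟨h.1.1, h.2⟩, fun h => ⟨⟨h.1, h.2.trans hxO.2⟩, h.2⟩⟩
  integral_eq_zero := by
    have h := ha.mem_derivSpace.1 w.2
    rw [ha.inner_kvec, inter_eq_left.2 fun r hr => hr.2] at h
    exact h

theorem Weight.wvec_memHa_of_derivSpace (ha : Weight a) (w : ha.derivSpace) :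
    (ha.memHa_of_derivSpace w).wvec = (w : L2Om) := by
  refine Lp.ext ?_
  filter_upwards [(ha.memHa_of_derivSpace w).weighted.coeFn_toLp,
    ae_restrict_mem measurableSet_Ioo] with x h1 hx
  have h3 : √(a x) ≠ 0 := (Real.sqrt_pos.2 (ha.pos x hx)).ne'
  rw [MemHa.wvec, h1, ← mul_assoc, mul_inv_cancel₀ h3, one_mul]

/-- Smooth functions with compact support in `(0,1)` belong to `H¹_a`. -/
theorem Weight.memHa_of_contDiff (ha : Weight a) {φ : ℝ → ℝ} (hφ : ContDiff ℝ ∞ φ)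
    (hs : tsupport φ ⊆ Om) : MemHa a φ (deriv φ) := by
  have hd : Continuous (deriv φ) := hφ.continuous_deriv (by simp)
  have h0 : ∀ x, x ∉ Om → φ x = 0 := fun x hx => image_eq_zero_of_notMem_tsupport fun h => hx (hs h)
  have hF : ∀ x, 0 ≤ x → ∫ r in Ioo 0 x, deriv φ r = φ x := fun x hx => by
    rw [← integral_Ioc_eq_integral_Ioo, ← intervalIntegral.integral_of_le hx,
      intervalIntegral.integral_deriv_eq_sub (fun y _ => (hφ.differentiable (by simp)) y)
        (hd.intervalIntegrable _ _), h0 0 (by simp), sub_zero]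
  refine ⟨?_, ?_, ?_, ?_⟩
  · exact (hd.integrableOn_Icc (a := 0) (b := 1)).mono_set Ioo_subset_Icc_self
  · obtain ⟨A, hA⟩ := isCompact_Icc.exists_bound_of_continuousOn
      (ha.cont.sqrt.mul hd.continuousOn)
    exact MemLp.of_bound (ha.aestronglyMeasurable_sqrt.mul hd.aestronglyMeasurable) A
      ((ae_restrict_iff' measurableSet_Ioo).2
        (Eventually.of_forall fun x hx => hA x (Ioo_subset_Icc_self hx)))
  · filter_upwards [ae_restrict_mem measurableSet_Ioo] with x hx
    rw [hF x hx.1.le]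
  · rw [hF 1 zero_le_one, h0 1 (by simp)]

/-- The range contains every test function on `(0,1)`, and these determine an `L²` function. -/
theorem Weight.embed_dense (ha : Weight a) (v : L2Om) (hv : ∀ w, ⟪v, ha.embed w⟫_ℝ = 0) :
    v = 0 := by
  have h : ∀ᵐ x ∂(volume : Measure ℝ), x ∈ Om → v x = 0 := by
    refine isOpen_Ioo.ae_eq_zero_of_integral_contDiff_smul_eq_zero ?_ fun φ hφ _ hs => ?_
    · have : IntegrableOn v Om volume := (Lp.memLp v).integrable (by norm_num)
      exact this.locallyIntegrableOn
    · have hm := ha.memHa_of_contDiff hφ hs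
      have h1 := hv ⟨hm.wvec, hm.wvec_mem ha⟩
      rw [hm.embed_wvec ha] at h1
      have h2 := integral_inner_toLp (Lp.memLp v) (hm.memLp ha)
      rw [Lp.toLp_coeFn, h1] at h2
      rw [← setIntegral_eq_integral_of_forall_compl_eq_zero (s := Om), h2]
      · simp [mul_comm]
      · intro x hx
        rw [image_eq_zero_of_notMem_tsupport fun h => hx (hs h), zero_smul]
  refine Lp.ext ?_
  filter_upwards [(ae_restrict_iff' measurableSet_Ioo).2 h,
    Lp.coeFn_zero ℝ 2 (volume.restrict Om)] with x h1 h2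
  rw [h1, h2]; rfl

/-- Elements of `H¹_a` are bounded by the norm of their weighted derivative. -/
theorem MemHa.ae_sq_le (ha : Weight a) {u g : ℝ → ℝ} (h : MemHa a u g) :
    ∀ᵐ x ∂volume.restrict Om,
      u x ^ 2 ≤ (∫ r in Om, (a r)⁻¹) * ∫ r in Om, a r * g r ^ 2 := by
  filter_upwards [h.ae_eq_inner ha] with x hx
  have h1 : ∫ r in Om, a r * g r ^ 2 = ‖h.wvec‖ ^ 2 := by
    rw [← real_inner_self_eq_norm_sq, h.inner_wvec ha]
    simp only [sq, mul_assoc]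
  rw [hx, h1, ← sq_abs]
  calc |⟪ha.kvec x, h.wvec⟫_ℝ| ^ 2 ≤ (‖ha.kvec x‖ * ‖h.wvec‖) ^ 2 := by
        gcongr; exact abs_real_inner_le_norm _ _
    _ = ‖ha.kvec x‖ ^ 2 * ‖h.wvec‖ ^ 2 := by ring
    _ ≤ _ := by gcongr; exact ha.norm_kvec_sq_le x

end WeightLemmas

/-! ### Eigenfunctions of the degenerate operator -/

/-- A complete system of eigenfunctions `e i` of `-(a u')' = λ u` in `H¹_a`. -/
structure EigenSystem (a : ℝ → ℝ) (ι : Type) where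
  e : ι → ℝ → ℝ
  de : ι → ℝ → ℝ
  lam : ι → ℝ
  lam_pos : ∀ i, 0 < lam i
  memHa : ∀ i, MemHa a (e i) (de i)
  parseval : ∀ {f g : ℝ → ℝ}, MemLp f 2 (volume.restrict Om) → MemLp g 2 (volume.restrict Om) →
    HasSum (fun i => (∫ x in Om, f x * e i x) * ∫ x in Om, g x * e i x) (∫ x in Om, f x * g x)
  weak : ∀ {u g : ℝ → ℝ}, MemHa a u g → ∀ i,
    ∫ x in Om, a x * g x * de i x = lam i * ∫ x in Om, u x * e i x
  parsevalHa : ∀ {u g v k : ℝ → ℝ}, MemHa a u g → MemHa a v k →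
    HasSum (fun i => lam i * ((∫ x in Om, u x * e i x) * ∫ x in Om, v x * e i x))
      (∫ x in Om, a x * g x * k x)
  curve : ∀ {c : ι → ℝ → ℝ} {m : ι → ℝ}, (∀ i, Continuous (c i)) → Summable m →
    (∀ i t, lam i * c i t ^ 2 ≤ m i) →
    ∃ u g : ℝ × ℝ → ℝ, Continuous u ∧ Measurable g ∧
      (∀ t, MemHa a (fun x => u (x, t)) fun x => g (x, t)) ∧
      (∀ i t, ∫ x in Om, u (x, t) * e i x = c i t) ∧
      ∀ t, Tendsto (fun s => eLpNorm (fun x => u (x, s) - u (x, t)) 2 (volume.restrict Om))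
        (𝓝 t) (𝓝 0)

/-- The singular value decomposition of the embedding of `H¹_a` into `L²`. Left singular vectors are
the eigenfunctions, right ones are their normalised weighted derivatives, and `λ = σ⁻²`. Parseval's
identity for the left basis is the one in `L²`, for the right basis the one for the form `∫ a u'
v'`. -/
theorem exists_eigenSystem {a : ℝ → ℝ} (ha : Weight a) :
    ∃ (ι : Type) (_ : Countable ι), Nonempty (EigenSystem a ι) := by
  have hK : IsCompactOperator ha.embed :=
    (isCompactOperator_kernelOp (ha.memLp_kvec.toLp _)).comp_clm _
  have : Fact ((2 : ENNReal) ≠ ⊤) := ⟨by norm_num⟩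
  have : SecondCountableTopology L2Om := inferInstance
  obtain ⟨ι, hι, E, Ψ, σ, hσ, hKΨ, hEK⟩ :=
    exists_singular_basis ha.embed hK ha.embed_injective ha.embed_dense
  -- Scaled so that the function with weighted derivative `w i` is the unit vector `E i`.
  let w : ι → ha.derivSpace := fun i => (σ i)⁻¹ • Ψ i
  have hKw : ∀ i, ha.embed (w i) = E i := fun i => by
    rw [map_smul, hKΨ, smul_smul, inv_mul_cancel₀ (hσ i).ne', one_smul]
  have hm := fun i => ha.memHa_of_derivSpace (w i)
  have hE : ∀ i, E i = ((hm i).memLp ha).toLp _ := fun i => by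
    rw [← hKw, ← (hm i).embed_wvec ha]
    congr 1
    exact Subtype.ext (ha.wvec_memHa_of_derivSpace (w i)).symm
  have hcoef : ∀ {f : ℝ → ℝ} (hf : MemLp f 2 (volume.restrict Om)) (i : ι),
      ⟪E i, hf.toLp f⟫_ℝ = ∫ x in Om, f x * ⟪ha.kvec x, (w i : L2Om)⟫_ℝ := fun hf i => by
    rw [hE, real_inner_comm, integral_inner_toLp]
  have hcoefΨ : ∀ {u g : ℝ → ℝ} (h : MemHa a u g) (i : ι),
      ⟪Ψ i, (⟨h.wvec, h.wvec_mem ha⟩ : ha.derivSpace)⟫_ℝ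
        = (σ i)⁻¹ * ∫ x in Om, u x * ⟪ha.kvec x, (w i : L2Om)⟫_ℝ := fun h i => by
    rw [← hcoef (h.memLp ha), ← h.embed_wvec ha, hEK, ← mul_assoc, inv_mul_cancel₀ (hσ i).ne',
      one_mul]
  refine ⟨ι, hι, ⟨⟨fun i x => ⟪ha.kvec x, (w i : L2Om)⟫_ℝ, fun i x => (√(a x))⁻¹ * (w i : L2Om) x,
    fun i => (σ i ^ 2)⁻¹, fun i => inv_pos.2 (pow_pos (hσ i) 2), hm, ?_, ?_, ?_, ?_⟩⟩⟩
  · intro f g hf hg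
    have h := E.hasSum_inner_mul_inner (hf.toLp f) (hg.toLp g)
    rw [integral_inner_toLp] at h
    refine h.congr_fun fun i => ?_
    rw [real_inner_comm, hcoef, hcoef]
  · intro u g h i
    have h1 := h.inner_wvec ha (hm i)
    rw [ha.wvec_memHa_of_derivSpace] at h1
    rw [← h1, real_inner_comm]
    have h2 := hcoefΨ h i
    have h3 : ⟪(w i : L2Om), h.wvec⟫_ℝ
        = (σ i)⁻¹ * ⟪Ψ i, (⟨h.wvec, h.wvec_mem ha⟩ : ha.derivSpace)⟫_ℝ := by
      rw [← real_inner_smul_left]; rfl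
    rw [h3, h2]
    ring
  · intro u g v k h h'
    have h1 := Ψ.hasSum_inner_mul_inner ⟨h.wvec, h.wvec_mem ha⟩ ⟨h'.wvec, h'.wvec_mem ha⟩
    have h2 := h.inner_wvec ha h'
    rw [← h2]
    refine h1.congr_fun fun i => ?_
    rw [real_inner_comm, hcoefΨ, hcoefΨ]
    ring
  · intro c m hc hsum hcm
    obtain ⟨W, hW, hWc⟩ := exists_continuous_curve Ψ (c := fun i t => (σ i)⁻¹ * c i t) (m := m)
      (fun i => continuous_const.mul (hc i)) hsum
      (fun i t => by rw [mul_pow, inv_pow]; exact hcm i t)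
    have hcont : Continuous fun z : ℝ × ℝ => ⟪ha.kvec z.1, (W z.2 : L2Om)⟫_ℝ :=
      (ha.continuous_kvec.comp continuous_fst).inner
        (continuous_subtype_val.comp (hW.comp continuous_snd))
    -- The space derivative is taken to be `deriv` of the jointly continuous function `u`.
    -- Representatives of the classes `W t` chosen separately for each `t` need not be jointly
    -- measurable.
    have hmeas : Measurable fun z : ℝ × ℝ =>
        deriv (fun x => ⟪ha.kvec x, (W z.2 : L2Om)⟫_ℝ) z.1 := by
      have h1 : Continuous (Function.uncurry fun t x : ℝ => ⟪ha.kvec x, (W t : L2Om)⟫_ℝ) :=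
        hcont.comp continuous_swap
      exact (measurable_deriv_with_param h1).comp measurable_swap
    refine ⟨_, _, hcont, hmeas, fun t => ?_, fun i t => ?_, fun t => ?_⟩
    · refine (ha.memHa_of_derivSpace (W t)).congr (Eventually.of_forall fun x => rfl) ?_
      filter_upwards [ha.ae_hasDerivAt (W t : L2Om)] with x hx
      exact hx.deriv.symm
    · dsimp only
      have h1 := hcoef ((ha.memHa_of_derivSpace (W t)).memLp ha) i
      rw [← h1, ← (ha.memHa_of_derivSpace (W t)).embed_wvec ha, hEK]
      have h2 : (⟨_, (ha.memHa_of_derivSpace (W t)).wvec_mem ha⟩ : ha.derivSpace) = W t :=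
        Subtype.ext (ha.wvec_memHa_of_derivSpace (W t))
      rw [h2, hWc, ← mul_assoc, mul_inv_cancel₀ (hσ i).ne', one_mul]
    · have h1 : Continuous fun s => ha.embed (W s) := ha.embed.continuous.comp hW
      have h2 : Tendsto (fun s => ‖ha.embed (W s) - ha.embed (W t)‖ₑ) (𝓝 t) (𝓝 0) := by
        simpa using ((h1.sub (continuous_const (y := ha.embed (W t)))).enorm).tendsto t
      refine h2.congr fun s => ?_
      rw [Lp.enorm_def]
      refine eLpNorm_congr_ae ?_
      filter_upwards [Lp.coeFn_sub (ha.embed (W s)) (ha.embed (W t)), ha.coeFn_embed (W s),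
        ha.coeFn_embed (W t)] with x h3 h4 h5
      rw [h3, Pi.sub_apply, h4, h5]

/-! ### The scalar equation `u' + λ b u = f` -/

section Scalar

/-- `u` is a primitive of `r` on `[0,T]` with value `c` at `0`. -/
structure IsPrimitive (T c : ℝ) (r u : ℝ → ℝ) : Prop where
  int : IntervalIntegrable r volume 0 T
  eq : ∀ t ∈ Icc 0 T, u t = c + ∫ s in 0..t, r s

variable {T c d : ℝ} {r s u v : ℝ → ℝ}

theorem IsPrimitive.int_le (hu : IsPrimitive T c r u) {t : ℝ} (ht : t ∈ Icc 0 T) :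
    IntervalIntegrable r volume 0 t :=
  hu.int.mono_set (by rw [uIcc_of_le ht.1, uIcc_of_le (ht.1.trans ht.2)]
                      exact Icc_subset_Icc le_rfl ht.2)

theorem IsPrimitive.continuousOn (hT : 0 ≤ T) (hu : IsPrimitive T c r u) :
    ContinuousOn u (Icc 0 T) := by
  have h1 : ContinuousOn (fun t => c + ∫ s in 0..t, r s) (uIcc 0 T) :=
    continuousOn_const.add (intervalIntegral.continuousOn_primitive_interval
      ((intervalIntegrable_iff_integrableOn_Icc_of_le hT).1 hu.int |>.mono_set
        (by rw [uIcc_of_le hT])))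
  rw [uIcc_of_le hT] at h1
  exact h1.congr fun t ht => hu.eq t ht

theorem IsPrimitive.apply_zero (hT : 0 ≤ T) (hu : IsPrimitive T c r u) : u 0 = c := by
  rw [hu.eq 0 ⟨le_rfl, hT⟩]; simp

/-- Leibniz' rule for absolutely continuous functions. All scalar energy and duality identities, and
the integration by parts of the drift, come from it. -/
theorem IsPrimitive.mul (hT : 0 ≤ T) (hu : IsPrimitive T c r u) (hv : IsPrimitive T d s v) :
    IsPrimitive T (c * d) (fun t => r t * v t + u t * s t) (fun t => u t * v t) := by
  have hcu : ContinuousOn u (uIcc 0 T) := by rw [uIcc_of_le hT]; exact hu.continuousOn hT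
  have hcv : ContinuousOn v (uIcc 0 T) := by rw [uIcc_of_le hT]; exact hv.continuousOn hT
  refine ⟨(hu.int.mul_continuousOn hcv).add (hv.int.continuousOn_mul hcu), fun t ht => ?_⟩
  have aux : ∀ {c : ℝ} {r u : ℝ → ℝ}, IsPrimitive T c r u →
      AbsolutelyContinuousOnInterval (fun t => c + ∫ s in 0..t, r s) 0 t ∧
      (∀ᵐ x, x ∈ uIcc 0 t → deriv (fun t => c + ∫ s in 0..t, r s) x = r x) := by
    intro c r u hu
    refine ⟨?_, ?_⟩
    · have h1 := (hu.int_le ht).absolutelyContinuousOnInterval_intervalIntegral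
        (c := 0) left_mem_uIcc
      have h2 : AbsolutelyContinuousOnInterval (fun _ : ℝ => c) 0 t :=
        (LipschitzWith.const c).lipschitzOnWith.absolutelyContinuousOnInterval
      exact h2.fun_add h1
    · filter_upwards [(hu.int_le ht).ae_hasDerivAt_integral] with x hx hxt
      exact ((hx hxt 0 left_mem_uIcc).const_add c).deriv
  obtain ⟨a1, d1⟩ := aux hu
  obtain ⟨a2, d2⟩ := aux hv
  have h := a1.integral_deriv_mul_eq_sub a2
  rw [hu.eq t ht, hv.eq t ht]
  simp only [intervalIntegral.integral_same, add_zero] at h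
  rw [eq_sub_iff_add_eq'] at h
  rw [← h]
  congr 1
  refine intervalIntegral.integral_congr_ae ?_
  filter_upwards [d1, d2] with x h1 h2 hx
  have hx' : x ∈ uIcc 0 t := uIoc_subset_uIcc hx
  have hxT : x ∈ Icc 0 T := by
    rw [uIcc_of_le ht.1] at hx'; exact ⟨hx'.1, hx'.2.trans ht.2⟩
  rw [h1 hx', h2 hx', hu.eq x hxT, hv.eq x hxT]

/-- Differentiable functions are primitives. -/
theorem isPrimitive_of_hasDerivAt (hd : ∀ t, HasDerivAt u (r t) t) (hr : Continuous r) :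
    IsPrimitive T (u 0) r u where
  int := hr.intervalIntegrable _ _
  eq t _ := by
    rw [intervalIntegral.integral_eq_sub_of_hasDerivAt (fun x _ => hd x)
      (hr.intervalIntegrable _ _)]
    ring

/-- `u` solves `u' + λ b u = f` on `[0,T]` with `u(0) = c`. -/
def ScalarSol (b : ℝ → ℝ) (lam T c : ℝ) (f u : ℝ → ℝ) : Prop :=
  IsPrimitive T c (fun s => f s - lam * b s * u s) u

variable {b f : ℝ → ℝ} {lam b₀ : ℝ}

/-- Variation of constants with the integrating factor `exp (λ ∫ b)`; the product rule verifies the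
equation for merely integrable `f`. -/
theorem exists_scalarSol (hT : 0 ≤ T) (hb : Continuous b) (hf : IntervalIntegrable f volume 0 T) :
    ∃ u, ScalarSol b lam T c f u := by
  let Θ : ℝ → ℝ := fun t => ∫ s in 0..t, b s
  have hΘ : ∀ t, HasDerivAt Θ (b t) t := fun t =>
    intervalIntegral.integral_hasDerivAt_right (hb.intervalIntegrable _ _)
      hb.aestronglyMeasurable.stronglyMeasurableAtFilter hb.continuousAt
  have hΘc : Continuous Θ := continuous_iff_continuousAt.2 fun t => (hΘ t).continuousAt
  have h1 : IsPrimitive T (Real.exp (-lam * Θ 0))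
      (fun t => Real.exp (-lam * Θ t) * (-lam * b t)) (fun t => Real.exp (-lam * Θ t)) :=
    isPrimitive_of_hasDerivAt (fun t => ((hΘ t).const_mul (-lam)).exp) (by fun_prop)
  have h2 : IsPrimitive T c (fun t => Real.exp (lam * Θ t) * f t)
      (fun t => c + ∫ s in 0..t, Real.exp (lam * Θ s) * f s) :=
    ⟨hf.continuousOn_mul (by fun_prop), fun t _ => rfl⟩
  have h3 := h1.mul hT h2
  refine ⟨fun t => Real.exp (-lam * Θ t) * (c + ∫ s in 0..t, Real.exp (lam * Θ s) * f s), ?_⟩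
  have h0 : Θ 0 = 0 := intervalIntegral.integral_same
  unfold ScalarSol
  convert h3 using 1
  · simp [h0]
  · funext t
    have : Real.exp (-lam * Θ t) * Real.exp (lam * Θ t) = 1 := by
      rw [← Real.exp_add]; simp
    linear_combination (-f t) * this

/-- Pointwise energy estimate. -/
theorem ScalarSol.sq_le (hT : 0 ≤ T) (h : ScalarSol b lam T c f u) (hl : 0 < lam) (hb₀ : 0 < b₀)
    (hb : ∀ t, b₀ ≤ b t) (hf : IntervalIntegrable (fun t => f t ^ 2) volume 0 T) {t : ℝ}
    (ht : t ∈ Icc 0 T) :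
    lam * u t ^ 2 ≤ lam * c ^ 2 + 1 / (2 * b₀) * ∫ s in 0..T, f s ^ 2 := by
  have h2 := IsPrimitive.mul hT h h
  have hsub : IntervalIntegrable (fun t => f t ^ 2) volume 0 t :=
    hf.mono_set (by rw [uIcc_of_le ht.1, uIcc_of_le hT]; exact Icc_subset_Icc le_rfl ht.2)
  -- Young's inequality `2 f u ≤ f² / (2 λ b₀) + 2 λ b₀ u²`, whose last term is absorbed by the
  -- dissipation. Multiplying by `λ` at the end makes the source constant `1 / (2 b₀)` independent
  -- of `λ`.
  have h3 : ∫ s in 0..t, ((f s - lam * b s * u s) * u s + u s * (f s - lam * b s * u s))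
      ≤ ∫ s in 0..t, 1 / (2 * lam * b₀) * f s ^ 2 := by
    refine intervalIntegral.integral_mono ht.1 (h2.int_le ht) (hsub.const_mul _) fun s => ?_
    dsimp only
    have h4 : lam * b₀ * u s ^ 2 ≤ lam * b s * u s ^ 2 := by
      gcongr; exact hb s
    have h5 : 0 ≤ 1 / (2 * lam * b₀) * (f s - 2 * lam * b₀ * u s) ^ 2 := by positivity
    have h6 : 1 / (2 * lam * b₀) * (f s - 2 * lam * b₀ * u s) ^ 2
        = 1 / (2 * lam * b₀) * f s ^ 2 - 2 * (f s * u s) + 2 * (lam * b₀ * u s ^ 2) := by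
      field_simp; ring
    nlinarith
  have h4 : ∫ s in 0..t, f s ^ 2 ≤ ∫ s in 0..T, f s ^ 2 :=
    intervalIntegral.integral_mono_interval le_rfl ht.1 ht.2
      (Eventually.of_forall fun s => sq_nonneg _) hf
  rw [intervalIntegral.integral_const_mul] at h3
  have h5 := h2.eq t ht
  have h6 : u t ^ 2 ≤ c ^ 2 + 1 / (2 * lam * b₀) * ∫ s in 0..T, f s ^ 2 := by
    have : 1 / (2 * lam * b₀) * ∫ s in 0..t, f s ^ 2
        ≤ 1 / (2 * lam * b₀) * ∫ s in 0..T, f s ^ 2 := by gcongr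
    rw [sq, sq c, h5]
    linarith
  calc lam * u t ^ 2 ≤ lam * (c ^ 2 + 1 / (2 * lam * b₀) * ∫ s in 0..T, f s ^ 2) := by gcongr
    _ = _ := by field_simp

/-- Weighted energy estimate. -/
theorem ScalarSol.weighted_le (hT : 0 ≤ T) (h : ScalarSol b lam T 0 f u) (hl : 0 < lam)
    (hb₀ : 0 < b₀) (hb : ∀ t, b₀ ≤ b t)
    (hf : IntervalIntegrable (fun t => f t ^ 2) volume 0 T) {γ : ℝ} (hγ : 0 < γ) :
    ∫ s in 0..T, Real.exp (-2 * γ * s) * (lam * u s ^ 2)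
      ≤ 1 / (4 * γ * b₀) * ∫ s in 0..T, Real.exp (-2 * γ * s) * f s ^ 2 := by
  have h1 : IsPrimitive T (Real.exp (-2 * γ * 0))
      (fun t => Real.exp (-2 * γ * t) * (-2 * γ * 1)) (fun t => Real.exp (-2 * γ * t)) :=
    isPrimitive_of_hasDerivAt (fun t => ((hasDerivAt_id t).const_mul (-2 * γ)).exp) (by fun_prop)
  have h2 := h1.mul hT (IsPrimitive.mul hT h h)
  have h3 := h2.eq T ⟨hT, le_rfl⟩
  have hcu : ContinuousOn u (uIcc 0 T) := by
    rw [uIcc_of_le hT]; exact IsPrimitive.continuousOn hT h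
  have i1 : IntervalIntegrable (fun s => Real.exp (-2 * γ * s) * f s ^ 2) volume 0 T :=
    hf.continuousOn_mul (by fun_prop)
  have i2 : IntervalIntegrable (fun s => Real.exp (-2 * γ * s) * (lam * u s ^ 2)) volume 0 T :=
    ContinuousOn.intervalIntegrable (by fun_prop)
  -- Here Young's inequality is absorbed by the term `-2 γ u²` coming from the weight, so all the
  -- dissipation `2 b₀ λ u²` survives and the source is gained a factor `1/γ`.
  have h4 := intervalIntegral.integral_mono hT h2.int
    ((i1.const_mul (1 / (2 * γ))).sub (i2.const_mul (2 * b₀))) (fun s => by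
      dsimp only
      have e := Real.exp_pos (-2 * γ * s)
      have h4 : lam * b₀ * u s ^ 2 ≤ lam * b s * u s ^ 2 := by
        gcongr; exact hb s
      have h5 : 0 ≤ 1 / (2 * γ) * (f s - 2 * γ * u s) ^ 2 := by positivity
      have h6 : 1 / (2 * γ) * (f s - 2 * γ * u s) ^ 2
          = 1 / (2 * γ) * f s ^ 2 - 2 * (f s * u s) + 2 * (γ * u s ^ 2) := by
        field_simp; ring
      have h7 : 0 ≤ 1 / (2 * γ) * f s ^ 2 - 2 * b₀ * (lam * u s ^ 2) + 2 * (γ * u s ^ 2)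
          - 2 * (f s * u s) + 2 * (lam * b s * u s ^ 2) := by nlinarith
      have h8 := mul_nonneg e.le h7
      linarith [h8])
  rw [intervalIntegral.integral_sub (i1.const_mul _) (i2.const_mul _),
    intervalIntegral.integral_const_mul, intervalIntegral.integral_const_mul] at h4
  have h5 : 0 ≤ Real.exp (-2 * γ * T) * (u T * u T) :=
    mul_nonneg (Real.exp_pos _).le (mul_self_nonneg _)
  have h6 : 2 * b₀ * ∫ s in 0..T, Real.exp (-2 * γ * s) * (lam * u s ^ 2)
      ≤ 1 / (2 * γ) * ∫ s in 0..T, Real.exp (-2 * γ * s) * f s ^ 2 := by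
    simp only [mul_zero, zero_add] at h3
    linarith
  have h7 : ∀ x y : ℝ, 2 * b₀ * x ≤ 1 / (2 * γ) * y → x ≤ 1 / (4 * γ * b₀) * y := fun x y hxy => by
    have h8 : 1 / (2 * γ) * y = 2 * b₀ * (1 / (4 * γ * b₀) * y) := by field_simp; ring
    rw [h8] at hxy
    exact le_of_mul_le_mul_left hxy (by positivity)
  exact h7 _ _ h6

/-- Duality between a scalar equation and its time reversal. -/
theorem ScalarSol.duality (hT : 0 ≤ T) {g q : ℝ → ℝ} (h : ScalarSol b lam T 0 f u)
    (h' : ScalarSol (fun t => b (T - t)) lam T 0 g q)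
    (hf : IntervalIntegrable f volume 0 T) (hg : IntervalIntegrable g volume 0 T) :
    ∫ t in 0..T, f t * q (T - t) = ∫ t in 0..T, u t * g (T - t) := by
  set ρ : ℝ → ℝ := fun s => g s - lam * b (T - s) * q s with hρ
  have h_int : IntervalIntegrable (fun t => ρ (T - t)) volume 0 T := by
    have := (IntervalIntegrable.comp_sub_left h'.int T).symm
    simpa [hρ] using this
  have hgr : IntervalIntegrable (fun t => g (T - t)) volume 0 T := by
    have := (IntervalIntegrable.comp_sub_left hg T).symm
    simpa using this
  have hP : IsPrimitive T (q T) (fun t => -ρ (T - t)) (fun t => q (T - t)) := by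
    refine ⟨h_int.neg, fun t ht => ?_⟩
    have ht' : T - t ∈ Icc 0 T := ⟨by linarith [ht.2], by linarith [ht.1]⟩
    rw [h'.eq (T - t) ht', h'.eq T ⟨hT, le_rfl⟩, intervalIntegral.integral_neg,
      intervalIntegral.integral_comp_sub_left (fun s => ρ s) T, sub_zero, ← sub_eq_add_neg,
      eq_sub_iff_add_eq, add_assoc,
      intervalIntegral.integral_add_adjacent_intervals (IsPrimitive.int_le h' ht')]
    exact (IsPrimitive.int_le h' ht').symm.trans h'.int
  -- The product `u(t) q(T - t)` vanishes at both ends, because `u` and `q` start from zero, and the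
  -- terms with `λ b` cancel in its derivative.
  have h1 := (IsPrimitive.mul hT h hP).eq T ⟨hT, le_rfl⟩
  have hq0 : q 0 = 0 := IsPrimitive.apply_zero hT h'
  have hcu : ContinuousOn u (uIcc 0 T) := by
    rw [uIcc_of_le hT]; exact IsPrimitive.continuousOn hT h
  have hcP : ContinuousOn (fun t => q (T - t)) (uIcc 0 T) := by
    rw [uIcc_of_le hT]; exact IsPrimitive.continuousOn hT hP
  have h2 : (fun t => (f t - lam * b t * u t) * q (T - t) + u t * -ρ (T - t))
      = fun t => f t * q (T - t) - u t * g (T - t) := by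
    funext t
    simp only [hρ, sub_sub_cancel]
    ring
  rw [h2, intervalIntegral.integral_sub (hf.mul_continuousOn hcP) (hgr.continuousOn_mul hcu)] at h1
  simp only [sub_self, hq0, mul_zero, zero_mul, zero_add] at h1
  linarith

end Scalar

/-! ### Integration on the cylinder and slicing in time -/

section SpaceTime

/-- Lebesgue measure on the cylinder `(0,1) × (0,T)`. -/
noncomputable abbrev Qm (T : ℝ) : Measure (ℝ × ℝ) := volume.restrict (Om ×ˢ Ioo 0 T)

theorem Qm_eq_prod (T : ℝ) :
    Qm T = (volume.restrict Om).prod (volume.restrict (Ioo 0 T)) := by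
  rw [Measure.prod_restrict]; rfl

instance (T : ℝ) : IsFiniteMeasure (Qm T) := by rw [Qm_eq_prod]; infer_instance

theorem Qm_mono {t T : ℝ} (h : t ≤ T) : Qm t ≤ Qm T :=
  Measure.restrict_mono (prod_mono le_rfl (Ioo_subset_Ioo le_rfl h)) le_rfl

theorem ae_Qm_mem (T : ℝ) : ∀ᵐ z ∂Qm T, z ∈ Om ×ˢ Ioo 0 T :=
  ae_restrict_mem (measurableSet_Ioo.prod measurableSet_Ioo)

variable {T : ℝ}

theorem intervalIntegral_eq_Ioo (hT : 0 ≤ T) (f : ℝ → ℝ) :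
    ∫ t in 0..T, f t = ∫ t in Ioo 0 T, f t := by
  rw [intervalIntegral.integral_of_le hT, integral_Ioc_eq_integral_Ioo]

theorem intervalIntegrable_iff_Ioo (hT : 0 ≤ T) {f : ℝ → ℝ} :
    IntervalIntegrable f volume 0 T ↔ Integrable f (volume.restrict (Ioo 0 T)) :=
  intervalIntegrable_iff_integrableOn_Ioo_of_le hT

theorem integral_Qm (hT : 0 ≤ T) {G : ℝ × ℝ → ℝ} (hG : Integrable G (Qm T)) :
    ∫ z, G z ∂Qm T = ∫ t in 0..T, ∫ x in Om, G (x, t) := by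
  rw [Qm_eq_prod] at *
  rw [integral_prod_symm G hG, intervalIntegral_eq_Ioo hT]

theorem intervalIntegrable_slice (hT : 0 ≤ T) {G : ℝ × ℝ → ℝ} (hG : Integrable G (Qm T)) :
    IntervalIntegrable (fun t => ∫ x in Om, G (x, t)) volume 0 T := by
  rw [intervalIntegrable_iff_Ioo hT]
  rw [Qm_eq_prod] at hG
  exact hG.integral_prod_right

theorem ae_slice_memLp {g : ℝ × ℝ → ℝ} (hg : MemLp g 2 (Qm T)) :
    ∀ᵐ t ∂volume.restrict (Ioo 0 T), MemLp (fun x => g (x, t)) 2 (volume.restrict Om) := by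
  rw [Qm_eq_prod] at hg
  have h1 := hg.1.prod_swap.prodMk_left
  have h2 := hg.integrable_sq.prod_left_ae
  filter_upwards [h1, h2] with t h3 h4
  exact (memLp_two_iff_integrable_sq h3).2 h4

theorem memLp_fst {f : ℝ → ℝ} (hf : MemLp f 2 (volume.restrict Om)) :
    MemLp (fun z : ℝ × ℝ => f z.1) 2 (Qm T) := by
  rw [Qm_eq_prod]; exact hf.comp_fst _

theorem memLp_time_mul {wt : ℝ → ℝ} (hwt : Continuous wt) {f : ℝ × ℝ → ℝ} (hf : MemLp f 2 (Qm T)) :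
    MemLp (fun z => wt z.2 * f z) 2 (Qm T) := by
  obtain ⟨C, hC⟩ := isCompact_Icc.exists_bound_of_continuousOn (s := Icc 0 T) hwt.continuousOn
  refine hf.of_le_mul (c := C) ((by fun_prop : Continuous fun z : ℝ × ℝ => wt z.2)
    |>.aestronglyMeasurable.mul hf.1) ?_
  filter_upwards [ae_Qm_mem T] with z hz
  rw [norm_mul]
  gcongr
  exact hC _ (Ioo_subset_Icc_self hz.2)

theorem integrable_time_mul {wt : ℝ → ℝ} (hwt : Continuous wt) {f : ℝ × ℝ → ℝ}
    (hf : Integrable f (Qm T)) : Integrable (fun z => wt z.2 * f z) (Qm T) := by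
  obtain ⟨C, hC⟩ := isCompact_Icc.exists_bound_of_continuousOn (s := Icc 0 T) hwt.continuousOn
  refine hf.bdd_mul (c := C) (by fun_prop : Continuous fun z : ℝ × ℝ => wt z.2).aestronglyMeasurable
    ?_
  filter_upwards [ae_Qm_mem T] with z hz
  exact hC _ (Ioo_subset_Icc_self hz.2)

/-- An a.e. bound in space for a.e. time is an a.e. bound on the cylinder. -/
theorem ae_Qm_of_ae_ae {u : ℝ × ℝ → ℝ} (hu : AEStronglyMeasurable u (Qm T)) {C : ℝ}
    (h : ∀ᵐ t ∂volume.restrict (Ioo 0 T), ∀ᵐ x ∂volume.restrict Om, u (x, t) ≤ C) :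
    ∀ᵐ z ∂Qm T, u z ≤ C := by
  -- Concluding from slices to the product requires a measurable set, hence a measurable
  -- representative.
  obtain ⟨v, hv, huv⟩ := hu
  have h1 : ∀ᵐ t ∂volume.restrict (Ioo 0 T), ∀ᵐ x ∂volume.restrict Om, u (x, t) = v (x, t) := by
    rw [Qm_eq_prod] at huv
    have := Measure.ae_ae_of_ae_prod
      ((Measure.measurePreserving_swap (μ := volume.restrict (Ioo 0 T))
        (ν := volume.restrict Om)).quasiMeasurePreserving.ae huv)
    exact this
  have hm : MeasurableSet {z : ℝ × ℝ | v z ≤ C} := hv.measurable measurableSet_Iic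
  have h2 : ∀ᵐ z ∂(volume.restrict (Ioo 0 T)).prod (volume.restrict Om),
      z ∈ Prod.swap ⁻¹' {z : ℝ × ℝ | v z ≤ C} := by
    rw [Measure.ae_prod_mem_iff_ae_ae_mem (measurable_swap hm)]
    filter_upwards [h, h1] with t h3 h4
    filter_upwards [h3, h4] with x h5 h6
    change v (x, t) ≤ C
    rw [← h6]; exact h5
  have h3 : ∀ᵐ z ∂Qm T, v z ≤ C := by
    rw [Qm_eq_prod]
    exact (Measure.measurePreserving_swap (μ := volume.restrict Om)
      (ν := volume.restrict (Ioo 0 T))).quasiMeasurePreserving.ae h2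
  filter_upwards [h3, huv] with z h4 h5
  rw [h5]; exact h4

/-- The coefficient `∫ g(x,t) e(x) dx`. -/
noncomputable def coef (e : ℝ → ℝ) (g : ℝ × ℝ → ℝ) (t : ℝ) : ℝ := ∫ x in Om, g (x, t) * e x

theorem integrable_mul_fst {g : ℝ × ℝ → ℝ} {e : ℝ → ℝ} (hg : MemLp g 2 (Qm T))
    (he : MemLp e 2 (volume.restrict Om)) : Integrable (fun z => g z * e z.1) (Qm T) :=
  MemLp.integrable_mul hg (memLp_fst he)

theorem intervalIntegrable_coef (hT : 0 ≤ T) {g : ℝ × ℝ → ℝ} {e : ℝ → ℝ} (hg : MemLp g 2 (Qm T))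
    (he : MemLp e 2 (volume.restrict Om)) : IntervalIntegrable (coef e g) volume 0 T :=
  intervalIntegrable_slice hT (integrable_mul_fst hg he)

/-- Dominated convergence for series in which the majorants are only required to sum, at almost
every time, to an integrable function. This exchanges Parseval sums with time integrals. -/
theorem hasSum_intervalIntegral {ι : Type} [Countable ι] (hT : 0 ≤ T) {F G : ι → ℝ → ℝ}
    {Φ Γ : ℝ → ℝ} (hF : ∀ i, AEStronglyMeasurable (F i) (volume.restrict (Ioo 0 T)))
    (hFG : ∀ i, ∀ᵐ t ∂volume.restrict (Ioo 0 T), |F i t| ≤ G i t)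
    (hG : ∀ᵐ t ∂volume.restrict (Ioo 0 T), HasSum (fun i => G i t) (Γ t))
    (hΓ : IntervalIntegrable Γ volume 0 T)
    (hΦ : ∀ᵐ t ∂volume.restrict (Ioo 0 T), HasSum (fun i => F i t) (Φ t)) :
    HasSum (fun i => ∫ t in 0..T, F i t) (∫ t in 0..T, Φ t) := by
  simp only [intervalIntegral_eq_Ioo hT]
  refine hasSum_integral_of_dominated_convergence G hF hFG ?_ ?_ hΦ
  · filter_upwards [hG] with t ht using ht.summable
  · refine ((intervalIntegrable_iff_Ioo hT).1 hΓ).congr ?_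
    filter_upwards [hG] with t ht using ht.tsum_eq.symm

/-- Membership in `L²(0,T; H¹_a)`. -/
structure L2Ha (a : ℝ → ℝ) (T : ℝ) (u g : ℝ × ℝ → ℝ) : Prop where
  memLp : MemLp u 2 (Qm T)
  weighted : MemLp (fun z => √(a z.1) * g z) 2 (Qm T)
  slice : ∀ᵐ t ∂volume.restrict (Ioo 0 T), MemHa a (fun x => u (x, t)) (fun x => g (x, t))

variable {a : ℝ → ℝ}

theorem MemH.toL2Ha {u g : ℝ × ℝ → ℝ} (h : MemH a T u g) : L2Ha a T u g :=
  ⟨h.memLp, h.weighted, h.slice⟩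

theorem L2Ha.mono {u g : ℝ × ℝ → ℝ} (h : L2Ha a T u g) {t : ℝ} (ht : t ≤ T) : L2Ha a t u g :=
  ⟨h.memLp.mono_measure (Qm_mono ht), h.weighted.mono_measure (Qm_mono ht),
    ae_mono (Measure.restrict_mono (Ioo_subset_Ioo le_rfl ht) le_rfl) h.slice⟩

theorem MemHa.toL2Ha (ha : Weight a) {φ φx : ℝ → ℝ} (h : MemHa a φ φx) :
    L2Ha a T (fun z => φ z.1) (fun z => φx z.1) :=
  ⟨memLp_fst (h.memLp ha), memLp_fst h.weighted, Eventually.of_forall fun _ => h⟩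

theorem L2Ha.integrable_mul (ha : Weight a) {u g v k : ℝ × ℝ → ℝ} (h : L2Ha a T u g)
    (h' : L2Ha a T v k) : Integrable (fun z => a z.1 * g z * k z) (Qm T) := by
  refine (MemLp.integrable_mul h.weighted h'.weighted).congr ?_
  filter_upwards [ae_Qm_mem T] with z hz
  have := Real.mul_self_sqrt (ha.pos z.1 hz.1).le
  simp only [Pi.mul_apply]
  linear_combination (g z * k z) * this

end SpaceTime

/-! ### Parseval identities on the cylinder -/

section Sums

variable {T : ℝ} {a : ℝ → ℝ} {ι : Type} [Countable ι]

/-- Parseval's identity on the cylinder. -/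
theorem EigenSystem.hasSum_coef (ha : Weight a) (S : EigenSystem a ι) (hT : 0 ≤ T)
    {f g : ℝ × ℝ → ℝ} (hf : MemLp f 2 (Qm T)) (hg : MemLp g 2 (Qm T)) :
    HasSum (fun i => ∫ t in 0..T, coef (S.e i) f t * coef (S.e i) g t) (∫ z, f z * g z ∂Qm T) := by
  have he := fun i => (S.memHa i).memLp ha
  rw [integral_Qm hT (G := fun z => f z * g z) (MemLp.integrable_mul hf hg)]
  have hm : ∀ {f : ℝ × ℝ → ℝ}, MemLp f 2 (Qm T) → ∀ i,
      AEStronglyMeasurable (coef (S.e i) f) (volume.restrict (Ioo 0 T)) := fun hf i =>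
    ((intervalIntegrable_iff_Ioo hT).1 (intervalIntegrable_coef hT hf (he i))).aestronglyMeasurable
  -- The majorant comes from `|f_i g_i| ≤ f_i² + g_i²`, and Parseval's identity sums it to the
  -- squared `L²` norms of the two slices.
  refine hasSum_intervalIntegral hT
    (G := fun i t => (coef (S.e i) f t * coef (S.e i) f t + coef (S.e i) g t * coef (S.e i) g t))
    (Γ := fun t => (∫ x in Om, f (x, t) * f (x, t)) + ∫ x in Om, g (x, t) * g (x, t))
    (fun i => (hm hf i).mul (hm hg i)) (fun i => Eventually.of_forall fun t => ?_) ?_ ?_ ?_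
  · rw [abs_le]
    constructor <;> nlinarith [sq_nonneg (coef (S.e i) f t + coef (S.e i) g t),
      sq_nonneg (coef (S.e i) f t - coef (S.e i) g t)]
  · filter_upwards [ae_slice_memLp hf, ae_slice_memLp hg] with t h1 h2
    exact (S.parseval h1 h1).add (S.parseval h2 h2)
  · exact (intervalIntegrable_slice hT (MemLp.integrable_mul hf hf)).add
      (intervalIntegrable_slice hT (MemLp.integrable_mul hg hg))
  · filter_upwards [ae_slice_memLp hf, ae_slice_memLp hg] with t h1 h2
    exact S.parseval h1 h2

/-- Parseval's identity for the form `∫ a u_x v_x`, integrated in time with a weight. -/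
theorem EigenSystem.hasSum_coef_Ha (ha : Weight a) (S : EigenSystem a ι) (hT : 0 ≤ T)
    {u g v k : ℝ × ℝ → ℝ} (h : L2Ha a T u g) (h' : L2Ha a T v k) {wt : ℝ → ℝ}
    (hwt : Continuous wt) :
    HasSum (fun i => ∫ t in 0..T, wt t * (S.lam i * (coef (S.e i) u t * coef (S.e i) v t)))
      (∫ z, wt z.2 * (a z.1 * g z * k z) ∂Qm T) := by
  have he := fun i => (S.memHa i).memLp ha
  rw [integral_Qm hT (integrable_time_mul hwt (h.integrable_mul ha h'))]
  have hm : ∀ {f : ℝ × ℝ → ℝ}, MemLp f 2 (Qm T) → ∀ i,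
      AEStronglyMeasurable (coef (S.e i) f) (volume.restrict (Ioo 0 T)) := fun hf i =>
    ((intervalIntegrable_iff_Ioo hT).1 (intervalIntegrable_coef hT hf (he i))).aestronglyMeasurable
  obtain ⟨C, hC⟩ := isCompact_Icc.exists_bound_of_continuousOn (s := Icc 0 T) hwt.continuousOn
  refine hasSum_intervalIntegral hT
    (G := fun i t => C * (S.lam i * (coef (S.e i) u t * coef (S.e i) u t)
      + S.lam i * (coef (S.e i) v t * coef (S.e i) v t)))
    (Γ := fun t => C * ((∫ x in Om, a x * g (x, t) * g (x, t))
      + ∫ x in Om, a x * k (x, t) * k (x, t)))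
    (fun i => hwt.aestronglyMeasurable.mul
      (((hm h.memLp i).mul (hm h'.memLp i)).const_mul _)) (fun i => ?_) ?_ ?_ ?_
  · filter_upwards [ae_restrict_mem measurableSet_Ioo] with t ht
    rw [abs_mul]
    refine mul_le_mul (hC t (Ioo_subset_Icc_self ht)) ?_ (abs_nonneg _)
      ((norm_nonneg _).trans (hC t (Ioo_subset_Icc_self ht)))
    rw [abs_mul, abs_of_pos (S.lam_pos i), ← mul_add]
    refine mul_le_mul_of_nonneg_left ?_ (S.lam_pos i).le
    rw [abs_le]
    constructor <;> nlinarith [sq_nonneg (coef (S.e i) u t + coef (S.e i) v t),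
      sq_nonneg (coef (S.e i) u t - coef (S.e i) v t)]
  · filter_upwards [h.slice, h'.slice] with t h1 h2
    exact ((S.parsevalHa h1 h1).add (S.parsevalHa h2 h2)).mul_left C
  · exact ((intervalIntegrable_slice hT (h.integrable_mul ha h)).add
      (intervalIntegrable_slice hT (h'.integrable_mul ha h'))).const_mul C
  · filter_upwards [h.slice, h'.slice] with t h1 h2
    rw [integral_const_mul]
    exact (S.parsevalHa h1 h2).mul_left (wt t)

end Sums

/-! ### The equation `u_t - b (a u_x)_x = g` -/

section Heat

variable {a b : ℝ → ℝ} {T b₀ : ℝ} {u₀ : ℝ → ℝ} {g u ux : ℝ × ℝ → ℝ}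

theorem MemHa.sub {u k v l : ℝ → ℝ} (h : MemHa a u k) (h' : MemHa a v l) :
    MemHa a (fun x => u x - v x) (fun x => k x - l x) where
  integrable := Integrable.sub h.integrable h'.integrable
  weighted := (h.weighted.sub h'.weighted).ae_eq
    (Eventually.of_forall fun x => by simp [mul_sub])
  eq_integral := by
    filter_upwards [h.eq_integral, h'.eq_integral, ae_restrict_mem measurableSet_Ioo]
      with x h1 h2 hx
    have hs : Ioo 0 x ⊆ Om := Ioo_subset_Ioo le_rfl hx.2.le
    rw [integral_sub (h.integrable.mono_set hs) (h'.integrable.mono_set hs), h1, h2]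
  integral_eq_zero := by
    rw [integral_sub h.integrable h'.integrable, h.integral_eq_zero, h'.integral_eq_zero, sub_zero]

theorem MemH.sub {u k v l : ℝ × ℝ → ℝ} (h : MemH a T u k) (h' : MemH a T v l) :
    MemH a T (fun z => u z - v z) (fun z => k z - l z) where
  memLp := h.memLp.sub h'.memLp
  weighted := (h.weighted.sub h'.weighted).ae_eq
    (Eventually.of_forall fun x => by simp [mul_sub])
  slice := by filter_upwards [h.slice, h'.slice] with t h1 h2 using h1.sub h2
  memLp_slice t ht := (h.memLp_slice t ht).sub (h'.memLp_slice t ht)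
  continuous t ht := by
    have h1 := (h.continuous t ht).add (h'.continuous t ht)
    rw [add_zero] at h1
    refine tendsto_of_tendsto_of_tendsto_of_le_of_le' tendsto_const_nhds h1
      (Eventually.of_forall fun s => zero_le) ?_
    filter_upwards [self_mem_nhdsWithin] with s hs
    have e1 := ((h.memLp_slice s hs).sub (h.memLp_slice t ht)).1
    have e2 := ((h'.memLp_slice s hs).sub (h'.memLp_slice t ht)).1
    refine le_trans (le_of_eq ?_) (eLpNorm_sub_le e1 e2 one_le_two)
    congr 1
    funext x
    simp only [Pi.sub_apply]
    ring

/-- `u` is the weak solution of `u_t - b (a u_x)_x = g`, `u(0,t) = u(1,t) = 0`, `u(·,0) = u₀`, and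
`ux` is its space derivative. -/
structure IsHeatSol (a b : ℝ → ℝ) (T : ℝ) (u₀ : ℝ → ℝ) (g u ux : ℝ × ℝ → ℝ) : Prop where
  memH : MemH a T u ux
  weak : ∀ φ φx : ℝ → ℝ, MemHa a φ φx → ∀ t ∈ Icc 0 T,
    (∫ x in Om, u (x, t) * φ x) - (∫ x in Om, u₀ x * φ x)
      + ∫ z in Om ×ˢ Ioo 0 t, b z.2 * (a z.1 * ux z * φx z.1)
      = ∫ z in Om ×ˢ Ioo 0 t, g z * φ z.1

theorem IsHeatSol.congr {g' : ℝ × ℝ → ℝ} (h : IsHeatSol a b T u₀ g u ux)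
    (hg : g =ᵐ[Qm T] g') : IsHeatSol a b T u₀ g' u ux where
  memH := h.memH
  weak φ φx hφ t ht := by
    rw [h.weak φ φx hφ t ht]
    refine integral_congr_ae ?_
    filter_upwards [ae_mono (Qm_mono ht.2) hg] with z hz
    rw [hz]

theorem IsHeatSol.sub (ha : Weight a) (hb : Continuous b) {g' v vx : ℝ × ℝ → ℝ}
    (h : IsHeatSol a b T u₀ g u ux) (h' : IsHeatSol a b T u₀ g' v vx) (hg : MemLp g 2 (Qm T))
    (hg' : MemLp g' 2 (Qm T)) :
    IsHeatSol a b T (fun _ => 0) (fun z => g z - g' z) (fun z => u z - v z)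
      (fun z => ux z - vx z) where
  memH := h.memH.sub h'.memH
  weak φ φx hφ t ht := by
    have hm := hφ.memLp ha
    have i1 : ∀ {u k : ℝ × ℝ → ℝ}, MemH a T u k →
        Integrable (fun x => u (x, t) * φ x) (volume.restrict Om) := fun h =>
      MemLp.integrable_mul (h.memLp_slice t ht) hm
    have i2 : ∀ {u k : ℝ × ℝ → ℝ}, MemH a T u k →
        Integrable (fun z => b z.2 * (a z.1 * k z * φx z.1)) (Qm t) := fun h =>
      integrable_time_mul hb ((h.toL2Ha.mono ht.2).integrable_mul ha (hφ.toL2Ha ha))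
    have i3 : ∀ {g : ℝ × ℝ → ℝ}, MemLp g 2 (Qm T) →
        Integrable (fun z => g z * φ z.1) (Qm t) := fun hg =>
      integrable_mul_fst (hg.mono_measure (Qm_mono ht.2)) hm
    have e1 := h.weak φ φx hφ t ht
    have e2 := h'.weak φ φx hφ t ht
    have s1 : ∫ x in Om, (u (x, t) - v (x, t)) * φ x
        = (∫ x in Om, u (x, t) * φ x) - ∫ x in Om, v (x, t) * φ x := by
      rw [← integral_sub (i1 h.memH) (i1 h'.memH)]
      simp only [sub_mul]
    have s2 : ∫ z, b z.2 * (a z.1 * (ux z - vx z) * φx z.1) ∂Qm t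
        = (∫ z, b z.2 * (a z.1 * ux z * φx z.1) ∂Qm t)
          - ∫ z, b z.2 * (a z.1 * vx z * φx z.1) ∂Qm t := by
      rw [← integral_sub (i2 h.memH) (i2 h'.memH)]
      congr 1
      funext z
      ring
    have s3 : ∫ z, (g z - g' z) * φ z.1 ∂Qm t
        = (∫ z, g z * φ z.1 ∂Qm t) - ∫ z, g' z * φ z.1 ∂Qm t := by
      rw [← integral_sub (i3 hg) (i3 hg')]
      simp only [sub_mul]
    simp only [zero_mul, integral_zero]
    rw [s1, s2, s3]
    linarith

variable {ι : Type}

/-- The coefficients of a weak solution solve scalar equations. -/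
theorem IsHeatSol.scalarSol (ha : Weight a) (hb : Continuous b) (hT : 0 ≤ T)
    (S : EigenSystem a ι) (h : IsHeatSol a b T u₀ g u ux) (hg : MemLp g 2 (Qm T)) (i : ι) :
    ScalarSol b (S.lam i) T (∫ x in Om, u₀ x * S.e i x) (coef (S.e i) g) (coef (S.e i) u) := by
  have he := (S.memHa i).memLp ha
  have j1 := intervalIntegrable_coef hT hg he
  have j2 : IntervalIntegrable (fun s => S.lam i * b s * coef (S.e i) u s) volume 0 T :=
    (intervalIntegrable_coef hT h.memH.memLp he).continuousOn_mul (by fun_prop)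
  refine ⟨j1.sub j2, fun t ht => ?_⟩
  have e := h.weak _ _ (S.memHa i) t ht
  have hsub : uIcc 0 t ⊆ uIcc 0 T := by
    rw [uIcc_of_le ht.1, uIcc_of_le hT]; exact Icc_subset_Icc le_rfl ht.2
  rw [intervalIntegral.integral_sub (j1.mono_set hsub) (j2.mono_set hsub)]
  have hL := h.memH.toL2Ha.mono ht.2
  rw [integral_Qm ht.1 (integrable_mul_fst (hg.mono_measure (Qm_mono ht.2)) he),
    integral_Qm ht.1 (integrable_time_mul hb
      (hL.integrable_mul ha ((S.memHa i).toL2Ha ha)))] at e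
  have e2 : ∫ s in 0..t, ∫ x in Om, b s * (a x * ux (x, s) * S.de i x)
      = ∫ s in 0..t, S.lam i * b s * coef (S.e i) u s := by
    rw [intervalIntegral_eq_Ioo ht.1, intervalIntegral_eq_Ioo ht.1]
    refine integral_congr_ae ?_
    filter_upwards [hL.slice] with s hs
    rw [integral_const_mul, S.weak hs i, coef]
    ring
  rw [e2] at e
  simp only [coef] at e ⊢
  linarith

/-- Bessel's inequality: the square of one coefficient is at most the squared norm of the slice. -/
theorem intervalIntegrable_coef_sq (ha : Weight a) (hT : 0 ≤ T) (S : EigenSystem a ι)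
    (hg : MemLp g 2 (Qm T)) (i : ι) :
    IntervalIntegrable (fun t => coef (S.e i) g t ^ 2) volume 0 T := by
  have h1 := intervalIntegrable_slice hT (G := fun z => g z * g z) (MemLp.integrable_mul hg hg)
  have h2 := intervalIntegrable_coef hT hg ((S.memHa i).memLp ha)
  rw [intervalIntegrable_iff_Ioo hT] at *
  refine h1.mono' (h2.aestronglyMeasurable.pow 2) ?_
  filter_upwards [ae_slice_memLp hg] with t ht
  rw [Real.norm_eq_abs, abs_of_nonneg (sq_nonneg _), sq]
  exact le_hasSum (S.parseval ht ht) i fun j _ => mul_self_nonneg _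

/-- Weighted energy estimate for vanishing initial datum. -/
theorem IsHeatSol.weighted_energy (ha : Weight a) (hb : Continuous b) (hT : 0 ≤ T)
    (hb₀ : 0 < b₀) (hbb : ∀ t, b₀ ≤ b t) (h : IsHeatSol a b T (fun _ => 0) g u ux)
    (hg : MemLp g 2 (Qm T)) {γ : ℝ} (hγ : 0 < γ) :
    ∫ z, Real.exp (-2 * γ * z.2) * (a z.1 * ux z ^ 2) ∂Qm T
      ≤ 1 / (4 * γ * b₀) * ∫ z, Real.exp (-2 * γ * z.2) * g z ^ 2 ∂Qm T := by
  obtain ⟨ι, _, ⟨S⟩⟩ := exists_eigenSystem ha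
  have hwt : Continuous fun t => Real.exp (-2 * γ * t) := by fun_prop
  have s1 := S.hasSum_coef_Ha ha hT h.memH.toL2Ha h.memH.toL2Ha hwt
  have s2 := (S.hasSum_coef ha hT (memLp_time_mul hwt hg) hg).mul_left (1 / (4 * γ * b₀))
  have h3 := hasSum_le (fun i => ?_) s1 s2
  · refine le_trans (le_of_eq ?_) (h3.trans (le_of_eq ?_))
    · congr 1; funext z; ring
    · congr 2; funext z; ring
  · have h4 := h.scalarSol ha hb hT S hg i
    simp only [zero_mul, integral_zero] at h4
    have h5 := h4.weighted_le hT (S.lam_pos i) hb₀ hbb (intervalIntegrable_coef_sq ha hT S hg i) hγ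
    refine le_trans (le_of_eq ?_) (h5.trans (le_of_eq ?_))
    · congr 1; funext t; ring
    · congr 2; funext t
      have : coef (S.e i) (fun z => Real.exp (-2 * γ * z.2) * g z) t
          = Real.exp (-2 * γ * t) * coef (S.e i) g t := by
        rw [coef, coef, ← integral_const_mul]
        congr 1; funext x; ring
      rw [this]; ring

/-- Uniform estimate for vanishing initial datum. -/
theorem IsHeatSol.ae_sq_le (ha : Weight a) (hb : Continuous b) (hT : 0 ≤ T)
    (hb₀ : 0 < b₀) (hbb : ∀ t, b₀ ≤ b t) (h : IsHeatSol a b T (fun _ => 0) g u ux)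
    (hg : MemLp g 2 (Qm T)) :
    ∀ᵐ z ∂Qm T, u z ^ 2 ≤ (∫ r in Om, (a r)⁻¹) * (1 / (2 * b₀) * ∫ z, g z ^ 2 ∂Qm T) := by
  obtain ⟨ι, _, ⟨S⟩⟩ := exists_eigenSystem ha
  refine ae_Qm_of_ae_ae (h.memH.memLp.1.pow 2) ?_
  filter_upwards [h.memH.slice, ae_restrict_mem measurableSet_Ioo] with t ht htT
  -- The scalar pointwise estimates, summed over all modes, bound the energy at almost every time.
  -- The embedding of `H¹_a` into `L^∞` then gives the bound on `u`.
  have h1 : ∫ x in Om, a x * ux (x, t) ^ 2 ≤ 1 / (2 * b₀) * ∫ z, g z ^ 2 ∂Qm T := by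
    have s2 := (S.hasSum_coef ha hT hg hg).mul_left (1 / (2 * b₀))
    have h3 := hasSum_le (fun i => ?_) (S.parsevalHa ht ht) s2
    · refine le_trans (le_of_eq ?_) (h3.trans (le_of_eq ?_))
      · congr 1; funext z; ring
      · congr 2; funext z; ring
    · have h4 := h.scalarSol ha hb hT S hg i
      simp only [zero_mul, integral_zero] at h4
      have h5 := h4.sq_le hT (S.lam_pos i) hb₀ hbb (intervalIntegrable_coef_sq ha hT S hg i)
        (Ioo_subset_Icc_self htT)
      simp only [coef, mul_zero, zero_add, sq] at h5 ⊢
      exact h5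
  filter_upwards [MemHa.ae_sq_le ha ht] with x hx
  refine hx.trans ?_
  gcongr
  exact integral_nonneg_of_ae ((ae_restrict_iff' measurableSet_Ioo).2
    (Eventually.of_forall fun r hr => (inv_pos.2 (ha.pos r hr)).le))

/-- Fourier's method. Each coefficient solves a scalar equation, and `λ c²` is dominated uniformly
in time by a series that is summable because `u₀` lies in `H¹_a` and `g` in `L²`. The coefficients
thus assemble into a continuous curve in `H¹_a`. -/
theorem exists_isHeatSol (ha : Weight a) (hb : Continuous b) (hT : 0 ≤ T) (hb₀ : 0 < b₀)
    (hbb : ∀ t, b₀ ≤ b t) {k₀ : ℝ → ℝ} (hu₀ : MemHa a u₀ k₀) (hg : MemLp g 2 (Qm T)) :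
    ∃ u ux, IsHeatSol a b T u₀ g u ux := by
  obtain ⟨ι, _, ⟨S⟩⟩ := exists_eigenSystem ha
  have he := fun i => (S.memHa i).memLp ha
  have hex : ∀ i, ∃ c, ScalarSol b (S.lam i) T (∫ x in Om, u₀ x * S.e i x) (coef (S.e i) g) c :=
    fun i => exists_scalarSol hT hb (intervalIntegrable_coef hT hg (he i))
  choose c hc using hex
  let m : ι → ℝ := fun i => S.lam i * ((∫ x in Om, u₀ x * S.e i x) * ∫ x in Om, u₀ x * S.e i x)
    + 1 / (2 * b₀) * ∫ t in 0..T, coef (S.e i) g t * coef (S.e i) g t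
  have hm : HasSum m ((∫ x in Om, a x * k₀ x * k₀ x) + 1 / (2 * b₀) * ∫ z, g z * g z ∂Qm T) :=
    (S.parsevalHa hu₀ hu₀).add ((S.hasSum_coef ha hT hg hg).mul_left _)
  -- The coefficients are controlled on `[0,T]` only and are frozen outside, since `curve` asks for
  -- functions on the whole line.
  obtain ⟨u, ux, hu, hux, hslice, hcoef, hcont⟩ := S.curve (c := fun i => IccExtend hT
      ((Icc 0 T).domRestrict (c i))) (m := m)
    (fun i => ((IsPrimitive.continuousOn hT (hc i)).domRestrict).Icc_extend') hm.summable
    (fun i t => by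
      have h1 := (hc i).sq_le hT (S.lam_pos i) hb₀ hbb (intervalIntegrable_coef_sq ha hT S hg i)
        (projIcc 0 T hT t).2
      simp only [sq] at h1 ⊢
      exact h1)
  have hcoef' : ∀ i, ∀ t ∈ Icc 0 T, coef (S.e i) u t = c i t := fun i t ht => by
    rw [coef, hcoef, IccExtend_of_mem _ _ ht]; rfl
  have hmem : MemLp u 2 (Qm T) := by
    obtain ⟨C, hC⟩ := (isCompact_Icc.prod isCompact_Icc).exists_bound_of_continuousOn
      (s := Icc (0 : ℝ) 1 ×ˢ Icc 0 T) hu.continuousOn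
    refine MemLp.of_bound hu.aestronglyMeasurable C ?_
    filter_upwards [ae_Qm_mem T] with z hz
    exact hC z ⟨Ioo_subset_Icc_self hz.1, Ioo_subset_Icc_self hz.2⟩
  have hwm : AEStronglyMeasurable (fun z => √(a z.1) * ux z) (Qm T) := by
    rw [Qm_eq_prod]
    exact ha.aestronglyMeasurable_sqrt.comp_fst.mul hux.aestronglyMeasurable
  have hweighted : MemLp (fun z => √(a z.1) * ux z) 2 (Qm T) := by
    refine (memLp_two_iff_integrable_sq hwm).2 ?_
    have hwm2 := hwm.pow 2
    rw [Qm_eq_prod] at hwm2 ⊢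
    refine (integrable_prod_iff' hwm2).2
      ⟨Eventually.of_forall fun t => (hslice t).weighted.integrable_sq, ?_⟩
    refine Integrable.of_bound (hwm2.norm.prod_swap.integral_prod_right')
      ((∫ x in Om, a x * k₀ x * k₀ x) + 1 / (2 * b₀) * ∫ z, g z * g z ∂Qm T)
      ?_
    filter_upwards [ae_restrict_mem measurableSet_Ioo] with t ht
    rw [Real.norm_eq_abs, abs_of_nonneg (integral_nonneg fun _ => norm_nonneg _)]
    have h3 := hasSum_le (fun i => ?_) (S.parsevalHa (hslice t) (hslice t)) hm
    · refine le_trans (le_of_eq ?_) h3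
      refine integral_congr_ae ?_
      filter_upwards [ae_restrict_mem measurableSet_Ioo] with x hx
      have := Real.mul_self_sqrt (ha.pos x hx).le
      simp only [Pi.pow_apply]
      rw [Real.norm_eq_abs, abs_of_nonneg (sq_nonneg _)]
      linear_combination (ux (x, t) * ux (x, t)) * this
    · rw [hcoef, IccExtend_of_mem _ _ (Ioo_subset_Icc_self ht)]
      have h1 := (hc i).sq_le hT (S.lam_pos i) hb₀ hbb (intervalIntegrable_coef_sq ha hT S hg i)
        (Ioo_subset_Icc_self ht)
      simp only [sq] at h1 ⊢
      exact h1
  have hH : MemH a T u ux := ⟨hmem, hweighted, Eventually.of_forall hslice,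
    fun t _ => (hslice t).memLp ha, fun t _ => (hcont t).mono_left nhdsWithin_le_nhds⟩
  refine ⟨u, ux, hH, fun φ φx hφ t ht => ?_⟩
  have hφm := hφ.memLp ha
  have s1 := S.parseval ((hslice t).memLp ha) hφm
  have s2 := S.parseval (hu₀.memLp ha) hφm
  have s3 := S.hasSum_coef_Ha ha ht.1 (hH.toL2Ha.mono ht.2) (hφ.toL2Ha ha) hb
  have s4 := S.hasSum_coef ha ht.1 (hg.mono_measure (Qm_mono ht.2)) (memLp_fst hφm)
  -- Every term of the weak formulation is a Parseval series, so the identity is checked mode by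
  -- mode, where it is the integrated scalar equation.
  refine ((s1.sub s2).add s3).unique (s4.congr_fun fun i => ?_)
  have e := (hc i).eq t ht
  have hsub : uIcc 0 t ⊆ uIcc 0 T := by
    rw [uIcc_of_le ht.1, uIcc_of_le hT]; exact Icc_subset_Icc le_rfl ht.2
  have j1 := (intervalIntegrable_coef hT hg (he i)).mono_set hsub
  have j2 : IntervalIntegrable (fun s => S.lam i * b s * coef (S.e i) u s) volume 0 t :=
    ((intervalIntegrable_coef hT hmem (he i)).continuousOn_mul (by fun_prop)).mono_set hsub
  have e1 : ∫ s in 0..t, (coef (S.e i) g s - S.lam i * b s * c i s)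
      = (∫ s in 0..t, coef (S.e i) g s) - ∫ s in 0..t, S.lam i * b s * coef (S.e i) u s := by
    rw [← intervalIntegral.integral_sub j1 j2]
    refine intervalIntegral.integral_congr fun s hs => ?_
    rw [uIcc_of_le ht.1] at hs
    simp only [hcoef' i s ⟨hs.1, hs.2.trans ht.2⟩]
  have e2 : ∀ s, coef (S.e i) (fun z => φ z.1) s = ∫ x in Om, φ x * S.e i x := fun s => rfl
  have e3 : ∫ x in Om, u (x, t) * S.e i x = c i t := hcoef' i t ht
  simp only [e2, e3]
  rw [intervalIntegral.integral_mul_const]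
  have e4 : (fun s => b s * (S.lam i * (coef (S.e i) u s * ∫ x in Om, φ x * S.e i x)))
      = fun s => S.lam i * b s * coef (S.e i) u s * ∫ x in Om, φ x * S.e i x := by
    funext s; ring
  rw [e4, intervalIntegral.integral_mul_const, e, e1]
  ring

/-- Duality between a heat equation and a time reversed one. -/
theorem IsHeatSol.duality (ha : Weight a) (hb : Continuous b) (hT : 0 ≤ T)
    {f q qx : ℝ × ℝ → ℝ} (h : IsHeatSol a b T (fun _ => 0) g u ux)
    (h' : IsHeatSol a (fun t => b (T - t)) T (fun _ => 0) f q qx)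
    (hg : MemLp g 2 (Qm T)) (hf : MemLp f 2 (Qm T))
    (hqr : MemLp (fun z => q (z.1, T - z.2)) 2 (Qm T))
    (hfr : MemLp (fun z => f (z.1, T - z.2)) 2 (Qm T)) :
    ∫ z, g z * q (z.1, T - z.2) ∂Qm T = ∫ z, u z * f (z.1, T - z.2) ∂Qm T := by
  obtain ⟨ι, _, ⟨S⟩⟩ := exists_eigenSystem ha
  refine (S.hasSum_coef ha hT hg hqr).unique
    ((S.hasSum_coef ha hT h.memH.memLp hfr).congr_fun fun i => ?_)
  have he := (S.memHa i).memLp ha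
  have h1 := h.scalarSol ha hb hT S hg i
  have h2 := h'.scalarSol ha (hb.comp (by fun_prop)) hT S hf i
  simp only [zero_mul, integral_zero] at h1 h2
  exact h1.duality hT h2 (intervalIntegrable_coef hT hg he) (intervalIntegrable_coef hT hf he)

end Heat

/-! ### Systems with Lipschitz lower order terms -/

section Semilinear

variable {a b : ℝ → ℝ} {T b₀ : ℝ}

theorem Weight.integral_inv_nonneg (ha : Weight a) : 0 ≤ ∫ r in Om, (a r)⁻¹ :=
  integral_nonneg_of_ae ((ae_restrict_iff' measurableSet_Ioo).2
    (Eventually.of_forall fun r hr => (inv_pos.2 (ha.pos r hr)).le))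

/-- Poincaré inequality on the cylinder. -/
theorem L2Ha.poincare (ha : Weight a) (hT : 0 ≤ T) {u ux : ℝ × ℝ → ℝ} (h : L2Ha a T u ux)
    {wt : ℝ → ℝ} (hwt : Continuous wt) (hpos : ∀ t, 0 ≤ wt t) :
    ∫ z, wt z.2 * u z ^ 2 ∂Qm T
      ≤ (∫ r in Om, (a r)⁻¹) * ∫ z, wt z.2 * (a z.1 * ux z ^ 2) ∂Qm T := by
  have i1 : Integrable (fun z => wt z.2 * u z ^ 2) (Qm T) :=
    integrable_time_mul hwt h.memLp.integrable_sq
  have i2 : Integrable (fun z => wt z.2 * (a z.1 * ux z ^ 2)) (Qm T) :=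
    integrable_time_mul hwt ((h.integrable_mul ha h).congr
      (Eventually.of_forall fun z => by ring))
  rw [integral_Qm hT i1, integral_Qm hT i2, ← intervalIntegral.integral_const_mul]
  rw [intervalIntegral_eq_Ioo hT, intervalIntegral_eq_Ioo hT]
  refine integral_mono_ae ((intervalIntegrable_iff_Ioo hT).1 (intervalIntegrable_slice hT i1))
    (((intervalIntegrable_iff_Ioo hT).1 (intervalIntegrable_slice hT i2)).const_mul _) ?_
  filter_upwards [h.slice] with t ht
  simp only [integral_const_mul]
  rw [mul_left_comm]
  refine mul_le_mul_of_nonneg_left ?_ (hpos t)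
  calc ∫ x in Om, u (x, t) ^ 2
      ≤ ∫ _x in Om, (∫ r in Om, (a r)⁻¹) * ∫ r in Om, a r * ux (r, t) ^ 2 :=
        integral_mono_ae (ht.memLp ha).integrable_sq (integrable_const _) (ht.ae_sq_le ha)
    _ = _ := by simp

/-- Energy estimate for two coupled equations with a Lipschitz expression of the solution. -/
theorem weighted_lipschitz_le (ha : Weight a) (hb : Continuous b) (hT : 0 ≤ T) (hb₀ : 0 < b₀)
    (hbb : ∀ t, b₀ ≤ b t) {d dx g r N : Fin 2 → ℝ × ℝ → ℝ} {L : ℝ}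
    (hd : ∀ k, IsHeatSol a b T (fun _ => 0) (g k) (d k) (dx k))
    (hg : ∀ k, MemLp (g k) 2 (Qm T)) (hr : ∀ k, MemLp (r k) 2 (Qm T))
    (hNm : ∀ k, MemLp (N k) 2 (Qm T))
    (hN : ∀ k, ∀ᵐ z ∂Qm T, |N k z| ≤ |r k z| + L * (∑ j, |d j z| + √(a z.1) * |dx k z|))
    {γ : ℝ} (hγ : 0 < γ) :
    ∑ k, ∫ z, Real.exp (-2 * γ * z.2) * N k z ^ 2 ∂Qm T
      ≤ 4 * ∑ k, ∫ z, Real.exp (-2 * γ * z.2) * r k z ^ 2 ∂Qm T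
        + L ^ 2 * (2 * (∫ r in Om, (a r)⁻¹) + 1) / b₀ / γ
          * ∑ k, ∫ z, Real.exp (-2 * γ * z.2) * g k z ^ 2 ∂Qm T := by
  have hwt : Continuous fun t => Real.exp (-2 * γ * t) := by fun_prop
  have isq : ∀ {f : ℝ × ℝ → ℝ}, MemLp f 2 (Qm T) →
      Integrable (fun z => Real.exp (-2 * γ * z.2) * f z ^ 2) (Qm T) := fun hf =>
    integrable_time_mul hwt hf.integrable_sq
  have ix : ∀ k, Integrable (fun z => Real.exp (-2 * γ * z.2) * (a z.1 * dx k z ^ 2)) (Qm T) :=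
    fun k => integrable_time_mul hwt
      (((hd k).memH.toL2Ha.integrable_mul ha (hd k).memH.toL2Ha).congr
        (Eventually.of_forall fun z => by ring))
  have e1 : ∀ k, ∫ z, Real.exp (-2 * γ * z.2) * N k z ^ 2 ∂Qm T
      ≤ 4 * (∫ z, Real.exp (-2 * γ * z.2) * r k z ^ 2 ∂Qm T)
        + 4 * L ^ 2 * ((∫ z, Real.exp (-2 * γ * z.2) * d 0 z ^ 2 ∂Qm T)
          + (∫ z, Real.exp (-2 * γ * z.2) * d 1 z ^ 2 ∂Qm T)
          + ∫ z, Real.exp (-2 * γ * z.2) * (a z.1 * dx k z ^ 2) ∂Qm T) := by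
    intro k
    have j0 := isq (hd 0).memH.memLp
    have j1 := isq (hd 1).memH.memLp
    have j2 : Integrable (fun z => Real.exp (-2 * γ * z.2) * d 0 z ^ 2
        + Real.exp (-2 * γ * z.2) * d 1 z ^ 2) (Qm T) := j0.add j1
    have j3 : Integrable (fun z => 4 * L ^ 2 * (Real.exp (-2 * γ * z.2) * d 0 z ^ 2
        + Real.exp (-2 * γ * z.2) * d 1 z ^ 2
        + Real.exp (-2 * γ * z.2) * (a z.1 * dx k z ^ 2))) (Qm T) := (j2.add (ix k)).const_mul _
    rw [← integral_add j0 j1, ← integral_add j2 (ix k), ← integral_const_mul,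
      ← integral_const_mul, ← integral_add ((isq (hr k)).const_mul 4) j3]
    refine integral_mono_ae (isq (hNm k)) (((isq (hr k)).const_mul 4).add j3) ?_
    filter_upwards [hN k, ae_Qm_mem T] with z hz hzQ
    have h1 : N k z ^ 2 ≤ (|r k z| + L * (∑ j, |d j z| + √(a z.1) * |dx k z|)) ^ 2 := by
      rw [← sq_abs]; gcongr
    rw [Fin.sum_univ_two] at h1
    -- Cauchy–Schwarz for four summands, whence the factor `4`.
    have h2 : ∀ p q s t : ℝ, (p + L * (q + s + t)) ^ 2
        ≤ 4 * p ^ 2 + 4 * L ^ 2 * (q ^ 2 + s ^ 2 + t ^ 2) := fun p q s t => by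
      nlinarith [sq_nonneg (p - L * q), sq_nonneg (p - L * s), sq_nonneg (p - L * t),
        sq_nonneg (L * q - L * s), sq_nonneg (L * q - L * t), sq_nonneg (L * s - L * t)]
    have h3 := h1.trans (h2 _ _ _ _)
    rw [mul_pow √(a z.1), Real.sq_sqrt (ha.pos z.1 hzQ.1).le, sq_abs, sq_abs, sq_abs, sq_abs] at h3
    have h4 := mul_le_mul_of_nonneg_left h3 (Real.exp_pos (-2 * γ * z.2)).le
    refine h4.trans (le_of_eq ?_)
    ring
  have e2 : ∀ k, ∫ z, Real.exp (-2 * γ * z.2) * d k z ^ 2 ∂Qm T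
      ≤ (∫ r in Om, (a r)⁻¹) * ∫ z, Real.exp (-2 * γ * z.2) * (a z.1 * dx k z ^ 2) ∂Qm T :=
    fun k => (hd k).memH.toL2Ha.poincare ha hT hwt fun t => (Real.exp_pos _).le
  have e3 : ∀ k, ∫ z, Real.exp (-2 * γ * z.2) * (a z.1 * dx k z ^ 2) ∂Qm T
      ≤ 1 / (4 * γ * b₀) * ∫ z, Real.exp (-2 * γ * z.2) * g k z ^ 2 ∂Qm T := fun k =>
    (hd k).weighted_energy ha hb hT hb₀ hbb (hg k) hγ
  have hC := ha.integral_inv_nonneg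
  set C := ∫ r in Om, (a r)⁻¹
  simp only [Fin.sum_univ_two] at *
  set X := fun k => ∫ z, Real.exp (-2 * γ * z.2) * (a z.1 * dx k z ^ 2) ∂Qm T with hX
  set G := fun k => ∫ z, Real.exp (-2 * γ * z.2) * g k z ^ 2 ∂Qm T with hG
  -- In `2 C + 1`, the `2 C` comes from Poincaré's inequality, as both components enter both
  -- equations, and the `1` from the gradient in each equation. The factor `4` cancels the one in `1
  -- / (4 γ b₀)`.
  have e4 : 4 * L ^ 2 * (2 * C + 1) * (X 0 + X 1)
      ≤ 4 * L ^ 2 * (2 * C + 1) * (1 / (4 * γ * b₀) * (G 0 + G 1)) := by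
    have : X 0 + X 1 ≤ 1 / (4 * γ * b₀) * (G 0 + G 1) := by
      rw [mul_add]; exact add_le_add (e3 0) (e3 1)
    gcongr
  have e5 : 4 * L ^ 2 * (2 * C + 1) * (1 / (4 * γ * b₀) * (G 0 + G 1))
      = L ^ 2 * (2 * C + 1) / b₀ / γ * (G 0 + G 1) := by field_simp
  have e6 : 4 * L ^ 2 * (∫ z, Real.exp (-2 * γ * z.2) * d 0 z ^ 2 ∂Qm T)
      ≤ 4 * L ^ 2 * (C * X 0) := by gcongr; exact e2 0
  have e7 : 4 * L ^ 2 * (∫ z, Real.exp (-2 * γ * z.2) * d 1 z ^ 2 ∂Qm T)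
      ≤ 4 * L ^ 2 * (C * X 1) := by gcongr; exact e2 1
  have e8 := e1 0
  have e9 := e1 1
  change _ ≤ _ + _ * (_ + _ + X 0) at e8
  change _ ≤ _ + _ * (_ + _ + X 1) at e9
  linarith

/-- Stability: solutions with vanishing initial data whose sources are controlled by the solution
and by `r` are bounded by `r`. -/
theorem exists_stability_const (ha : Weight a) (hb : Continuous b) (hT : 0 ≤ T) (hb₀ : 0 < b₀)
    (hbb : ∀ t, b₀ ≤ b t) (L : ℝ) :
    ∃ C, 0 ≤ C ∧ ∀ d dx g r : Fin 2 → ℝ × ℝ → ℝ,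
      (∀ k, IsHeatSol a b T (fun _ => 0) (g k) (d k) (dx k)) →
      (∀ k, MemLp (g k) 2 (Qm T)) → (∀ k, MemLp (r k) 2 (Qm T)) →
      (∀ k, ∀ᵐ z ∂Qm T, |g k z| ≤ |r k z| + L * (∑ j, |d j z| + √(a z.1) * |dx k z|)) →
      ∀ k, ∀ᵐ z ∂Qm T, d k z ^ 2 ≤ C * ∑ j, ∫ z, r j z ^ 2 ∂Qm T := by
  have hC := ha.integral_inv_nonneg
  set Ca := ∫ r in Om, (a r)⁻¹ with hCa
  set Λ := L ^ 2 * (2 * Ca + 1) / b₀ with hΛ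
  have hΛ0 : 0 ≤ Λ := by positivity
  -- This choice gives `Λ / γ ≤ 1/2`, so half of the source norm is absorbed and `4` doubles to `8`.
  -- The weight is then removed at the cost of `exp (2 γ T)`.
  set γ := 2 * Λ + 1 with hγd
  have hγ : 0 < γ := by positivity
  refine ⟨Ca * (1 / (2 * b₀) * (Real.exp (2 * γ * T) * 8)), by positivity,
    fun d dx g r hd hg hr hgr k => ?_⟩
  have hwt : Continuous fun t => Real.exp (-2 * γ * t) := by fun_prop
  have h1 := weighted_lipschitz_le ha hb hT hb₀ hbb hd hg hr hg hgr hγ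
  rw [← hCa, ← hΛ] at h1
  have hG0 : ∀ k, 0 ≤ ∫ z, Real.exp (-2 * γ * z.2) * g k z ^ 2 ∂Qm T := fun k =>
    integral_nonneg fun z => mul_nonneg (Real.exp_pos _).le (sq_nonneg _)
  have h2 : Λ / γ ≤ 1 / 2 := by rw [div_le_iff₀ hγ]; linarith
  set G := ∑ k, ∫ z, Real.exp (-2 * γ * z.2) * g k z ^ 2 ∂Qm T with hG
  have hGnn : 0 ≤ G := Finset.sum_nonneg fun k _ => hG0 k
  have h3 : G ≤ 8 * ∑ k, ∫ z, Real.exp (-2 * γ * z.2) * r k z ^ 2 ∂Qm T := by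
    nlinarith [mul_le_mul_of_nonneg_right h2 hGnn]
  have h4 : ∑ k, ∫ z, Real.exp (-2 * γ * z.2) * r k z ^ 2 ∂Qm T
      ≤ ∑ k, ∫ z, r k z ^ 2 ∂Qm T := by
    refine Finset.sum_le_sum fun k _ => ?_
    refine integral_mono_ae (integrable_time_mul hwt (hr k).integrable_sq)
      (hr k).integrable_sq ?_
    filter_upwards [ae_Qm_mem T] with z hz
    have : Real.exp (-2 * γ * z.2) ≤ 1 := by
      rw [Real.exp_le_one_iff]; nlinarith [mul_pos hγ hz.2.1]
    nlinarith [sq_nonneg (r k z)]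
  have h5 : ∫ z, g k z ^ 2 ∂Qm T ≤ Real.exp (2 * γ * T) * G := by
    have : ∫ z, g k z ^ 2 ∂Qm T
        ≤ Real.exp (2 * γ * T) * ∫ z, Real.exp (-2 * γ * z.2) * g k z ^ 2 ∂Qm T := by
      rw [← integral_const_mul]
      refine integral_mono_ae (hg k).integrable_sq
        ((integrable_time_mul hwt (hg k).integrable_sq).const_mul _) ?_
      filter_upwards [ae_Qm_mem T] with z hz
      rw [← mul_assoc, ← Real.exp_add]
      have : 1 ≤ Real.exp (2 * γ * T + -2 * γ * z.2) := by
        rw [Real.one_le_exp_iff]; nlinarith [mul_pos hγ (sub_pos.2 hz.2.2)]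
      nlinarith [sq_nonneg (g k z)]
    refine this.trans ?_
    gcongr
    exact Finset.single_le_sum (f := fun k => ∫ z, Real.exp (-2 * γ * z.2) * g k z ^ 2 ∂Qm T)
      (fun k _ => hG0 k) (Finset.mem_univ k)
  filter_upwards [(hd k).ae_sq_le ha hb hT hb₀ hbb (hg k)] with z hz
  refine hz.trans ?_
  rw [← hCa]
  calc Ca * (1 / (2 * b₀) * ∫ z, g k z ^ 2 ∂Qm T)
      ≤ Ca * (1 / (2 * b₀) * (Real.exp (2 * γ * T) * (8 * ∑ k, ∫ z, r k z ^ 2 ∂Qm T))) := by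
        gcongr
        refine h5.trans ?_
        gcongr
        linarith
    _ = _ := by ring

/-- Existence for a system of two equations with a Lipschitz right-hand side. -/
theorem exists_semilinear (ha : Weight a) (hb : Continuous b) (hT : 0 ≤ T) (hb₀ : 0 < b₀)
    (hbb : ∀ t, b₀ ≤ b t) {u₀ k₀ : Fin 2 → ℝ → ℝ} (hu₀ : ∀ k, MemHa a (u₀ k) (k₀ k))
    (N : (Fin 2 → ℝ × ℝ → ℝ) → (Fin 2 → ℝ × ℝ → ℝ) → Fin 2 → ℝ × ℝ → ℝ) {L : ℝ}
    (hN : ∀ u ux, (∀ k, L2Ha a T (u k) (ux k)) → ∀ k, MemLp (N u ux k) 2 (Qm T))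
    (hLip : ∀ u ux v vx k, ∀ z ∈ Om ×ˢ Ioo 0 T, |N u ux k z - N v vx k z|
      ≤ L * (∑ j, |u j z - v j z| + √(a z.1) * |ux k z - vx k z|)) :
    ∃ u ux, ∀ k, IsHeatSol a b T (u₀ k) (N u ux k) (u k) (ux k) := by
  have hC := ha.integral_inv_nonneg
  set Λ := L ^ 2 * (2 * (∫ r in Om, (a r)⁻¹) + 1) / b₀ with hΛ
  have hΛ0 : 0 ≤ Λ := by positivity
  -- Two components measured in the sup metric cost a factor `2`, so `Λ / γ ≤ 1/8` gives the squared
  -- contraction constant `1/4`.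
  set γ := 8 * Λ + 1 with hγd
  have hγ : 0 < γ := by positivity
  have hp : Continuous fun t => Real.exp (γ * t) := by fun_prop
  have hm : Continuous fun t => Real.exp (-γ * t) := by fun_prop
  -- The unknown of the fixed point problem is the source rather than the solution, since `N` also
  -- involves the gradient. It is stored as `h = exp(-γ t)` times the source, so that the weighted
  -- norm is the norm of `L²`.
  have hgm : ∀ h : Lp ℝ 2 (Qm T), MemLp (fun z => Real.exp (γ * z.2) * h z) 2 (Qm T) := fun h =>
    memLp_time_mul hp (Lp.memLp h)
  have hex : ∀ (k : Fin 2) (h : Lp ℝ 2 (Qm T)), ∃ u ux,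
      IsHeatSol a b T (u₀ k) (fun z => Real.exp (γ * z.2) * h z) u ux := fun k h =>
    exists_isHeatSol ha hb hT hb₀ hbb (hu₀ k) (hgm h)
  choose U UX hU using hex
  have hNm : ∀ (h : Fin 2 → Lp ℝ 2 (Qm T)) k,
      MemLp (N (fun k => U k (h k)) (fun k => UX k (h k)) k) 2 (Qm T) := fun h k =>
    hN _ _ (fun k => (hU k (h k)).memH.toL2Ha) k
  let Φ : (Fin 2 → Lp ℝ 2 (Qm T)) → (Fin 2 → Lp ℝ 2 (Qm T)) := fun h k =>
    (memLp_time_mul hm (hNm h k)).toLp _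
  have hcontr : ContractingWith (1 / 2) Φ := by
    refine ⟨by norm_num, LipschitzWith.of_dist_le_mul fun h h' => ?_⟩
    rw [dist_pi_le_iff (by positivity)]
    intro k
    have hd := fun k => (hU k (h k)).sub ha hb (hU k (h' k)) (hgm _) (hgm _)
    have h1 := weighted_lipschitz_le ha hb hT hb₀ hbb hd
      (fun k => (hgm (h k)).sub (hgm (h' k))) (r := fun _ _ => 0) (fun k => MemLp.zero)
      (N := fun k z => N (fun k => U k (h k)) (fun k => UX k (h k)) k z
        - N (fun k => U k (h' k)) (fun k => UX k (h' k)) k z)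
      (fun k => (hNm h k).sub (hNm h' k)) (L := L) (fun k => by
        filter_upwards [ae_Qm_mem T] with z hz
        simpa using hLip _ _ _ _ k z hz) hγ
    rw [← hΛ] at h1
    simp only [ne_eq, OfNat.ofNat_ne_zero, not_false_eq_true, zero_pow, mul_zero, integral_zero,
      Finset.sum_const_zero, zero_add] at h1
    have h2 : ∀ k, ∫ z, Real.exp (-2 * γ * z.2) * (Real.exp (γ * z.2) * h k z
        - Real.exp (γ * z.2) * h' k z) ^ 2 ∂Qm T = dist (h k) (h' k) ^ 2 := fun k => by
      rw [dist_eq_norm, ← real_inner_self_eq_norm_sq]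
      have h3 := integral_inner_toLp (Lp.memLp (h k - h' k)) (Lp.memLp (h k - h' k))
      rw [Lp.toLp_coeFn] at h3
      rw [h3]
      refine integral_congr_ae ?_
      filter_upwards [Lp.coeFn_sub (h k) (h' k)] with z hz
      rw [hz, Pi.sub_apply]
      have h4 : Real.exp (-2 * γ * z.2) * (Real.exp (γ * z.2) * Real.exp (γ * z.2)) = 1 := by
        rw [← Real.exp_add, ← Real.exp_add, Real.exp_eq_one_iff]; ring
      linear_combination (h k z - h' k z) ^ 2 * h4
    have h3 : dist (Φ h k) (Φ h' k) ^ 2 = ∫ z, Real.exp (-2 * γ * z.2)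
        * (N (fun k => U k (h k)) (fun k => UX k (h k)) k z
          - N (fun k => U k (h' k)) (fun k => UX k (h' k)) k z) ^ 2 ∂Qm T := by
      have h4 : Φ h k - Φ h' k = ((memLp_time_mul hm (hNm h k)).sub
          (memLp_time_mul hm (hNm h' k))).toLp _ := (MemLp.toLp_sub _ _).symm
      rw [dist_eq_norm, ← real_inner_self_eq_norm_sq, h4, integral_inner_toLp]
      refine integral_congr_ae (Eventually.of_forall fun z => ?_)
      simp only [Pi.sub_apply]
      have h4 : Real.exp (-γ * z.2) * Real.exp (-γ * z.2) = Real.exp (-2 * γ * z.2) := by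
        rw [← Real.exp_add]; ring_nf
      rw [← h4]
      ring
    have h4 : dist (Φ h k) (Φ h' k) ^ 2 ≤ ∑ k, ∫ z, Real.exp (-2 * γ * z.2)
        * (N (fun k => U k (h k)) (fun k => UX k (h k)) k z
          - N (fun k => U k (h' k)) (fun k => UX k (h' k)) k z) ^ 2 ∂Qm T := by
      rw [h3]
      exact Finset.single_le_sum (f := fun k => ∫ z, Real.exp (-2 * γ * z.2)
        * (N (fun k => U k (h k)) (fun k => UX k (h k)) k z
          - N (fun k => U k (h' k)) (fun k => UX k (h' k)) k z) ^ 2 ∂Qm T)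
        (fun k _ => integral_nonneg fun z => mul_nonneg (Real.exp_pos _).le (sq_nonneg _))
        (Finset.mem_univ k)
    simp only [h2] at h1
    have h5 : ∑ k, dist (h k) (h' k) ^ 2 ≤ 2 * dist h h' ^ 2 := by
      rw [Fin.sum_univ_two]
      have p0 := dist_le_pi_dist h h' 0
      have p1 := dist_le_pi_dist h h' 1
      nlinarith [dist_nonneg (x := h 0) (y := h' 0), dist_nonneg (x := h 1) (y := h' 1)]
    have h6 : Λ / γ ≤ 1 / 8 := by rw [div_le_iff₀ hγ]; linarith
    have h7 : dist (Φ h k) (Φ h' k) ^ 2 ≤ (1 / 2 * dist h h') ^ 2 := by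
      have h8 : Λ / γ * ∑ k, dist (h k) (h' k) ^ 2 ≤ 1 / 8 * (2 * dist h h' ^ 2) :=
        mul_le_mul h6 h5 (Finset.sum_nonneg fun k _ => sq_nonneg _) (by norm_num)
      have h9 := h4.trans (h1.trans h8)
      linarith
    have h8 := abs_le_of_sq_le_sq h7 (by positivity)
    simpa using h8
  obtain ⟨h, hfix⟩ : ∃ h, Φ h = h := ⟨_, hcontr.fixedPoint_isFixedPt⟩
  refine ⟨fun k => U k (h k), fun k => UX k (h k), fun k => (hU k (h k)).congr ?_⟩
  have h1 := (memLp_time_mul hm (hNm h k)).coeFn_toLp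
  have h2 : (memLp_time_mul hm (hNm h k)).toLp _ = h k := congrFun hfix k
  rw [h2] at h1
  filter_upwards [h1] with z hz
  rw [hz, ← mul_assoc, ← Real.exp_add]
  simp

end Semilinear

/-! ### Lipschitz and Taylor estimates from bounded partial derivatives -/

section Nonlinearity

theorem fderiv_apply_eq_pd (G : ℝ × ℝ → ℝ) (z δ : ℝ × ℝ) :
    fderiv ℝ G z δ = ∑ j, pd j G z * ![δ.1, δ.2] j := by
  have h : δ = δ.1 • ((1, 0) : ℝ × ℝ) + δ.2 • ((0, 1) : ℝ × ℝ) := by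
    ext <;> simp
  conv_lhs => rw [h, map_add, map_smul, map_smul]
  simp [pd, Fin.sum_univ_two, mul_comm]

theorem abs_pd_sum_le {G : ℝ × ℝ → ℝ} {M : ℝ} {z : ℝ × ℝ} (hM : ∑ j, |pd j G z| ≤ M)
    (δ : ℝ × ℝ) : |∑ j, pd j G z * ![δ.1, δ.2] j| ≤ M * (|δ.1| + |δ.2|) := by
  rw [Fin.sum_univ_two] at *
  simp only [Matrix.cons_val_zero, Matrix.cons_val_one]
  refine (abs_add_le _ _).trans ?_
  rw [abs_mul, abs_mul]
  nlinarith [abs_nonneg (pd 0 G z), abs_nonneg (pd 1 G z), abs_nonneg δ.1, abs_nonneg δ.2]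

/-- Along a segment, the derivative is given by the partial derivatives. -/
theorem hasDerivAt_segment {G : ℝ × ℝ → ℝ} (hG : Differentiable ℝ G) (z δ : ℝ × ℝ) (s : ℝ) :
    HasDerivAt (fun s : ℝ => G (z + s • δ)) (∑ j, pd j G (z + s • δ) * ![δ.1, δ.2] j) s := by
  rw [← fderiv_apply_eq_pd]
  have h1 : HasDerivAt (fun s : ℝ => z + s • δ) δ s := by
    simpa using ((hasDerivAt_id s).smul_const δ).const_add z
  exact (hG (z + s • δ)).hasFDerivAt.comp_hasDerivAt s h1

theorem abs_sub_le_of_pd {G : ℝ × ℝ → ℝ} (hG : Differentiable ℝ G) {M : ℝ}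
    (hM : ∀ z, ∑ j, |pd j G z| ≤ M) (z w : ℝ × ℝ) :
    |G w - G z| ≤ M * (|w.1 - z.1| + |w.2 - z.2|) := by
  have h := norm_image_sub_le_of_norm_deriv_le_segment_01' (f := fun s : ℝ => G (z + s • (w - z)))
    (C := M * (|w.1 - z.1| + |w.2 - z.2|))
    (fun s _ => (hasDerivAt_segment hG z (w - z) s).hasDerivWithinAt)
    (fun s _ => abs_pd_sum_le (hM _) (w - z))
  simpa using h

/-- Second order Taylor estimate. -/
theorem abs_taylor_le {G : ℝ × ℝ → ℝ} (hG : ContDiff ℝ 2 G) {M : ℝ}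
    (hM : ∀ j z, ∑ k, |pd k (pd j G) z| ≤ M) (z w : ℝ × ℝ) :
    |G w - G z - ∑ j, pd j G z * ![w.1 - z.1, w.2 - z.2] j|
      ≤ M * (|w.1 - z.1| + |w.2 - z.2|) ^ 2 := by
  have hpd : ∀ j, Differentiable ℝ (pd j G) := fun j =>
    ((hG.fderiv_right (m := 1) (by norm_num)).clm_apply contDiff_const).differentiable (by norm_num)
  set δ := w - z with hδ
  have hM0 : 0 ≤ M := (Finset.sum_nonneg fun k _ => abs_nonneg _).trans (hM 0 z)
  -- The mean value inequality for the remainder along the segment: its derivative is a difference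
  -- of gradients paired with `δ`, and the gradient is Lipschitz.
  have h := norm_image_sub_le_of_norm_deriv_le_segment_01'
    (f := fun s : ℝ => G (z + s • δ) - s * ∑ j, pd j G z * ![δ.1, δ.2] j)
    (C := M * (|δ.1| + |δ.2|) ^ 2)
    (fun s _ => ((hasDerivAt_segment (hG.differentiable (by norm_num)) z δ s).sub
      ((hasDerivAt_id s).mul_const _)).hasDerivWithinAt)
    (fun s hs => by
      rw [one_mul, ← Finset.sum_sub_distrib]
      simp only [← sub_mul]
      have h1 : ∀ j, |pd j G (z + s • δ) - pd j G z| ≤ M * (|δ.1| + |δ.2|) := fun j => by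
        refine (abs_sub_le_of_pd (hpd j) (hM j) z (z + s • δ)).trans ?_
        simp only [Prod.fst_add, Prod.snd_add, Prod.smul_fst, Prod.smul_snd, add_sub_cancel_left,
          smul_eq_mul, abs_mul, abs_of_nonneg hs.1]
        refine mul_le_mul_of_nonneg_left ?_ hM0
        nlinarith [abs_nonneg δ.1, abs_nonneg δ.2, hs.2]
      rw [Fin.sum_univ_two]
      simp only [Matrix.cons_val_zero, Matrix.cons_val_one]
      rw [Real.norm_eq_abs]
      refine (abs_add_le _ _).trans ?_
      rw [abs_mul, abs_mul]
      calc _ ≤ M * (|δ.1| + |δ.2|) * |δ.1| + M * (|δ.1| + |δ.2|) * |δ.2| := by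
            gcongr <;> exact h1 _
        _ = _ := by ring)
  have e : w = z + (1 : ℝ) • δ := by simp [hδ]
  have h2 : G w - G z - ∑ j, pd j G z * ![w.1 - z.1, w.2 - z.2] j
      = G (z + (1 : ℝ) • δ) - 1 * (∑ j, pd j G z * ![δ.1, δ.2] j)
        - (G (z + (0 : ℝ) • δ) - 0 * ∑ j, pd j G z * ![δ.1, δ.2] j) := by
    rw [← e]; simp only [hδ, Prod.fst_sub, Prod.snd_sub, zero_smul, add_zero]; ring
  rw [h2]
  exact h

end Nonlinearity

/-! ### Consequences of the assumptions on `a` and `ℓ` -/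

section Coefficients

variable {D : Data}

theorem Data.Assumptions.a_one (hD : D.Assumptions) : D.a 1 = 1 := by
  have h := hD.a_mul 1 (by simp) 1 (by simp)
  have h1 := hD.a_pos 1 (by simp)
  rw [one_mul] at h
  exact mul_left_cancel₀ h1.ne' (by linarith)

/-- The derivative of `a(y) y^{-K}` is `y^{-K-1} (y a' - K a) ≤ 0`, and the value at `1` is `a(1) =
1`. -/
theorem Data.Assumptions.exists_rpow_le (hD : D.Assumptions) :
    ∃ K ∈ Ioo (0 : ℝ) 1, ∀ x ∈ Ioc (0 : ℝ) 1, x ^ K ≤ D.a x := by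
  obtain ⟨K, hK, h⟩ := hD.a_weak
  refine ⟨K, hK, fun x hx => ?_⟩
  have hdiff : ∀ y ∈ Ioo (0 : ℝ) 1, HasDerivAt D.a (derivWithin D.a (Ioc 0 1) y) y := fun y hy => by
    have h1 := (hD.a_C1.differentiableOn (by norm_num)) y (Ioo_subset_Ioc_self hy)
    exact h1.hasDerivWithinAt.hasDerivAt (Ioc_mem_nhds hy.1 hy.2)
  have hanti : AntitoneOn (fun y => D.a y * y ^ (-K)) (Ioc 0 1) := by
    refine antitoneOn_of_deriv_nonpos (convex_Ioc 0 1) ?_ ?_ ?_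
    · refine (hD.a_cont.mono Ioc_subset_Icc_self).mul ?_
      exact continuousOn_id.rpow_const fun y hy => Or.inl hy.1.ne'
    · rw [interior_Ioc]
      intro y hy
      exact ((hdiff y hy).differentiableAt.mul
        (Real.differentiableAt_rpow_const_of_ne (-K) hy.1.ne')).differentiableWithinAt
    · rw [interior_Ioc]
      intro y hy
      have h1 := (hdiff y hy).mul (Real.hasDerivAt_rpow_const (p := -K) (Or.inl hy.1.ne'))
      rw [show (fun y => D.a y * y ^ (-K)) = (D.a * fun y => y ^ (-K)) from rfl, h1.deriv]
      have h2 := h y (Ioo_subset_Ioc_self hy)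
      have h3 : y ^ (-K) = y * y ^ (-K - 1) := by
        rw [Real.rpow_sub_one hy.1.ne', mul_div_cancel₀ _ hy.1.ne']
      have h4 : 0 < y ^ (-K - 1) := Real.rpow_pos_of_pos hy.1 _
      rw [h3]
      nlinarith
  have h1 := hanti hx (right_mem_Ioc.2 one_pos) hx.2
  simp only [hD.a_one, Real.one_rpow, mul_one] at h1
  rw [Real.rpow_neg hx.1.le, ← div_eq_mul_inv, le_div_iff₀ (Real.rpow_pos_of_pos hx.1 _),
    one_mul] at h1
  exact h1

/-- From `a ≥ x^K`: `K < 1` makes `1/a ≤ x^{-K}` integrable, and `K ≤ 2` gives `x² ≤ x^K ≤ a`. -/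
theorem Data.Assumptions.weight (hD : D.Assumptions) : Weight D.a := by
  obtain ⟨K, hK, h⟩ := hD.exists_rpow_le
  refine ⟨hD.a_cont, fun x hx => hD.a_pos x (Ioo_subset_Ioc_self hx), ?_, fun x hx => ?_⟩
  · have h1 : IntegrableOn (fun x : ℝ => x ^ (-K)) Om :=
      ((intervalIntegral.intervalIntegrable_rpow' (a := 0) (b := 1) (r := -K)
        (by linarith [hK.2])).1).mono_set Ioo_subset_Ioc_self
    refine Integrable.mono' h1 ?_ ?_
    · exact ((hD.a_cont.mono Ioo_subset_Icc_self).aemeasurable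
        measurableSet_Ioo).inv.aestronglyMeasurable
    · filter_upwards [ae_restrict_mem measurableSet_Ioo] with x hx
      have h2 := h x (Ioo_subset_Ioc_self hx)
      have h3 := Real.rpow_pos_of_pos hx.1 K
      rw [Real.norm_eq_abs, abs_of_pos (inv_pos.2 (h3.trans_le h2)), Real.rpow_neg hx.1.le]
      exact inv_anti₀ h3 h2
  · refine le_trans ?_ (h x (Ioo_subset_Ioc_self hx))
    rw [← Real.rpow_natCast]
    exact Real.rpow_le_rpow_of_exponent_ge hx.1 hx.2.le (by norm_num; linarith [hK.2])

theorem Data.Assumptions.a_ell_pos (hD : D.Assumptions) {t : ℝ} (ht : t ∈ Icc 0 D.T) :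
    0 < D.a (D.ell t) ∧ (1 ≤ D.ell t → D.a (D.ell t) = (D.a (D.ell t)⁻¹)⁻¹) := by
  have hl := hD.ell_pos t ht
  have key : 1 ≤ D.ell t → D.a (D.ell t) = (D.a (D.ell t)⁻¹)⁻¹ := fun h1 => by
    have h2 : (D.ell t)⁻¹ ∈ Ioc (0 : ℝ) 1 := ⟨inv_pos.2 hl, inv_le_one_of_one_le₀ h1⟩
    have h3 := hD.a_ell t ht _ (Ioc_subset_Icc_self h2)
    rw [mul_inv_cancel₀ hl.ne', hD.a_one] at h3
    exact eq_inv_of_mul_eq_one_left h3.symm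
  refine ⟨?_, key⟩
  rcases le_total (D.ell t) 1 with h | h
  · exact hD.a_pos _ ⟨hl, h⟩
  · rw [key h]
    exact inv_pos.2 (hD.a_pos _ ⟨inv_pos.2 hl, inv_le_one_of_one_le₀ h⟩)

/-- Continuity of `a` is assumed on `[0,1]` only. Beyond `1`, multiplicativity gives `a(ℓ) = 1 /
a(1/ℓ)`, and the two regimes are joined in one formula by truncating `ℓ` and `1/ℓ` at `1`. -/
theorem Data.Assumptions.continuousOn_a_ell (hD : D.Assumptions) :
    ContinuousOn (fun t => D.a (D.ell t)) (Icc 0 D.T) := by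
  have hl := hD.ell_C1.continuousOn
  have h1 : ContinuousOn (fun t => D.a (min (D.ell t) 1)) (Icc 0 D.T) :=
    hD.a_cont.comp (hl.inf continuousOn_const)
      fun t ht => ⟨le_min (hD.ell_pos t ht).le zero_le_one, min_le_right _ _⟩
  have h2 : ContinuousOn (fun t => D.a (min (D.ell t)⁻¹ 1)) (Icc 0 D.T) :=
    hD.a_cont.comp ((hl.inv₀ fun t ht => (hD.ell_pos t ht).ne').inf continuousOn_const)
      fun t ht => ⟨le_min (inv_pos.2 (hD.ell_pos t ht)).le zero_le_one, min_le_right _ _⟩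
  have h3 : ∀ t ∈ Icc 0 D.T, D.a (min (D.ell t)⁻¹ 1) ≠ 0 := fun t ht =>
    (hD.a_pos _ ⟨lt_min (inv_pos.2 (hD.ell_pos t ht)) one_pos, min_le_right _ _⟩).ne'
  refine (h1.mul (h2.inv₀ h3)).congr fun t ht => ?_
  have hp := hD.ell_pos t ht
  change D.a (D.ell t) = D.a (min (D.ell t) 1) * (D.a (min (D.ell t)⁻¹ 1))⁻¹
  rcases le_total (D.ell t) 1 with h | h
  · rw [min_eq_left h, min_eq_right ((one_le_inv₀ hp).2 h), hD.a_one]; simp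
  · rw [min_eq_right h, min_eq_left (inv_le_one_of_one_le₀ h), hD.a_one, one_mul,
      (hD.a_ell_pos ht).2 h]

/-- Continuous extension of `b` to the real line. -/
noncomputable def Data.bx (D : Data) (t : ℝ) : ℝ := D.b (max 0 (min D.T t))

/-- The logarithmic derivative of `ℓ`, extended continuously to the real line. -/
noncomputable def Data.beta (D : Data) (t : ℝ) : ℝ :=
  derivWithin D.ell (Icc 0 D.T) (max 0 (min D.T t)) / D.ell (max 0 (min D.T t))

theorem Data.Assumptions.clamp_mem (hD : D.Assumptions) (t : ℝ) :
    max 0 (min D.T t) ∈ Icc 0 D.T :=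
  ⟨le_max_left _ _, max_le hD.T_pos.le (min_le_left _ _)⟩

theorem clamp_eq {T t : ℝ} (ht : t ∈ Icc 0 T) : max 0 (min T t) = t := by
  rw [min_eq_right ht.2, max_eq_right ht.1]

theorem Data.bx_eq {t : ℝ} (ht : t ∈ Icc 0 D.T) : D.bx t = D.b t := by
  rw [Data.bx, clamp_eq ht]

theorem Data.Assumptions.continuous_bx (hD : D.Assumptions) : Continuous D.bx := by
  have h : ContinuousOn D.b (Icc 0 D.T) :=
    hD.continuousOn_a_ell.div (hD.ell_C1.continuousOn.pow 2)
      fun t ht => pow_ne_zero 2 (hD.ell_pos t ht).ne'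
  exact h.comp_continuous (by fun_prop) hD.clamp_mem

theorem Data.Assumptions.exists_bx_lower (hD : D.Assumptions) : ∃ b₀ > 0, ∀ t, b₀ ≤ D.bx t := by
  obtain ⟨s, hs, hmin⟩ := isCompact_Icc.exists_isMinOn (s := Icc 0 D.T)
    ⟨0, left_mem_Icc.2 hD.T_pos.le⟩ hD.continuous_bx.continuousOn
  refine ⟨D.bx s, ?_, fun t => ?_⟩
  · rw [Data.bx_eq hs]
    exact div_pos (hD.a_ell_pos hs).1 (pow_pos (hD.ell_pos s hs) 2)
  · have h := hmin (hD.clamp_mem t)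
    have h2 : D.bx (max 0 (min D.T t)) = D.bx t := by
      rw [Data.bx_eq (hD.clamp_mem t)]; rfl
    rw [← h2]; exact h

theorem Data.Assumptions.continuous_beta (hD : D.Assumptions) : Continuous D.beta := by
  have h : ContinuousOn (fun t => derivWithin D.ell (Icc 0 D.T) t / D.ell t) (Icc 0 D.T) :=
    (hD.ell_C1.continuousOn_derivWithin (uniqueDiffOn_Icc hD.T_pos) (by norm_num)).div
      hD.ell_C1.continuousOn fun t ht => (hD.ell_pos t ht).ne'
  exact h.comp_continuous (f := fun t => max 0 (min D.T t)) (by fun_prop) hD.clamp_mem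

theorem Data.Assumptions.exists_beta_bound (hD : D.Assumptions) :
    ∃ C, 0 ≤ C ∧ ∀ t, |D.beta t| ≤ C := by
  obtain ⟨C, hC⟩ := isCompact_Icc.exists_bound_of_continuousOn (s := Icc 0 D.T)
    hD.continuous_beta.continuousOn
  have h : ∀ t, |D.beta t| ≤ C := fun t => by
    have h1 := hC _ (hD.clamp_mem t)
    have h2 : D.beta (max 0 (min D.T t)) = D.beta t := by
      rw [Data.beta, clamp_eq (hD.clamp_mem t)]; rfl
    rw [h2] at h1; exact h1
  exact ⟨C, (abs_nonneg _).trans (h 0), h⟩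

/-- The degenerate factor cancels, leaving a drift coefficient that is bounded and linear in `x`. -/
theorem Data.Assumptions.B_mul_sqrt (hD : D.Assumptions) {x t : ℝ} (hx : x ∈ Om)
    (ht : t ∈ Icc 0 D.T) : D.B x t * √(D.a x) = D.beta t * x := by
  have h1 : √(D.a x) ≠ 0 := (Real.sqrt_pos.2 (hD.weight.pos x hx)).ne'
  have h2 := (hD.ell_pos t ht).ne'
  rw [Data.B, Data.beta, clamp_eq ht]
  field_simp

end Coefficients

/-! ### The drift term -/

section Drift

variable {a : ℝ → ℝ} {T : ℝ}

theorem Weight.le_sqrt (ha : Weight a) {x : ℝ} (hx : x ∈ Om) : x ≤ √(a x) :=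
  Real.le_sqrt_of_sq_le (ha.sq_le x hx)

/-- Since `x ≤ √a`, the drift is dominated by the weighted derivative and may serve as an `L²`
source. -/
theorem L2Ha.memLp_drift (ha : Weight a) {u ux : ℝ × ℝ → ℝ} (h : L2Ha a T u ux) :
    MemLp (fun z => z.1 * ux z) 2 (Qm T) := by
  refine h.weighted.mono ?_ ?_
  · have h1 : AEStronglyMeasurable (fun z : ℝ × ℝ => z.1 * (√(a z.1))⁻¹) (Qm T) := by
      rw [Qm_eq_prod]
      exact (continuous_id.aestronglyMeasurable.mul
        ha.memLp_inv_sqrt.1).comp_fst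
    refine (h1.mul h.weighted.1).congr ?_
    filter_upwards [ae_Qm_mem T] with z hz
    have h3 : √(a z.1) ≠ 0 := (Real.sqrt_pos.2 (ha.pos z.1 hz.1)).ne'
    simp only [Pi.mul_apply]
    field_simp
  · filter_upwards [ae_Qm_mem T] with z hz
    rw [norm_mul, norm_mul, Real.norm_eq_abs, Real.norm_eq_abs √(a z.1), abs_of_pos hz.1.1,
      abs_of_nonneg (Real.sqrt_nonneg _)]
    gcongr
    exact ha.le_sqrt hz.1

theorem MemHa.isPrimitive {u g : ℝ → ℝ} (h : MemHa a u g) :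
    IsPrimitive 1 0 g (fun x => ∫ r in Ioo 0 x, g r) :=
  ⟨(intervalIntegrable_iff_Ioo zero_le_one).2 h.integrable, fun t ht => by
    rw [zero_add, intervalIntegral_eq_Ioo ht.1]⟩

/-- Integration by parts for the drift term. -/
theorem MemHa.integral_drift {u g v k : ℝ → ℝ} (h : MemHa a u g)
    (h' : MemHa a v k) :
    ∫ x in Om, x * u x * k x = - ∫ x in Om, (u x + x * g x) * v x := by
  have hid : IsPrimitive 1 0 (fun _ => 1) (fun x => x) :=
    isPrimitive_of_hasDerivAt (u := fun x : ℝ => x) (fun t => hasDerivAt_id t) continuous_const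
  have h1 := (hid.mul zero_le_one h.isPrimitive)
  have hU := h1.continuousOn zero_le_one
  have hV := h'.isPrimitive.continuousOn zero_le_one
  -- Integrates the derivative of `(x u) v`; the boundary terms vanish because of the factor `x` at
  -- `0` and `v = 0` at `1`.
  have h2 := (h1.mul zero_le_one h'.isPrimitive).eq 1 (by simp)
  rw [h'.integral_eq_zero, mul_zero, mul_zero, zero_add] at h2
  have i1 := h1.int.mul_continuousOn (by rwa [← uIcc_of_le zero_le_one] at hV)
  have i2 := h'.isPrimitive.int.continuousOn_mul (by rwa [← uIcc_of_le zero_le_one] at hU)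
  rw [intervalIntegral.integral_add i1 i2, intervalIntegral_eq_Ioo zero_le_one,
    intervalIntegral_eq_Ioo zero_le_one] at h2
  have e1 : ∫ x in Om, x * u x * k x = ∫ x in Ioo 0 1, x * (∫ r in Ioo 0 x, g r) * k x := by
    refine integral_congr_ae ?_
    filter_upwards [h.eq_integral] with x hx
    rw [hx]
  have e2 : ∫ x in Om, (u x + x * g x) * v x
      = ∫ x in Ioo 0 1, (1 * (∫ r in Ioo 0 x, g r) + x * g x) * ∫ r in Ioo 0 x, k r := by
    refine integral_congr_ae ?_
    filter_upwards [h.eq_integral, h'.eq_integral] with x hx hx'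
    rw [hx, hx', one_mul]
  rw [e1, e2]
  linarith

theorem L2Ha.integral_drift (ha : Weight a) (hT : 0 ≤ T) {u g v k : ℝ × ℝ → ℝ}
    (h : L2Ha a T u g) (h' : L2Ha a T v k) {wt : ℝ → ℝ} (hwt : Continuous wt) :
    ∫ z, wt z.2 * (z.1 * u z * k z) ∂Qm T = - ∫ z, wt z.2 * ((u z + z.1 * g z) * v z) ∂Qm T := by
  have i1 : Integrable (fun z => z.1 * u z * k z) (Qm T) :=
    (MemLp.integrable_mul h.memLp (h'.memLp_drift ha)).congr
      (Eventually.of_forall fun z => by simp only [Pi.mul_apply]; ring)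
  have i2 : Integrable (fun z => (u z + z.1 * g z) * v z) (Qm T) :=
    MemLp.integrable_mul (h.memLp.add (h.memLp_drift ha)) h'.memLp
  rw [integral_Qm hT (integrable_time_mul hwt i1), integral_Qm hT (integrable_time_mul hwt i2),
    ← intervalIntegral.integral_neg, intervalIntegral_eq_Ioo hT, intervalIntegral_eq_Ioo hT]
  refine integral_congr_ae ?_
  filter_upwards [h.slice, h'.slice] with t ht ht'
  rw [integral_const_mul, integral_const_mul, ht.integral_drift ht']
  ring

end Drift

/-! ### Time reversal -/

section Reversal

/-- Time reversal. -/
def rev (T : ℝ) (z : ℝ × ℝ) : ℝ × ℝ := (z.1, T - z.2)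

variable {T : ℝ}

theorem rev_rev (z : ℝ × ℝ) : rev T (rev T z) = z := by simp [rev]

theorem measurable_rev : Measurable (rev T) := by unfold rev; fun_prop

theorem measurePreserving_rev : MeasurePreserving (rev T) volume volume :=
  (MeasurePreserving.id volume).prod (Measure.measurePreserving_sub_left volume T)

theorem measurableEmbedding_rev : MeasurableEmbedding (rev T) :=
  (MeasurableEquiv.ofInvolutive (rev T) rev_rev measurable_rev).measurableEmbedding

theorem rev_preimage (s t : ℝ) : rev T ⁻¹' (Om ×ˢ Ioo s t) = Om ×ˢ Ioo (T - t) (T - s) := by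
  ext z
  simp only [rev, mem_preimage, mem_prod, mem_Ioo]
  constructor <;> rintro ⟨h1, h2, h3⟩ <;> exact ⟨h1, by linarith, by linarith⟩

theorem setIntegral_rev (G : ℝ × ℝ → ℝ) (t : ℝ) :
    ∫ z in Om ×ˢ Ioo 0 (T - t), G (rev T z) = ∫ z in Om ×ˢ Ioo t T, G z := by
  rw [← (measurePreserving_rev (T := T)).setIntegral_preimage_emb measurableEmbedding_rev,
    rev_preimage]
  simp only [sub_sub_cancel, sub_zero, rev_rev]

theorem measurePreserving_rev_Qm : MeasurePreserving (rev T) (Qm T) (Qm T) := by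
  have h := (measurePreserving_rev (T := T)).restrict_preimage
    ((measurableSet_Ioo (a := (0 : ℝ)) (b := 1)).prod (measurableSet_Ioo (a := (0 : ℝ)) (b := T)))
  rw [rev_preimage, sub_self, sub_zero] at h
  exact h

theorem MemLp.rev {g : ℝ × ℝ → ℝ} (hg : MemLp g 2 (Qm T)) :
    MemLp (fun z => g (StackelbergNash.rev T z)) 2 (Qm T) :=
  hg.comp_measurePreserving measurePreserving_rev_Qm

theorem measurePreserving_sub_Ioo :
    MeasurePreserving (fun t => T - t) (volume.restrict (Ioo 0 T)) (volume.restrict (Ioo 0 T)) := by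
  have h := (Measure.measurePreserving_sub_left volume T).restrict_preimage
    (measurableSet_Ioo (a := (0 : ℝ)) (b := T))
  simpa using h

theorem MemH.rev {a : ℝ → ℝ} {p px : ℝ × ℝ → ℝ} (h : MemH a T p px) :
    MemH a T (fun z => p (StackelbergNash.rev T z)) (fun z => px (StackelbergNash.rev T z)) where
  memLp := StackelbergNash.MemLp.rev h.memLp
  weighted := StackelbergNash.MemLp.rev h.weighted
  slice := measurePreserving_sub_Ioo.quasiMeasurePreserving.ae h.slice
  memLp_slice t ht := h.memLp_slice (T - t) ⟨by linarith [ht.2], by linarith [ht.1]⟩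
  continuous t ht := by
    refine (h.continuous (T - t) ⟨by linarith [ht.2], by linarith [ht.1]⟩).comp ?_
    refine tendsto_nhdsWithin_of_tendsto_nhds_of_eventually_within _ ?_ ?_
    · exact ((by fun_prop : Continuous fun s : ℝ => T - s).tendsto t).mono_left nhdsWithin_le_nhds
    · filter_upwards [self_mem_nhdsWithin] with s hs
      exact ⟨by linarith [hs.2], by linarith [hs.1]⟩

end Reversal

/-! ### Reduction of state and adjoint equations to the heat equation -/

section Solutions

variable {D : Data} {u₀ : ℝ → ℝ} {f u p : ℝ × ℝ → ℝ}

theorem Data.Assumptions.memLp_beta_drift (hD : D.Assumptions) {u ux : ℝ × ℝ → ℝ}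
    (h : L2Ha D.a D.T u ux) : MemLp (fun z => D.beta z.2 * (z.1 * ux z)) 2 (Qm D.T) :=
  memLp_time_mul hD.continuous_beta (h.memLp_drift hD.weight)

/-- Forward solutions are heat solutions with the drift term as a source. -/
theorem Data.Assumptions.isForwardSol_iff (hD : D.Assumptions) (hf : MemLp f 2 (Qm D.T)) :
    D.IsForwardSol u₀ f u ↔ ∃ ux, IsHeatSol D.a D.bx D.T u₀
      (fun z => f z + D.beta z.2 * (z.1 * ux z)) u ux := by
  have ha := hD.weight
  have key : ∀ ux, MemH D.a D.T u ux → ∀ φ φx, MemHa D.a φ φx → ∀ t ∈ Icc 0 D.T,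
      (∫ z in Om ×ˢ Ioo 0 t,
        (D.b z.2 * D.a z.1 * ux z * φx z.1 - D.B z.1 z.2 * √(D.a z.1) * ux z * φ z.1)
        = (∫ z, D.bx z.2 * (D.a z.1 * ux z * φx z.1) ∂Qm t)
          - ∫ z, D.beta z.2 * (z.1 * ux z) * φ z.1 ∂Qm t) ∧
      ∫ z, (f z + D.beta z.2 * (z.1 * ux z)) * φ z.1 ∂Qm t
        = (∫ z, f z * φ z.1 ∂Qm t) + ∫ z, D.beta z.2 * (z.1 * ux z) * φ z.1 ∂Qm t := by
    intro ux h φ φx hφ t ht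
    have hL := h.toL2Ha
    have i1 := integrable_time_mul hD.continuous_bx
      ((hL.mono ht.2).integrable_mul ha (hφ.toL2Ha ha))
    have i2 := integrable_mul_fst ((hD.memLp_beta_drift hL).mono_measure (Qm_mono ht.2))
      (hφ.memLp ha)
    have i3 := integrable_mul_fst (hf.mono_measure (Qm_mono ht.2)) (hφ.memLp ha)
    refine ⟨?_, ?_⟩
    · rw [← integral_sub i1 i2]
      refine integral_congr_ae ?_
      filter_upwards [ae_Qm_mem t] with z hz
      have hz2 : z.2 ∈ Icc 0 D.T := ⟨hz.2.1.le, hz.2.2.le.trans ht.2⟩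
      rw [hD.B_mul_sqrt hz.1 hz2, Data.bx_eq hz2]
      ring
    · rw [← integral_add i3 i2]
      simp only [add_mul]
  constructor
  · rintro ⟨ux, hH, hw⟩
    refine ⟨ux, hH, fun φ φx hφ t ht => ?_⟩
    obtain ⟨e1, e2⟩ := key ux hH φ φx hφ t ht
    have e3 := hw φ φx hφ t ht
    rw [e1] at e3
    rw [e2]
    linarith
  · rintro ⟨ux, hH, hw⟩
    refine ⟨ux, hH, fun φ φx hφ t ht => ?_⟩
    obtain ⟨e1, e2⟩ := key ux hH φ φx hφ t ht
    have e3 := hw φ φx hφ t ht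
    rw [e2] at e3
    rw [e1]
    linarith

theorem Data.Assumptions.memLp_backward_source (hD : D.Assumptions) (hf : MemLp f 2 (Qm D.T))
    {p px : ℝ × ℝ → ℝ} (h : MemH D.a D.T p px) :
    MemLp (fun z => f (rev D.T z) - D.beta (D.T - z.2)
      * (p (rev D.T z) + z.1 * px (rev D.T z))) 2 (Qm D.T) :=
  (MemLp.rev hf).sub (memLp_time_mul (wt := fun t => D.beta (D.T - t))
    (hD.continuous_beta.comp (by fun_prop))
    (h.rev.memLp.add (h.rev.toL2Ha.memLp_drift hD.weight)))

/-- Backward solutions are time reversed heat solutions. -/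
theorem Data.Assumptions.isBackwardSol_iff (hD : D.Assumptions) (hf : MemLp f 2 (Qm D.T)) :
    D.IsBackwardSol f p ↔ ∃ px, MemH D.a D.T p px ∧
      IsHeatSol D.a (fun t => D.bx (D.T - t)) D.T (fun _ => 0)
      (fun z => f (rev D.T z) - D.beta (D.T - z.2) * (p (rev D.T z) + z.1 * px (rev D.T z)))
      (fun z => p (rev D.T z)) (fun z => px (rev D.T z)) := by
  have ha := hD.weight
  have hbr : Continuous fun t => D.bx (D.T - t) := hD.continuous_bx.comp (by fun_prop)
  have hbt : Continuous fun t => D.beta (D.T - t) := hD.continuous_beta.comp (by fun_prop)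
  have key : ∀ px, MemH D.a D.T p px → ∀ φ φx, MemHa D.a φ φx → ∀ t ∈ Icc 0 D.T,
      (∫ z in Om ×ˢ Ioo t D.T,
        (D.b z.2 * D.a z.1 * px z * φx z.1 - D.B z.1 z.2 * √(D.a z.1) * p z * φx z.1)
        = (∫ z, D.bx (D.T - z.2) * (D.a z.1 * px (rev D.T z) * φx z.1) ∂Qm (D.T - t))
          + ∫ z, D.beta (D.T - z.2) * ((p (rev D.T z) + z.1 * px (rev D.T z)) * φ z.1)
            ∂Qm (D.T - t)) ∧
      ∫ z, (f (rev D.T z) - D.beta (D.T - z.2) * (p (rev D.T z) + z.1 * px (rev D.T z)))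
          * φ z.1 ∂Qm (D.T - t)
        = (∫ z in Om ×ˢ Ioo t D.T, f z * φ z.1)
          - ∫ z, D.beta (D.T - z.2) * ((p (rev D.T z) + z.1 * px (rev D.T z)) * φ z.1)
            ∂Qm (D.T - t) := by
    intro px h φ φx hφ t ht
    have htT : D.T - t ≤ D.T := by linarith [ht.1]
    have ht0 : 0 ≤ D.T - t := by linarith [ht.2]
    have hL := h.rev.toL2Ha.mono htT
    have hφL := hφ.toL2Ha ha (T := D.T - t)
    have i1 := integrable_time_mul hbr (hL.integrable_mul ha hφL)
    have i2 : Integrable (fun z => z.1 * p (rev D.T z) * φx z.1) (Qm (D.T - t)) :=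
      (MemLp.integrable_mul hL.memLp (hφL.memLp_drift ha)).congr
        (Eventually.of_forall fun z => by simp only [Pi.mul_apply]; ring)
    have i3 : Integrable (fun z => (p (rev D.T z) + z.1 * px (rev D.T z)) * φ z.1)
        (Qm (D.T - t)) := integrable_mul_fst (hL.memLp.add (hL.memLp_drift ha)) (hφ.memLp ha)
    have i4 := integrable_mul_fst ((MemLp.rev hf).mono_measure (Qm_mono htT)) (hφ.memLp ha)
    refine ⟨?_, ?_⟩
    -- The adjoint drift falls on `φ_x` in the weak form; integration by parts moves it to `p + x
    -- p_x`, which is an admissible source.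
    · rw [← sub_neg_eq_add, ← hL.integral_drift ha ht0 hφL hbt,
        ← integral_sub i1 (integrable_time_mul hbt i2), ← setIntegral_rev]
      refine integral_congr_ae ?_
      filter_upwards [ae_Qm_mem (D.T - t)] with z hz
      have hz2 : D.T - z.2 ∈ Icc 0 D.T :=
        ⟨by linarith [hz.2.2, ht.1], by linarith [hz.2.1]⟩
      have e1 : D.B z.1 (D.T - z.2) * √(D.a z.1) = D.beta (D.T - z.2) * z.1 :=
        hD.B_mul_sqrt hz.1 hz2
      have e2 : D.bx (D.T - z.2) = D.b (D.T - z.2) := Data.bx_eq hz2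
      rw [e2]
      simp only [rev]
      rw [e1]
      ring
    · rw [← setIntegral_rev (fun z => f z * φ z.1) t]
      refine Eq.trans ?_ (integral_sub i4 (integrable_time_mul hbt i3))
      refine integral_congr_ae (Eventually.of_forall fun z => ?_)
      simp only [rev]
      ring
  constructor
  · rintro ⟨px, hH, hw⟩
    refine ⟨px, hH, hH.rev, fun φ φx hφ τ hτ => ?_⟩
    have ht : D.T - τ ∈ Icc 0 D.T := ⟨by linarith [hτ.2], by linarith [hτ.1]⟩
    obtain ⟨e1, e2⟩ := key px hH φ φx hφ _ ht
    have e3 := hw φ φx hφ _ ht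
    rw [e1] at e3
    rw [sub_sub_cancel] at e2 e3
    rw [e2]
    simp only [zero_mul, integral_zero]
    simp only [rev] at e3 ⊢
    linarith
  · rintro ⟨px, hH, hH', hw⟩
    refine ⟨px, hH, fun φ φx hφ t ht => ?_⟩
    obtain ⟨e1, e2⟩ := key px hH φ φx hφ t ht
    have e3 := hw φ φx hφ (D.T - t) ⟨by linarith [ht.2], by linarith [ht.1]⟩
    rw [e2] at e3
    rw [e1]
    simp only [zero_mul, integral_zero] at e3
    simp only [rev, sub_sub_cancel] at e3 ⊢
    linarith

/-- Duality between the state equation and the adjoint equation. -/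
theorem Data.Assumptions.duality (hD : D.Assumptions) {A : ℝ × ℝ → ℝ}
    (hf : MemLp f 2 (Qm D.T)) (hA : MemLp A 2 (Qm D.T))
    (hu : ∃ ux, IsHeatSol D.a D.bx D.T (fun _ => 0)
      (fun z => f z + D.beta z.2 * (z.1 * ux z)) u ux) (hp : D.IsBackwardSol A p) :
    ∫ z, f z * p z ∂Qm D.T = ∫ z, u z * A z ∂Qm D.T := by
  have ha := hD.weight
  obtain ⟨ux, hux⟩ := hu
  obtain ⟨px, hpH, hpx⟩ := (hD.isBackwardSol_iff hA).1 hp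
  have hs := hD.memLp_backward_source hA hpH
  have hg := hf.add (hD.memLp_beta_drift hux.memH.toL2Ha)
  have h := hux.duality ha hD.continuous_bx hD.T_pos.le hpx hg hs
    (MemLp.rev hpx.memH.memLp) (MemLp.rev hs)
  simp only [rev, sub_sub_cancel, Prod.mk.eta] at h
  have i1 : Integrable (fun z => D.beta z.2 * (z.1 * p z * ux z)) (Qm D.T) :=
    integrable_time_mul hD.continuous_beta
      ((MemLp.integrable_mul hpH.memLp (hux.memH.toL2Ha.memLp_drift ha)).congr
        (Eventually.of_forall fun z => by simp only [Pi.mul_apply]; ring))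
  have i2 : Integrable (fun z => D.beta z.2 * ((p z + z.1 * px z) * u z)) (Qm D.T) :=
    integrable_time_mul hD.continuous_beta
      (MemLp.integrable_mul (hpH.memLp.add (hpH.toL2Ha.memLp_drift ha)) hux.memH.memLp)
  have i3 : Integrable (fun z => f z * p z) (Qm D.T) := MemLp.integrable_mul hf hpH.memLp
  have i4 : Integrable (fun z => u z * A z) (Qm D.T) := MemLp.integrable_mul hux.memH.memLp hA
  have e1 : ∫ z, (f z + D.beta z.2 * (z.1 * ux z)) * p z ∂Qm D.T
      = (∫ z, f z * p z ∂Qm D.T) + ∫ z, D.beta z.2 * (z.1 * p z * ux z) ∂Qm D.T := by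
    rw [← integral_add i3 i1]
    congr 1; funext z; ring
  have e2 : ∫ z, u z * (A z - D.beta z.2 * (p z + z.1 * px z)) ∂Qm D.T
      = (∫ z, u z * A z ∂Qm D.T) - ∫ z, D.beta z.2 * ((p z + z.1 * px z) * u z) ∂Qm D.T := by
    rw [← integral_sub i4 i2]
    congr 1; funext z; ring
  -- The two drift contributions are adjoint to each other and cancel.
  rw [e1, e2, hpH.toL2Ha.integral_drift ha hD.T_pos.le hux.memH.toL2Ha hD.continuous_beta] at h
  linarith

end Solutions

/-! ### Restriction to control and observation regions -/

section Regions

variable {S : Set ℝ} {T : ℝ}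

theorem Qm_restrict (hS : MeasurableSet S) (hSO : S ⊆ Om) :
    (Qm T).restrict (S ×ˢ univ) = volume.restrict (S ×ˢ Ioo 0 T) := by
  rw [Measure.restrict_restrict (hS.prod MeasurableSet.univ), prod_inter_prod, univ_inter,
    inter_eq_left.2 hSO]

theorem indicator_fst_mul (S : Set ℝ) (f : ℝ × ℝ → ℝ) :
    (fun z : ℝ × ℝ => (S.indicator 1 z.1 : ℝ) * f z) = (S ×ˢ univ).indicator f := by
  funext z
  by_cases hz : z.1 ∈ S <;> simp [indicator, hz]

theorem memLp_indicator_mul (hS : MeasurableSet S) (hSO : S ⊆ Om) {f : ℝ × ℝ → ℝ}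
    (hf : MemLp f 2 (volume.restrict (S ×ˢ Ioo 0 T))) :
    MemLp (fun z => (S.indicator 1 z.1 : ℝ) * f z) 2 (Qm T) := by
  rw [indicator_fst_mul, memLp_indicator_iff_restrict (hS.prod MeasurableSet.univ),
    Qm_restrict hS hSO]
  exact hf

theorem integral_indicator_mul (hS : MeasurableSet S) (hSO : S ⊆ Om) (f : ℝ × ℝ → ℝ) :
    ∫ z, (S.indicator 1 z.1 : ℝ) * f z ∂Qm T = ∫ z in S ×ˢ Ioo 0 T, f z := by
  rw [indicator_fst_mul, integral_indicator (hS.prod MeasurableSet.univ), Qm_restrict hS hSO]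

theorem restrict_le_Qm (hSO : S ⊆ Om) : volume.restrict (S ×ˢ Ioo 0 T) ≤ Qm T :=
  Measure.restrict_mono (prod_mono hSO le_rfl) le_rfl

theorem indicator_mul_congr (hS : MeasurableSet S) (hSO : S ⊆ Om) {f g : ℝ × ℝ → ℝ}
    (h : f =ᵐ[volume.restrict (S ×ˢ Ioo 0 T)] g) :
    (fun z => (S.indicator 1 z.1 : ℝ) * f z) =ᵐ[Qm T] fun z => (S.indicator 1 z.1 : ℝ) * g z := by
  rw [← Qm_restrict hS hSO, EventuallyEq, ae_restrict_iff' (hS.prod MeasurableSet.univ)] at h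
  filter_upwards [h] with z hz
  by_cases hzS : z.1 ∈ S
  · rw [hz ⟨hzS, mem_univ _⟩]
  · simp [indicator, hzS]

end Regions

/-! ### The state system -/

section State

variable {D : Data}

theorem Data.Assumptions.exists_F_bound (hD : D.Assumptions) :
    ∃ M, 0 ≤ M ∧ (∀ i z, ∑ j, |pd j (D.F i) z| ≤ M) ∧
      ∀ i j z, ∑ k, |pd k (pd j (D.F i)) z| ≤ M := by
  obtain ⟨M, hM, h⟩ := hD.F_bound
  have n1 : ∀ i z, 0 ≤ ∑ j, |pd j (D.F i) z| := fun i z => Finset.sum_nonneg fun _ _ => abs_nonneg _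
  have n2 : ∀ i j z, 0 ≤ ∑ k, |pd k (pd j (D.F i)) z| :=
    fun i j z => Finset.sum_nonneg fun _ _ => abs_nonneg _
  refine ⟨M, hM.le, fun i z => ?_, fun i j z => ?_⟩
  · linarith [h i z, Finset.sum_nonneg fun (j : Fin 2) (_ : j ∈ Finset.univ) => n2 i j z]
  · have := Finset.single_le_sum (fun j _ => n2 i j z) (Finset.mem_univ j)
    linarith [h i z, n1 i z]

theorem Data.Assumptions.continuous_pd (hD : D.Assumptions) (k j : Fin 2) :
    Continuous (pd k (D.F j)) :=
  (((hD.F_C2 j).fderiv_right (m := 1) (by norm_num)).clm_apply contDiff_const).continuous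

/-- As `F_i(0,0) = 0`, the Lipschitz bound is a bound of linear growth without constant term. -/
theorem Data.Assumptions.memLp_F (hD : D.Assumptions) {y : Fin 2 → ℝ × ℝ → ℝ} {m : Measure (ℝ × ℝ)}
    (hy : ∀ k, MemLp (y k) 2 m) (i : Fin 2) : MemLp (fun z => D.F i (y 0 z, y 1 z)) 2 m := by
  obtain ⟨M, hM, hF, -⟩ := hD.exists_F_bound
  refine ((hy 0).norm.add (hy 1).norm).of_le_mul (c := M)
    ((hD.F_C2 i).continuous.comp_aestronglyMeasurable ((hy 0).1.prodMk (hy 1).1)) ?_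
  refine Eventually.of_forall fun z => ?_
  have h := abs_sub_le_of_pd ((hD.F_C2 i).differentiable (by norm_num)) (hF i) (0, 0)
    (y 0 z, y 1 z)
  simp only [hD.F_zero, sub_zero] at h
  rw [Real.norm_eq_abs, Real.norm_eq_abs]
  refine h.trans (mul_le_mul_of_nonneg_left ?_ hM)
  exact le_abs_self _

theorem Data.Assumptions.memLp_pd_mul (hD : D.Assumptions) {y : Fin 2 → ℝ × ℝ → ℝ}
    {m : Measure (ℝ × ℝ)} (hy : ∀ k, MemLp (y k) 2 m) {q : ℝ × ℝ → ℝ} (hq : MemLp q 2 m)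
    (k j : Fin 2) : MemLp (fun z => pd k (D.F j) (y 0 z, y 1 z) * q z) 2 m := by
  obtain ⟨M, hM, hF, -⟩ := hD.exists_F_bound
  refine hq.of_le_mul (c := M) (((hD.continuous_pd k j).comp_aestronglyMeasurable
    ((hy 0).1.prodMk (hy 1).1)).mul hq.1) (Eventually.of_forall fun z => ?_)
  rw [norm_mul]
  gcongr
  exact (Finset.single_le_sum (f := fun k => |pd k (D.F j) (y 0 z, y 1 z)|)
    (fun _ _ => abs_nonneg _) (Finset.mem_univ k)).trans (hF j _)

/-- The source terms of the state system. -/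
noncomputable def Data.src (D : Data) (h : ℝ × ℝ → ℝ) (v : Fin 2 → ℝ × ℝ → ℝ) (k : Fin 2)
    (z : ℝ × ℝ) : ℝ :=
  if k = 0 then (D.O.indicator 1 z.1 : ℝ) * h z + ∑ i, ((D.Of i).indicator 1 z.1 : ℝ) * v i z else 0

variable {h : ℝ × ℝ → ℝ} {v v' : Fin 2 → ℝ × ℝ → ℝ} {y y' : Fin 2 → ℝ × ℝ → ℝ}

theorem Data.Assumptions.memLp_src (hD : D.Assumptions)
    (hh : MemLp h 2 (volume.restrict (D.O ×ˢ Ioo 0 D.T)))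
    (hv : ∀ i, MemLp (v i) 2 (volume.restrict (D.Of i ×ˢ Ioo 0 D.T))) (k : Fin 2) :
    MemLp (D.src h v k) 2 (Qm D.T) := by
  unfold Data.src
  by_cases hk : k = 0
  · simp only [hk, if_true]
    exact (memLp_indicator_mul hD.O_meas hD.O_sub hh).add
      (memLp_finsetSum Finset.univ
        fun i _ => memLp_indicator_mul (hD.Of_meas i) (hD.Of_sub i) (hv i))
  · simp only [hk, if_false]
    exact MemLp.zero'

/-- States are heat solutions with all lower order terms as sources. -/
theorem Data.Assumptions.isState_iff (hD : D.Assumptions)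
    (hh : MemLp h 2 (volume.restrict (D.O ×ˢ Ioo 0 D.T)))
    (hv : ∀ i, MemLp (v i) 2 (volume.restrict (D.Of i ×ˢ Ioo 0 D.T))) :
    D.IsState h v y ↔ ∃ yx : Fin 2 → ℝ × ℝ → ℝ, ∀ k, IsHeatSol D.a D.bx D.T (D.y0 k)
      (fun z => (D.src h v k z - D.F k (y 0 z, y 1 z)) + D.beta z.2 * (z.1 * yx k z))
      (y k) (yx k) := by
  have e : D.IsState h v y ↔ ∀ k, D.IsForwardSol (D.y0 k)
      (fun z => D.src h v k z - D.F k (y 0 z, y 1 z)) (y k) := by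
    rw [Fin.forall_fin_two, Data.IsState]
    simp [Data.src]
  rw [e]
  constructor
  · intro H
    have hy : ∀ k, MemLp (y k) 2 (Qm D.T) := fun k => by
      obtain ⟨ux, hux, -⟩ := H k
      exact hux.memLp
    choose yx hyx using fun k => (hD.isForwardSol_iff
      ((hD.memLp_src hh hv k).sub (hD.memLp_F hy k))).1 (H k)
    exact ⟨yx, hyx⟩
  · rintro ⟨yx, hyx⟩ k
    exact (hD.isForwardSol_iff ((hD.memLp_src hh hv k).sub
      (hD.memLp_F (fun k => (hyx k).memH.memLp) k))).2 ⟨yx k, hyx k⟩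

theorem Data.IsState.memLp (H : D.IsState h v y) (k : Fin 2) : MemLp (y k) 2 (Qm D.T) := by
  obtain ⟨⟨_, h0, -⟩, ⟨_, h1, -⟩⟩ := H
  fin_cases k
  exacts [h0.memLp, h1.memLp]

/-- The controls enter through their values on `O_i × (0,T)` alone. This allows `v^i` to be
exchanged with its expression through the adjoint, which agrees with it only there and only a.e. -/
theorem Data.Assumptions.isState_congr (hD : D.Assumptions)
    (hh : MemLp h 2 (volume.restrict (D.O ×ˢ Ioo 0 D.T)))
    (hv : ∀ i, MemLp (v i) 2 (volume.restrict (D.Of i ×ˢ Ioo 0 D.T)))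
    (hvv : ∀ i, v i =ᵐ[volume.restrict (D.Of i ×ˢ Ioo 0 D.T)] v' i) (H : D.IsState h v y) :
    D.IsState h v' y := by
  rw [hD.isState_iff hh hv] at H
  rw [hD.isState_iff hh fun i => (hv i).ae_eq (hvv i)]
  obtain ⟨yx, hyx⟩ := H
  refine ⟨yx, fun k => (hyx k).congr ?_⟩
  filter_upwards [indicator_mul_congr (hD.Of_meas 0) (hD.Of_sub 0) (hvv 0),
    indicator_mul_congr (hD.Of_meas 1) (hD.Of_sub 1) (hvv 1)] with z h0 h1
  simp only [Data.src, Fin.sum_univ_two, h0, h1]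

theorem Data.Assumptions.abs_beta_drift_le (hD : D.Assumptions) {C : ℝ} (hC : ∀ t, |D.beta t| ≤ C)
    {x : ℝ} (hx : x ∈ Om) (t r : ℝ) : |D.beta t * (x * r)| ≤ C * (√(D.a x) * |r|) := by
  rw [abs_mul, abs_mul, abs_of_pos hx.1]
  have := hD.weight.le_sqrt hx
  have h0 : 0 ≤ C := (abs_nonneg _).trans (hC t)
  have := hx.1.le
  gcongr
  exact hC t

/-- The lower order terms of the state system are Lipschitz. -/
theorem Data.Assumptions.exists_state_lipschitz (hD : D.Assumptions) :
    ∃ L, 0 ≤ L ∧ ∀ (u ux w wx : Fin 2 → ℝ × ℝ → ℝ) (k : Fin 2), ∀ z ∈ Om ×ˢ Ioo 0 D.T,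
      |(D.beta z.2 * (z.1 * ux k z) - D.F k (u 0 z, u 1 z))
          - (D.beta z.2 * (z.1 * wx k z) - D.F k (w 0 z, w 1 z))|
        ≤ L * (∑ j, |u j z - w j z| + √(D.a z.1) * |ux k z - wx k z|) := by
  obtain ⟨M, hM, hF, -⟩ := hD.exists_F_bound
  obtain ⟨C, hC, hβ⟩ := hD.exists_beta_bound
  refine ⟨M + C, by positivity, fun u ux w wx k z hz => ?_⟩
  have h1 := abs_sub_le_of_pd ((hD.F_C2 k).differentiable (by norm_num)) (hF k)
    (u 0 z, u 1 z) (w 0 z, w 1 z)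
  have h2 := hD.abs_beta_drift_le hβ hz.1 z.2 (ux k z - wx k z)
  rw [Fin.sum_univ_two]
  simp only [abs_sub_comm (w 0 z), abs_sub_comm (w 1 z)] at h1
  have h3 : (D.beta z.2 * (z.1 * ux k z) - D.F k (u 0 z, u 1 z))
      - (D.beta z.2 * (z.1 * wx k z) - D.F k (w 0 z, w 1 z))
      = D.beta z.2 * (z.1 * (ux k z - wx k z))
        + (D.F k (w 0 z, w 1 z) - D.F k (u 0 z, u 1 z)) := by ring
  rw [h3]
  refine (abs_add_le _ _).trans ?_
  have h4 : 0 ≤ C * (|u 0 z - w 0 z| + |u 1 z - w 1 z|) := by positivity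
  have h5 : 0 ≤ M * (√(D.a z.1) * |ux k z - wx k z|) := by positivity
  linarith

theorem Data.Assumptions.exists_isState (hD : D.Assumptions)
    (hh : MemLp h 2 (volume.restrict (D.O ×ˢ Ioo 0 D.T)))
    (hv : ∀ i, MemLp (v i) 2 (volume.restrict (D.Of i ×ˢ Ioo 0 D.T))) :
    ∃ y, D.IsState h v y := by
  obtain ⟨b₀, hb₀, hbb⟩ := hD.exists_bx_lower
  obtain ⟨L, hL, hLip⟩ := hD.exists_state_lipschitz
  choose k₀ hk₀ using hD.y0_mem
  obtain ⟨u, ux, H⟩ := exists_semilinear hD.weight hD.continuous_bx hD.T_pos.le hb₀ hbb hk₀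
    (fun u ux k z => (D.src h v k z - D.F k (u 0 z, u 1 z)) + D.beta z.2 * (z.1 * ux k z))
    (L := L)
    (fun u ux hu k => ((hD.memLp_src hh hv k).sub (hD.memLp_F (fun k => (hu k).memLp) k)).add
      (hD.memLp_beta_drift (hu k)))
    (fun u ux w wx k z hz => by
      refine le_of_eq_of_le ?_ (hLip u ux w wx k z hz)
      congr 1
      ring)
  exact ⟨u, (hD.isState_iff hh hv).2 ⟨ux, H⟩⟩

theorem Data.Assumptions.isState_state (hD : D.Assumptions)
    (hh : MemLp h 2 (volume.restrict (D.O ×ˢ Ioo 0 D.T)))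
    (hv : ∀ i, MemLp (v i) 2 (volume.restrict (D.Of i ×ˢ Ioo 0 D.T))) :
    D.IsState h v (D.state h v) :=
  Classical.epsilon_spec (hD.exists_isState hh hv)

/-- The equation satisfied by the difference of two states. -/
theorem Data.Assumptions.state_sub (hD : D.Assumptions)
    (hh : MemLp h 2 (volume.restrict (D.O ×ˢ Ioo 0 D.T)))
    (hv : ∀ i, MemLp (v i) 2 (volume.restrict (D.Of i ×ˢ Ioo 0 D.T)))
    (hv' : ∀ i, MemLp (v' i) 2 (volume.restrict (D.Of i ×ˢ Ioo 0 D.T)))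
    (H : D.IsState h v y) (H' : D.IsState h v' y') :
    ∃ yx yx' : Fin 2 → ℝ × ℝ → ℝ, ∀ k, L2Ha D.a D.T (y k) (yx k) ∧ L2Ha D.a D.T (y' k) (yx' k) ∧
      IsHeatSol D.a D.bx D.T (fun _ => 0)
      (fun z => ((D.src h v' k z - D.src h v k z)
          - (D.F k (y' 0 z, y' 1 z) - D.F k (y 0 z, y 1 z)))
        + D.beta z.2 * (z.1 * (yx' k z - yx k z)))
      (fun z => y' k z - y k z) (fun z => yx' k z - yx k z) := by
  obtain ⟨yx, hyx⟩ := (hD.isState_iff hh hv).1 H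
  obtain ⟨yx', hyx'⟩ := (hD.isState_iff hh hv').1 H'
  refine ⟨yx, yx', fun k => ⟨(hyx k).memH.toL2Ha, (hyx' k).memH.toL2Ha, ?_⟩⟩
  have m : MemLp (fun z => (D.src h v k z - D.F k (y 0 z, y 1 z))
      + D.beta z.2 * (z.1 * yx k z)) 2 (Qm D.T) :=
    ((hD.memLp_src hh hv k).sub (hD.memLp_F H.memLp k)).add
      (hD.memLp_beta_drift (hyx k).memH.toL2Ha)
  have m' : MemLp (fun z => (D.src h v' k z - D.F k (y' 0 z, y' 1 z))
      + D.beta z.2 * (z.1 * yx' k z)) 2 (Qm D.T) :=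
    ((hD.memLp_src hh hv' k).sub (hD.memLp_F H'.memLp k)).add
      (hD.memLp_beta_drift (hyx' k).memH.toL2Ha)
  refine ((hyx' k).sub hD.weight hD.continuous_bx (hyx k) m' m).congr
    (Eventually.of_forall fun z => ?_)
  simp only
  ring

/-- Lipschitz dependence of the state on the controls, uniformly on the cylinder. -/
theorem Data.Assumptions.exists_state_stability (hD : D.Assumptions)
    (hh : MemLp h 2 (volume.restrict (D.O ×ˢ Ioo 0 D.T))) :
    ∃ C, 0 ≤ C ∧ ∀ v v' y y' : Fin 2 → ℝ × ℝ → ℝ,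
      (∀ i, MemLp (v i) 2 (volume.restrict (D.Of i ×ˢ Ioo 0 D.T))) →
      (∀ i, MemLp (v' i) 2 (volume.restrict (D.Of i ×ˢ Ioo 0 D.T))) →
      D.IsState h v y → D.IsState h v' y' → ∀ k, ∀ᵐ z ∂Qm D.T,
        (y' k z - y k z) ^ 2 ≤ C * ∫ z, (D.src h v' 0 z - D.src h v 0 z) ^ 2 ∂Qm D.T := by
  obtain ⟨b₀, hb₀, hbb⟩ := hD.exists_bx_lower
  obtain ⟨L, hL, hLip⟩ := hD.exists_state_lipschitz
  obtain ⟨C, hC, H⟩ := exists_stability_const hD.weight hD.continuous_bx hD.T_pos.le hb₀ hbb L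
  refine ⟨C, hC, fun v v' y y' hv hv' hy hy' k => ?_⟩
  obtain ⟨yx, yx', hδ⟩ := hD.state_sub hh hv hv' hy hy'
  have hr : ∀ k, MemLp (fun z => D.src h v' k z - D.src h v k z) 2 (Qm D.T) := fun k =>
    (hD.memLp_src hh hv' k).sub (hD.memLp_src hh hv k)
  -- The difference of controls plays the role of `r`; drift and nonlinearity are the part that is
  -- Lipschitz in the solution. The second component of `r` is zero.
  have := H _ _ _ (fun k z => D.src h v' k z - D.src h v k z) (fun k => (hδ k).2.2)
    (fun k => ?_) hr (fun k => ?_) k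
  · simpa [Fin.sum_univ_two, Data.src] using this
  · have e : (fun z => D.beta z.2 * (z.1 * (yx' k z - yx k z)))
        = fun z => D.beta z.2 * (z.1 * yx' k z) - D.beta z.2 * (z.1 * yx k z) := by
      funext z; ring
    refine ((hr k).sub ((hD.memLp_F hy'.memLp k).sub (hD.memLp_F hy.memLp k))).add ?_
    rw [e]
    exact (hD.memLp_beta_drift (hδ k).2.1).sub (hD.memLp_beta_drift (hδ k).1)
  · filter_upwards [ae_Qm_mem D.T] with z hz
    refine le_trans ?_ (add_le_add_right (hLip y' yx' y yx k z hz) _)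
    refine le_trans (le_of_eq ?_) (abs_add_le _ _)
    congr 1
    ring

end State

/-! ### Existence of adjoint states -/

section Adjoint

variable {D : Data} {y q : Fin 2 → ℝ × ℝ → ℝ} {i : Fin 2}

theorem MemHa.zero (a : ℝ → ℝ) : MemHa a (fun _ => 0) (fun _ => 0) := by
  constructor <;> simp

theorem Data.Assumptions.memLp_observation (hD : D.Assumptions) (hy : ∀ k, MemLp (y k) 2 (Qm D.T))
    (i k : Fin 2) : MemLp (fun z => D.α i * (y k z - D.yd i k z)
      * ((D.Od i).indicator 1 z.1 : ℝ)) 2 (Qm D.T) := by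
  have h := (memLp_indicator_mul (hD.Od_meas i) (hD.Od_sub i)
    (((hy k).mono_measure (restrict_le_Qm (hD.Od_sub i))).sub (hD.yd_memLp i k))).const_mul (D.α i)
  refine h.ae_eq (Eventually.of_forall fun z => ?_)
  simp only [Pi.sub_apply]
  ring

theorem Data.Assumptions.memLp_adjoint_source (hD : D.Assumptions)
    (hy : ∀ k, MemLp (y k) 2 (Qm D.T)) (hq : ∀ k, MemLp (q k) 2 (Qm D.T)) (i k : Fin 2) :
    MemLp (fun z => D.α i * (y k z - D.yd i k z) * ((D.Od i).indicator 1 z.1 : ℝ)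
      - ∑ j, pd k (D.F j) (y 0 z, y 1 z) * q j z) 2 (Qm D.T) :=
  (hD.memLp_observation hy i k).sub
    (memLp_finsetSum Finset.univ fun j _ => hD.memLp_pd_mul hy (hq j) k j)

theorem Data.IsAdjoint.memLp (H : D.IsAdjoint y i q) (k : Fin 2) : MemLp (q k) 2 (Qm D.T) := by
  obtain ⟨_, h, -⟩ := H k
  exact h.memLp

/-- Time reversed, the adjoint system is a forward problem with affine right-hand side. Its
Lipschitz constant combines the bound `M` for `DF` with the bound `C` for `ℓ'/ℓ`. -/
theorem Data.Assumptions.exists_isAdjoint (hD : D.Assumptions)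
    (hy : ∀ k, MemLp (y k) 2 (Qm D.T)) (i : Fin 2) : ∃ q, D.IsAdjoint y i q := by
  obtain ⟨b₀, hb₀, hbb⟩ := hD.exists_bx_lower
  obtain ⟨M, hM, hF, -⟩ := hD.exists_F_bound
  obtain ⟨C, hC, hβ⟩ := hD.exists_beta_bound
  have hpd : ∀ k j z, |pd k (D.F j) z| ≤ M := fun k j z =>
    (Finset.single_le_sum (f := fun k => |pd k (D.F j) z|) (fun _ _ => abs_nonneg _)
      (Finset.mem_univ k)).trans (hF j z)
  obtain ⟨u, ux, H⟩ := exists_semilinear (b := fun t => D.bx (D.T - t)) hD.weight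
    (hD.continuous_bx.comp (by fun_prop)) hD.T_pos.le hb₀ (fun t => hbb _)
    (u₀ := fun _ _ => 0) (k₀ := fun _ _ => 0) (fun _ => MemHa.zero _)
    (fun u ux k z => (D.α i * (y k (rev D.T z) - D.yd i k (rev D.T z))
        * ((D.Od i).indicator 1 (rev D.T z).1 : ℝ)
        - ∑ j, pd k (D.F j) (y 0 (rev D.T z), y 1 (rev D.T z)) * u j z)
      - D.beta (D.T - z.2) * (u k z + z.1 * ux k z)) (L := M + C)
    (fun u ux hu k => ((MemLp.rev (hD.memLp_observation hy i k)).sub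
      (memLp_finsetSum Finset.univ fun j _ =>
        hD.memLp_pd_mul (fun k => MemLp.rev (hy k)) (hu j).memLp k j)).sub
      (memLp_time_mul (wt := fun t => D.beta (D.T - t)) (hD.continuous_beta.comp (by fun_prop))
        ((hu k).memLp.add ((hu k).memLp_drift hD.weight))))
    (fun u ux w wx k z hz => by
      have h1 := hD.abs_beta_drift_le hβ hz.1 (D.T - z.2) (ux k z - wx k z)
      have h2 : |D.beta (D.T - z.2) * (u k z - w k z)| ≤ C * |u k z - w k z| := by
        rw [abs_mul]
        exact mul_le_mul_of_nonneg_right (hβ _) (abs_nonneg _)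
      have h3 : ∀ j, |pd k (D.F j) (y 0 (rev D.T z), y 1 (rev D.T z)) * (u j z - w j z)|
          ≤ M * |u j z - w j z| := fun j => by
        rw [abs_mul]
        exact mul_le_mul_of_nonneg_right (hpd _ _ _) (abs_nonneg _)
      have h4 : |u k z - w k z| ≤ ∑ j, |u j z - w j z| :=
        Finset.single_le_sum (f := fun j => |u j z - w j z|) (fun _ _ => abs_nonneg _)
          (Finset.mem_univ k)
      have h5 := mul_le_mul_of_nonneg_left h4 hC
      have h6 : 0 ≤ M * (√(D.a z.1) * |ux k z - wx k z|) := by positivity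
      have h7 := (h3 0)
      have h8 := (h3 1)
      simp only [Fin.sum_univ_two] at h5 ⊢
      rw [abs_le] at h1 h2 h7 h8 ⊢
      constructor <;> nlinarith)
  refine ⟨fun k z => u k (rev D.T z), fun k => ?_⟩
  refine (hD.isBackwardSol_iff (hD.memLp_adjoint_source hy
    (fun k => MemLp.rev (H k).memH.memLp) i k)).2
    ⟨fun z => ux k (rev D.T z), (H k).memH.rev, ?_⟩
  simp only [rev_rev]
  exact H k

end Adjoint

/-- The case `s = 0` forces `f 0 = c`. Thus `c` may be computed from any state, although `J` is
defined by a chosen one, and no separate uniqueness statement is required. -/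
theorem hasDerivAt_zero_of_abs_le_sq {f : ℝ → ℝ} {c d K : ℝ}
    (h : ∀ s, |f s - c - s * d| ≤ K * s ^ 2) : HasDerivAt f d 0 := by
  have h0 : f 0 = c := by
    have := h 0
    simp only [zero_mul, sub_zero, ne_eq, OfNat.ofNat_ne_zero, not_false_eq_true, zero_pow,
      mul_zero, abs_nonpos_iff] at this
    linarith
  rw [hasDerivAt_iff_isLittleO_nhds_zero]
  have h1 : (fun s : ℝ => f (0 + s) - f 0 - s • d) =O[𝓝 0] fun s => s ^ 2 :=
    Asymptotics.IsBigO.of_bound K (Eventually.of_forall fun s => by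
      simpa [h0, abs_of_nonneg (sq_nonneg s)] using h s)
  refine h1.trans_isLittleO ?_
  simpa using Asymptotics.isLittleO_pow_id (𝕜 := ℝ) (one_lt_two)

theorem integral_add_mul_add_mul {m : Measure (ℝ × ℝ)} {f g k : ℝ × ℝ → ℝ} (hf : Integrable f m)
    (hg : Integrable g m) (hk : Integrable k m) (c d : ℝ) :
    ∫ z, (f z + c * g z + d * k z) ∂m = (∫ z, f z ∂m) + c * (∫ z, g z ∂m) + d * ∫ z, k z ∂m := by
  rw [integral_add (f := fun z => f z + c * g z) (hf.add (hg.const_mul c)) (hk.const_mul d),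
    integral_add hf (hg.const_mul c), integral_const_mul, integral_const_mul]

/-! ### First order expansion of the costs -/

section Derivative

variable {D : Data} {h w : ℝ × ℝ → ℝ} {v v' y y' q : Fin 2 → ℝ × ℝ → ℝ} {i : Fin 2}

/-- The remainder of the first order expansion of `F_j` at `y`. -/
noncomputable def Data.remainder (D : Data) (y y' : Fin 2 → ℝ × ℝ → ℝ) (j : Fin 2) (z : ℝ × ℝ) :
    ℝ :=
  D.F j (y' 0 z, y' 1 z) - D.F j (y 0 z, y 1 z)
    - ∑ k, pd k (D.F j) (y 0 z, y 1 z) * (y' k z - y k z)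

theorem Data.Assumptions.exists_abs_remainder_le (hD : D.Assumptions) :
    ∃ M, 0 ≤ M ∧ ∀ (y y' : Fin 2 → ℝ × ℝ → ℝ) j z,
      |D.remainder y y' j z| ≤ M * (|y' 0 z - y 0 z| + |y' 1 z - y 1 z|) ^ 2 := by
  obtain ⟨M, hM, -, hF⟩ := hD.exists_F_bound
  refine ⟨M, hM, fun y y' j z => ?_⟩
  have := abs_taylor_le (hD.F_C2 j) (hF j) (y 0 z, y 1 z) (y' 0 z, y' 1 z)
  simpa [Data.remainder, Fin.sum_univ_two] using this

theorem Data.Assumptions.memLp_remainder (hD : D.Assumptions) (hy : ∀ k, MemLp (y k) 2 (Qm D.T))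
    (hy' : ∀ k, MemLp (y' k) 2 (Qm D.T)) (j : Fin 2) :
    MemLp (D.remainder y y' j) 2 (Qm D.T) :=
  ((hD.memLp_F hy' j).sub (hD.memLp_F hy j)).sub
    (memLp_finsetSum Finset.univ fun k _ => hD.memLp_pd_mul hy ((hy' k).sub (hy k)) k j)

/-- The variation of the observation term, expressed through the adjoint state. -/
theorem Data.Assumptions.integral_observation (hD : D.Assumptions)
    (hh : MemLp h 2 (volume.restrict (D.O ×ˢ Ioo 0 D.T)))
    (hv : ∀ i, MemLp (v i) 2 (volume.restrict (D.Of i ×ˢ Ioo 0 D.T)))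
    (hv' : ∀ i, MemLp (v' i) 2 (volume.restrict (D.Of i ×ˢ Ioo 0 D.T)))
    (H : D.IsState h v y) (H' : D.IsState h v' y') (hq : D.IsAdjoint y i q) :
    D.α i * ∫ z in D.Od i ×ˢ Ioo 0 D.T, ∑ k, (y k z - D.yd i k z) * (y' k z - y k z)
      = (∫ z, (D.src h v' 0 z - D.src h v 0 z) * q 0 z ∂Qm D.T)
        - ∫ z, ∑ j, D.remainder y y' j z * q j z ∂Qm D.T := by
  obtain ⟨yx, yx', hδ⟩ := hD.state_sub hh hv hv' H H'
  have hδL : ∀ k, MemLp (fun z => y' k z - y k z) 2 (Qm D.T) := fun k =>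
    (H'.memLp k).sub (H.memLp k)
  have hA := hD.memLp_adjoint_source H.memLp hq.memLp i
  have hf : ∀ k, MemLp (fun z => (D.src h v' k z - D.src h v k z)
      - (D.F k (y' 0 z, y' 1 z) - D.F k (y 0 z, y 1 z))) 2 (Qm D.T) := fun k =>
    ((hD.memLp_src hh hv' k).sub (hD.memLp_src hh hv k)).sub
      ((hD.memLp_F H'.memLp k).sub (hD.memLp_F H.memLp k))
  -- Duality is applied to the exact difference of the states, not to a linearisation. What remains
  -- after `DF(y) δ` cancels with the adjoint potential is the Taylor remainder.
  have dual := fun k => hD.duality (hf k) (hA k) ⟨_, (hδ k).2.2⟩ (hq k)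
  have iA : ∀ k, Integrable (fun z => (y' k z - y k z)
      * (D.α i * (y k z - D.yd i k z) * ((D.Od i).indicator 1 z.1 : ℝ)
        - ∑ j, pd k (D.F j) (y 0 z, y 1 z) * q j z)) (Qm D.T) := fun k =>
    MemLp.integrable_mul (hδL k) (hA k)
  have iF : ∀ k, Integrable (fun z => ((D.src h v' k z - D.src h v k z)
      - (D.F k (y' 0 z, y' 1 z) - D.F k (y 0 z, y 1 z))) * q k z) (Qm D.T) := fun k =>
    MemLp.integrable_mul (hf k) (hq.memLp k)
  have iX : Integrable (fun z => ∑ k, (y' k z - y k z)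
      * ∑ j, pd k (D.F j) (y 0 z, y 1 z) * q j z) (Qm D.T) :=
    integrable_finsetSum _ fun k _ => MemLp.integrable_mul (hδL k)
      (memLp_finsetSum Finset.univ fun j _ => hD.memLp_pd_mul H.memLp (hq.memLp j) k j)
  have iS : Integrable (fun z => (D.src h v' 0 z - D.src h v 0 z) * q 0 z) (Qm D.T) :=
    MemLp.integrable_mul ((hD.memLp_src hh hv' 0).sub (hD.memLp_src hh hv 0)) (hq.memLp 0)
  have iR : Integrable (fun z => ∑ j, D.remainder y y' j z * q j z) (Qm D.T) :=
    integrable_finsetSum _ fun j _ =>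
      MemLp.integrable_mul (hD.memLp_remainder H.memLp H'.memLp j) (hq.memLp j)
  have e1 : D.α i * ∫ z in D.Od i ×ˢ Ioo 0 D.T, ∑ k, (y k z - D.yd i k z) * (y' k z - y k z)
      = (∑ k, ∫ z, (y' k z - y k z)
          * (D.α i * (y k z - D.yd i k z) * ((D.Od i).indicator 1 z.1 : ℝ)
            - ∑ j, pd k (D.F j) (y 0 z, y 1 z) * q j z) ∂Qm D.T)
        + ∫ z, ∑ k, (y' k z - y k z) * ∑ j, pd k (D.F j) (y 0 z, y 1 z) * q j z ∂Qm D.T := by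
    rw [← integral_finsetSum _ fun k _ => iA k,
      ← integral_add (integrable_finsetSum _ fun k _ => iA k) iX,
      ← integral_indicator_mul (hD.Od_meas i) (hD.Od_sub i), ← integral_const_mul]
    congr 1; funext z
    simp only [Fin.sum_univ_two]
    ring
  have e2 : (∫ z, (D.src h v' 0 z - D.src h v 0 z) * q 0 z ∂Qm D.T)
        - ∫ z, ∑ j, D.remainder y y' j z * q j z ∂Qm D.T
      = (∑ k, ∫ z, ((D.src h v' k z - D.src h v k z)
          - (D.F k (y' 0 z, y' 1 z) - D.F k (y 0 z, y 1 z))) * q k z ∂Qm D.T)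
        + ∫ z, ∑ k, (y' k z - y k z) * ∑ j, pd k (D.F j) (y 0 z, y 1 z) * q j z ∂Qm D.T := by
    rw [← integral_finsetSum _ fun k _ => iF k,
      ← integral_add (integrable_finsetSum _ fun k _ => iF k) iX, ← integral_sub iS iR]
    congr 1; funext z
    simp only [Fin.sum_univ_two, Data.remainder, Data.src, one_ne_zero, if_true, if_false]
    ring
  rw [e1, e2]
  simp only [dual]

theorem Data.src_update_sub (D : Data) (h w : ℝ × ℝ → ℝ) (v : Fin 2 → ℝ × ℝ → ℝ) (i : Fin 2)
    (s : ℝ) (z : ℝ × ℝ) : D.src h (Function.update v i (v i + s • w)) 0 z - D.src h v 0 z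
      = s * (((D.Of i).indicator 1 z.1 : ℝ) * w z) := by
  simp only [Data.src, if_true, Fin.sum_univ_two]
  fin_cases i <;> simp <;> ring

theorem Data.Admissible.integrable_mul {u : ℝ × ℝ → ℝ} (hu : D.Admissible i u)
    (hw : D.Admissible i w) :
    Integrable (fun z => D.ρ z.2 ^ 2 * (u z * w z))
      (volume.restrict (D.Of i ×ˢ Ioo 0 D.T)) :=
  (MemLp.integrable_mul hu.2 hw.2).congr
    (Eventually.of_forall fun z => by simp only [Pi.mul_apply]; ring)

/-- The directional derivative of `J_i` in its own control, in terms of the adjoint state. -/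
theorem Data.Assumptions.hasDerivAt_J (hD : D.Assumptions)
    (hh : MemLp h 2 (volume.restrict (D.O ×ˢ Ioo 0 D.T)))
    (hv : ∀ i, MemLp (v i) 2 (volume.restrict (D.Of i ×ˢ Ioo 0 D.T)))
    (H : D.IsState h v y) (hq : D.IsAdjoint y i q) (hvi : D.Admissible i (v i))
    (hw : D.Admissible i w) :
    HasDerivAt (fun s : ℝ => D.J i h (Function.update v i (v i + s • w)))
      (∫ z in D.Of i ×ˢ Ioo 0 D.T, (q 0 z + D.μ i * D.ρ z.2 ^ 2 * v i z) * w z) 0 := by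
  obtain ⟨C, hC, hstab⟩ := hD.exists_state_stability hh
  obtain ⟨M, hM, hrem⟩ := hD.exists_abs_remainder_le
  set md : Measure (ℝ × ℝ) := volume.restrict (D.Od i ×ˢ Ioo 0 D.T) with hmd
  set mf : Measure (ℝ × ℝ) := volume.restrict (D.Of i ×ˢ Ioo 0 D.T) with hmf
  have hmd_le : md ≤ Qm D.T := restrict_le_Qm (hD.Od_sub i)
  have hmf_le : mf ≤ Qm D.T := restrict_le_Qm (hD.Of_sub i)
  have hfin : IsFiniteMeasure md := isFiniteMeasure_of_le _ hmd_le
  -- Chosen so that `|y' - y|² ≤ E s²` a.e. for the perturbation `s w`.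
  set E := C * ∫ z, (((D.Of i).indicator 1 z.1 : ℝ) * w z) ^ 2 ∂Qm D.T with hE
  have hE0 : 0 ≤ E := mul_nonneg hC (integral_nonneg fun z => sq_nonneg _)
  set P := ∫ z, (|q 0 z| + |q 1 z|) ∂Qm D.T with hP
  have iq : ∀ j, Integrable (q j) (Qm D.T) := fun j => (hq.memLp j).integrable (by norm_num)
  set R := ∫ z, D.ρ z.2 ^ 2 * (w z * w z) ∂mf with hR
  have ivv := hvi.integrable_mul hvi
  have ivw := hvi.integrable_mul hw
  have iww := hw.integrable_mul hw
  have iqw : Integrable (fun z => q 0 z * w z) mf :=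
    MemLp.integrable_mul ((hq.memLp 0).mono_measure hmf_le) hw.1
  refine hasDerivAt_zero_of_abs_le_sq
    (c := D.α i / 2 * (∫ z, ∑ k, (y k z - D.yd i k z) ^ 2 ∂md)
      + D.μ i / 2 * ∫ z, D.ρ z.2 ^ 2 * (v i z * v i z) ∂mf)
    (K := D.α i / 2 * (2 * E * md.real univ) + 4 * M * E * P + D.μ i / 2 * R) fun s => ?_
  set v' := Function.update v i (v i + s • w) with hv'd
  have hv'i : v' i = v i + s • w := Function.update_self ..
  have hv' : ∀ j, MemLp (v' j) 2 (volume.restrict (D.Of j ×ˢ Ioo 0 D.T)) := fun j => by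
    by_cases hj : j = i
    · subst hj
      rw [hv'i]
      exact (hv j).add (hw.1.const_smul s)
    · rw [hv'd, Function.update_of_ne hj]
      exact hv j
  have H' := hD.isState_state hh hv'
  set y' := D.state h v' with hy'
  have hδ : ∀ k, ∀ᵐ z ∂Qm D.T, (y' k z - y k z) ^ 2 ≤ E * s ^ 2 := fun k => by
    have e : C * ∫ z, (D.src h v' 0 z - D.src h v 0 z) ^ 2 ∂Qm D.T = E * s ^ 2 := by
      simp only [hv'd, D.src_update_sub, mul_pow s]
      rw [integral_const_mul, hE]
      ring
    rw [← e]
    exact hstab v v' y y' hv hv' H H' k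
  have obs := hD.integral_observation hh hv hv' H H' hq
  have e1 : ∫ z, (D.src h v' 0 z - D.src h v 0 z) * q 0 z ∂Qm D.T = s * ∫ z, q 0 z * w z ∂mf := by
    rw [← integral_indicator_mul (hD.Of_meas i) (hD.Of_sub i), ← integral_const_mul]
    congr 1; funext z
    rw [hv'd, D.src_update_sub]
    ring
  rw [e1] at obs
  -- The bound on `y' - y` is pointwise, so the remainder is at most `4 M E s²` a.e. and only the
  -- `L¹` norm `P` of the adjoint state is needed.
  have hrest : |∫ z, ∑ j, D.remainder y y' j z * q j z ∂Qm D.T| ≤ 4 * M * E * P * s ^ 2 := by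
    have h1 := norm_integral_le_of_norm_le (f := fun z => ∑ j, D.remainder y y' j z * q j z)
      (μ := Qm D.T) (((iq 0).abs.add (iq 1).abs).const_mul (4 * M * E * s ^ 2)) (by
        filter_upwards [hδ 0, hδ 1] with z h0 h1
        have h2 : (|y' 0 z - y 0 z| + |y' 1 z - y 1 z|) ^ 2 ≤ 4 * (E * s ^ 2) := by
          nlinarith [sq_abs (y' 0 z - y 0 z), sq_abs (y' 1 z - y 1 z),
            sq_nonneg (|y' 0 z - y 0 z| - |y' 1 z - y 1 z|)]
        have h3 : ∀ j, |D.remainder y y' j z| ≤ 4 * M * E * s ^ 2 := fun j =>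
          (hrem y y' j z).trans (by nlinarith [mul_le_mul_of_nonneg_left h2 hM])
        rw [Fin.sum_univ_two, Real.norm_eq_abs]
        refine (abs_add_le _ _).trans ?_
        simp only [abs_mul, Pi.add_apply, mul_add]
        exact add_le_add (mul_le_mul_of_nonneg_right (h3 0) (abs_nonneg _))
          (mul_le_mul_of_nonneg_right (h3 1) (abs_nonneg _)))
    rw [integral_const_mul] at h1
    refine h1.trans (le_of_eq ?_)
    rw [hP]
    simp only [Pi.add_apply]
    ring
  have hyd : ∀ k, MemLp (fun z => y k z - D.yd i k z) 2 md := fun k =>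
    ((H.memLp k).mono_measure hmd_le).sub (hD.yd_memLp i k)
  have hδd : ∀ k, MemLp (fun z => y' k z - y k z) 2 md := fun k =>
    ((H'.memLp k).sub (H.memLp k)).mono_measure hmd_le
  have e2 : ∫ z, ∑ k, (y' k z - D.yd i k z) ^ 2 ∂md
      = (∫ z, ∑ k, (y k z - D.yd i k z) ^ 2 ∂md)
        + 2 * (∫ z, ∑ k, (y k z - D.yd i k z) * (y' k z - y k z) ∂md)
        + ∫ z, ∑ k, (y' k z - y k z) ^ 2 ∂md := by
    have j1 : Integrable (fun z => ∑ k, (y k z - D.yd i k z) ^ 2) md :=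
      integrable_finsetSum _ fun k _ => (hyd k).integrable_sq
    have j2 : Integrable (fun z => ∑ k, (y k z - D.yd i k z) * (y' k z - y k z)) md :=
      integrable_finsetSum _ fun k _ => MemLp.integrable_mul (hyd k) (hδd k)
    have j3 : Integrable (fun z => ∑ k, (y' k z - y k z) ^ 2) md :=
      integrable_finsetSum _ fun k _ => (hδd k).integrable_sq
    rw [← one_mul (∫ z, ∑ k, (y' k z - y k z) ^ 2 ∂md), ← integral_add_mul_add_mul j1 j2 j3]
    congr 1; funext z
    simp only [Fin.sum_univ_two]
    ring
  have hquad : |∫ z, ∑ k, (y' k z - y k z) ^ 2 ∂md| ≤ 2 * E * md.real univ * s ^ 2 := by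
    have h1 := norm_integral_le_of_norm_le_const (μ := md) (C := 2 * (E * s ^ 2))
      (f := fun z => ∑ k, (y' k z - y k z) ^ 2) (by
        filter_upwards [ae_mono hmd_le (hδ 0), ae_mono hmd_le (hδ 1)] with z h0 h1
        rw [Fin.sum_univ_two, Real.norm_of_nonneg (by positivity)]
        linarith)
    refine h1.trans (le_of_eq ?_)
    ring
  have e3 : ∫ z, D.ρ z.2 ^ 2 * v' i z ^ 2 ∂mf
      = (∫ z, D.ρ z.2 ^ 2 * (v i z * v i z) ∂mf)
        + 2 * s * (∫ z, D.ρ z.2 ^ 2 * (v i z * w z) ∂mf) + s ^ 2 * R := by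
    rw [hR, ← integral_add_mul_add_mul ivv ivw iww]
    congr 1; funext z
    simp only [hv'i, Pi.add_apply, Pi.smul_apply, smul_eq_mul]
    ring
  have e4 : ∫ z, (q 0 z + D.μ i * D.ρ z.2 ^ 2 * v i z) * w z ∂mf
      = (∫ z, q 0 z * w z ∂mf) + D.μ i * ∫ z, D.ρ z.2 ^ 2 * (v i z * w z) ∂mf := by
    rw [← integral_const_mul, ← integral_add iqw (ivw.const_mul _)]
    congr 1; funext z
    ring
  have hα := hD.α_pos i
  -- The exact expansion: `obs` turns the cross term of the observation into the adjoint term, and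
  -- only terms of order `s²` are left on the right.
  have e5 : D.J i h v' - (D.α i / 2 * (∫ z, ∑ k, (y k z - D.yd i k z) ^ 2 ∂md)
        + D.μ i / 2 * ∫ z, D.ρ z.2 ^ 2 * (v i z * v i z) ∂mf)
      - s * ∫ z, (q 0 z + D.μ i * D.ρ z.2 ^ 2 * v i z) * w z ∂mf
      = D.α i / 2 * (∫ z, ∑ k, (y' k z - y k z) ^ 2 ∂md)
        - (∫ z, ∑ j, D.remainder y y' j z * q j z ∂Qm D.T) + D.μ i / 2 * R * s ^ 2 := by
    rw [Data.J, ← hy', ← hmd, ← hmf, e2, e3, e4]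
    linear_combination obs
  rw [e5]
  have hR0 : 0 ≤ D.μ i / 2 * R * s ^ 2 := by
    have : 0 ≤ R := integral_nonneg fun z => mul_nonneg (sq_nonneg _) (mul_self_nonneg _)
    have := hD.μ_pos i
    positivity
  have hq2 := mul_le_mul_of_nonneg_left hquad (half_pos hα).le
  rw [← abs_of_pos (half_pos hα), ← abs_mul, abs_of_pos (half_pos hα)] at hq2
  rw [abs_le] at hrest hq2 ⊢
  constructor <;> nlinarith [hrest.1, hrest.2, hq2.1, hq2.2]

end Derivative

/-! ### Characterisation of equilibria -/

section Equilibrium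

variable {D : Data} {h w p : ℝ × ℝ → ℝ} {v y : Fin 2 → ℝ × ℝ → ℝ} {i : Fin 2}

/-- Near both ends `ρ ≥ 1` because it blows up there; on the compact interval in between it attains
a positive minimum. -/
theorem Data.Assumptions.exists_rho_lower (hD : D.Assumptions) :
    ∃ c > 0, ∀ t ∈ Ioo 0 D.T, c ≤ D.ρ t := by
  have hT := hD.T_pos
  obtain ⟨e₁, he₁, h₁⟩ := (mem_nhdsGT_iff_exists_Ioo_subset).1
    (hD.ρ_zero.eventually (eventually_ge_atTop 1))
  obtain ⟨e₂, he₂, h₂⟩ := (mem_nhdsLT_iff_exists_Ioo_subset).1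
    (hD.ρ_T.eventually (eventually_ge_atTop 1))
  simp only [mem_Ioi, mem_Iio] at he₁ he₂
  have hsub : Icc (min e₁ (D.T / 2)) (max e₂ (D.T / 2)) ⊆ Ioo 0 D.T := fun t ht =>
    ⟨(lt_min he₁ (by linarith)).trans_le ht.1, ht.2.trans_lt (max_lt he₂ (by linarith))⟩
  obtain ⟨s, hs, hmin⟩ := isCompact_Icc.exists_isMinOn
    (s := Icc (min e₁ (D.T / 2)) (max e₂ (D.T / 2)))
    ⟨D.T / 2, min_le_right _ _, le_max_right _ _⟩ (hD.ρ_smooth.continuousOn.mono hsub)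
  refine ⟨min 1 (D.ρ s), lt_min one_pos (hD.ρ_pos s (hsub hs)), fun t ht => ?_⟩
  by_cases ht₁ : t < e₁
  · exact (min_le_left _ _).trans (h₁ ⟨ht.1, ht₁⟩)
  by_cases ht₂ : e₂ < t
  · exact (min_le_left _ _).trans (h₂ ⟨ht₂, ht.2⟩)
  · exact (min_le_right _ _).trans (hmin ⟨(min_le_left _ _).trans (not_lt.1 ht₁),
      (not_lt.1 ht₂).trans (le_max_left _ _)⟩)

theorem Data.Assumptions.aestronglyMeasurable_rho (hD : D.Assumptions) (i : Fin 2) :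
    AEStronglyMeasurable (fun z : ℝ × ℝ => D.ρ z.2) (volume.restrict (D.Of i ×ˢ Ioo 0 D.T)) :=
  (hD.ρ_smooth.continuousOn.comp continuousOn_snd fun _ hz => hz.2).aestronglyMeasurable
    ((hD.Of_meas i).prod measurableSet_Ioo)

theorem Data.Assumptions.ae_rho_pos (hD : D.Assumptions) (i : Fin 2) :
    ∀ᵐ z ∂volume.restrict (D.Of i ×ˢ Ioo 0 D.T), 0 < D.ρ z.2 := by
  filter_upwards [ae_restrict_mem ((hD.Of_meas i).prod measurableSet_Ioo)] with z hz
  exact hD.ρ_pos _ hz.2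

/-- The control given by the optimality condition has finite cost. -/
theorem Data.Assumptions.admissible_of_ae_eq (hD : D.Assumptions)
    (hw : MemLp w 2 (volume.restrict (D.Of i ×ˢ Ioo 0 D.T)))
    (hp : MemLp p 2 (volume.restrict (D.Of i ×ˢ Ioo 0 D.T)))
    (hwp : ∀ᵐ z ∂volume.restrict (D.Of i ×ˢ Ioo 0 D.T),
      w z = -(1 / D.μ i) * (D.ρ z.2 ^ 2)⁻¹ * p z) : D.Admissible i w := by
  obtain ⟨c, hc, hρ⟩ := hD.exists_rho_lower
  refine ⟨hw, hp.of_le_mul (c := 1 / D.μ i * c⁻¹) ((hD.aestronglyMeasurable_rho i).mul hw.1) ?_⟩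
  filter_upwards [hwp, ae_restrict_mem ((hD.Of_meas i).prod measurableSet_Ioo)] with z h1 hz
  have h2 := hρ _ hz.2
  have h3 := hD.ρ_pos _ hz.2
  have hμ := hD.μ_pos i
  have e : D.ρ z.2 * w z = -(1 / D.μ i * (D.ρ z.2)⁻¹ * p z) := by
    rw [h1]; field_simp
  rw [e, norm_neg, norm_mul, Real.norm_of_nonneg (by positivity)]
  gcongr

/-- If all directional derivatives vanish, the optimality condition holds. -/
theorem Data.Assumptions.ae_eq_of_forall_integral_eq_zero (hD : D.Assumptions)
    (hw : D.Admissible i w) (hp : MemLp p 2 (volume.restrict (D.Of i ×ˢ Ioo 0 D.T)))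
    (H : ∀ u, D.Admissible i u →
      ∫ z in D.Of i ×ˢ Ioo 0 D.T, (p z + D.μ i * D.ρ z.2 ^ 2 * w z) * u z = 0) :
    ∀ᵐ z ∂volume.restrict (D.Of i ×ˢ Ioo 0 D.T),
      w z = -(1 / D.μ i) * (D.ρ z.2 ^ 2)⁻¹ * p z := by
  have hμ := hD.μ_pos i
  have hρm := hD.aestronglyMeasurable_rho i
  -- The natural direction `p + μ ρ² w` need not be square integrable, as only `ρ w` is known to be.
  -- Division by `1 + ρ²` makes it admissible without changing where it vanishes.
  set u : ℝ × ℝ → ℝ := fun z => (1 + D.ρ z.2 ^ 2)⁻¹ * (p z + D.μ i * D.ρ z.2 ^ 2 * w z) with hu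
  have hum : AEStronglyMeasurable u (volume.restrict (D.Of i ×ˢ Ioo 0 D.T)) := by
    have h1 := hρm.aemeasurable
    have h2 := hp.1.aemeasurable
    have h3 := hw.1.1.aemeasurable
    exact (((h1.pow_const 2).const_add 1).inv.mul
      (h2.add (((h1.pow_const 2).const_mul (D.μ i)).mul h3))).aestronglyMeasurable
  -- Both bounds use that `1`, `r` and `r²` are at most `1 + r²`.
  have bound : ∀ r : ℝ, 0 < r → ∀ s t : ℝ,
      |(1 + r ^ 2)⁻¹ * (s + D.μ i * r ^ 2 * t)| ≤ |s| + D.μ i * |t| ∧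
      r * |(1 + r ^ 2)⁻¹ * (s + D.μ i * r ^ 2 * t)| ≤ |s| + D.μ i * (r * |t|) := by
    intro r hr s t
    have hr2 : 0 < 1 + r ^ 2 := by positivity
    have hs : |s + D.μ i * r ^ 2 * t| ≤ |s| + D.μ i * r ^ 2 * |t| := by
      refine (abs_add_le _ _).trans (le_of_eq ?_)
      rw [abs_mul, abs_of_pos (by positivity : 0 < D.μ i * r ^ 2)]
    have h0 : 0 ≤ D.μ i * |t| := by positivity
    rw [abs_mul, abs_of_pos (inv_pos.2 hr2)]
    constructor
    · rw [inv_mul_le_iff₀ hr2]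
      nlinarith [abs_nonneg s, mul_nonneg (sq_nonneg r) (abs_nonneg s)]
    · rw [mul_left_comm, inv_mul_le_iff₀ hr2]
      have h1 : r * |s| ≤ (1 + r ^ 2) * |s| :=
        mul_le_mul_of_nonneg_right (by nlinarith [sq_nonneg (r - 1)]) (abs_nonneg s)
      have h2 := mul_le_mul_of_nonneg_left hs hr.le
      have h3 : 0 ≤ D.μ i * (r * |t|) := by positivity
      nlinarith
  have hua : D.Admissible i u := by
    refine ⟨(hp.norm.add (hw.1.norm.const_mul (D.μ i))).of_le hum ?_,
      (hp.norm.add (hw.2.norm.const_mul (D.μ i))).of_le (hρm.mul hum) ?_⟩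
    · filter_upwards [hD.ae_rho_pos i] with z hz
      refine ((bound _ hz (p z) (w z)).1).trans (le_of_le_of_eq (le_abs_self _) ?_)
      simp
    · filter_upwards [hD.ae_rho_pos i] with z hz
      rw [norm_mul, Real.norm_of_nonneg hz.le]
      refine ((bound _ hz (p z) (w z)).2).trans (le_of_le_of_eq (le_abs_self _) ?_)
      simp [abs_of_pos hz]
  have h_int : Integrable (fun z => (p z + D.μ i * D.ρ z.2 ^ 2 * w z) * u z)
      (volume.restrict (D.Of i ×ˢ Ioo 0 D.T)) := by
    refine ((MemLp.integrable_mul hp hua.1).add ((hw.integrable_mul hua).const_mul (D.μ i))).congr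
      (Eventually.of_forall fun z => ?_)
    simp only [Pi.add_apply, Pi.mul_apply]
    ring
  have hsq : ∀ z, (p z + D.μ i * D.ρ z.2 ^ 2 * w z) * u z
      = (1 + D.ρ z.2 ^ 2)⁻¹ * (p z + D.μ i * D.ρ z.2 ^ 2 * w z) ^ 2 := fun z => by
    rw [hu]; ring
  have h0 := (integral_eq_zero_iff_of_nonneg (fun z => by
    rw [hsq z]; exact mul_nonneg (by positivity) (sq_nonneg _)) h_int).1 (H u hua)
  filter_upwards [h0, hD.ae_rho_pos i] with z hz hρ
  rw [hsq z] at hz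
  have h1 : p z + D.μ i * D.ρ z.2 ^ 2 * w z = 0 := by
    rcases mul_eq_zero.1 hz with h2 | h2
    · have : 0 < (1 + D.ρ z.2 ^ 2)⁻¹ := by positivity
      exact absurd h2 this.ne'
    · exact pow_eq_zero_iff two_ne_zero |>.1 h2
  have h2 : p z = -(D.μ i * D.ρ z.2 ^ 2 * w z) := by linarith
  rw [h2]
  field_simp

/-- From an equilibrium, the chosen state and any adjoint states along it provide `y` and `p`, and
vanishing derivatives give the formula. Conversely, the formula makes `y` a state for `v` itself and
the integrand of the derivative zero. -/
theorem Data.Assumptions.isNashQuasiEquilibrium_iff (hD : D.Assumptions)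
    (hh : MemLp h 2 (volume.restrict (D.O ×ˢ Ioo 0 D.T)))
    (hv : ∀ i, MemLp (v i) 2 (volume.restrict (D.Of i ×ˢ Ioo 0 D.T))) :
    D.IsNashQuasiEquilibrium h v ↔
      ∃ (y : Fin 2 → ℝ × ℝ → ℝ) (p : Fin 2 → Fin 2 → ℝ × ℝ → ℝ),
        D.IsState h (fun i z => -(1 / D.μ i) * (D.ρ z.2 ^ 2)⁻¹ * p i 0 z) y ∧
        (∀ i, D.IsAdjoint y i (p i)) ∧
        ∀ i, ∀ᵐ z ∂volume.restrict (D.Of i ×ˢ Ioo 0 D.T),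
          v i z = -(1 / D.μ i) * (D.ρ z.2 ^ 2)⁻¹ * p i 0 z := by
  constructor
  · intro H
    have hy := hD.isState_state hh hv
    choose p hp using hD.exists_isAdjoint hy.memLp
    have hvp : ∀ i, ∀ᵐ z ∂volume.restrict (D.Of i ×ˢ Ioo 0 D.T),
        v i z = -(1 / D.μ i) * (D.ρ z.2 ^ 2)⁻¹ * p i 0 z := fun i =>
      hD.ae_eq_of_forall_integral_eq_zero (H i).1
        (((hp i).memLp 0).mono_measure (restrict_le_Qm (hD.Of_sub i)))
        fun u hu => (hD.hasDerivAt_J hh hv hy (hp i) (H i).1 hu).unique ((H i).2 u hu)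
    exact ⟨D.state h v, p, hD.isState_congr hh hv hvp hy, hp, hvp⟩
  · rintro ⟨y, p, hy, hp, hvp⟩ i
    have hpi : ∀ i, MemLp (p i 0) 2 (volume.restrict (D.Of i ×ˢ Ioo 0 D.T)) := fun i =>
      ((hp i).memLp 0).mono_measure (restrict_le_Qm (hD.Of_sub i))
    have hvi := hD.admissible_of_ae_eq (hv i) (hpi i) (hvp i)
    have hyv : D.IsState h v y := hD.isState_congr hh (fun j => (hv j).ae_eq (hvp j))
      (fun j => (hvp j).mono fun _ hz => hz.symm) hy
    refine ⟨hvi, fun w hw => ?_⟩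
    have hd := hD.hasDerivAt_J hh hv hyv (hp i) hvi hw
    rwa [integral_eq_zero_of_ae] at hd
    filter_upwards [hvp i, hD.ae_rho_pos i] with z hz hρ
    have hμ := hD.μ_pos i
    have e : p i 0 z + D.μ i * D.ρ z.2 ^ 2 * v i z = 0 := by
      rw [hz]; field_simp; ring
    simp [e]

end Equilibrium

end StackelbergNash

theorem mainTheorem7 (D : StackelbergNash.Data) (hD : D.Assumptions)
    (h : ℝ × ℝ → ℝ)
    (hh : MeasureTheory.MemLp h 2
      (MeasureTheory.volume.restrict (D.O ×ˢ Set.Ioo 0 D.T)))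
    (v : Fin 2 → ℝ × ℝ → ℝ)
    (hv : ∀ i, MeasureTheory.MemLp (v i) 2
      (MeasureTheory.volume.restrict (D.Of i ×ˢ Set.Ioo 0 D.T))) :
    D.IsNashQuasiEquilibrium h v ↔
      ∃ (y : Fin 2 → ℝ × ℝ → ℝ) (p : Fin 2 → Fin 2 → ℝ × ℝ → ℝ),
        D.IsState h (fun i z => -(1 / D.μ i) * (D.ρ z.2 ^ 2)⁻¹ * p i 0 z) y ∧
        (∀ i, D.IsAdjoint y i (p i)) ∧
        ∀ i, ∀ᵐ z ∂MeasureTheory.volume.restrict (D.Of i ×ˢ Set.Ioo 0 D.T),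
          v i z = -(1 / D.μ i) * (D.ρ z.2 ^ 2)⁻¹ * p i 0 z :=
  hD.isNashQuasiEquilibrium_iff hh hv
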